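/- **Notation.** Let $K$ be a field (for example $K=\mathbb C$, or a field of rational functions in formal parameters), let $n\ge 1$ and $r\ge 0$ be integers, and let $q,t\in K$ be nonzero parameters, with a chosen square root $q^{1/2}\in K$, such that $t^aq^b\ne 1$ for all integers $0\le a\le n$, $b\ge 0$ with $(a,b)\neq(0,0)$. (For $K=\mathbb C$ this holds for instance whenever $0<|q|<1$ and $0<|t|<1$.) Write $(z;q)_k=\prod_{i=0}^{k-1}(1-zq^i)$. For parameters $a,b,c,d,q,t$ put $\alpha=(abcd/q)^{1/2}$. *Koornwinder's operator* in the independent variables $x=(x_1,\dots,x_n)$ is $$\mathcal D_x=\sum_{i=1}^n A_i(x_i)\,(T_{q,x_i}-1)+\sum_{i=1}^n A_i(x_i^{-1})\,(T_{q^{-1},x_i}-1),$$ $$A_i(y)=\frac{(1-ay)(1-by)(1-cy)(1-dy)}{\alpha t^{n-1}(1-y^2)(1-qy^2)}\prod_{j\ne i}\frac{(1-tyx_j)(1-ty/x_j)}{(1-yx_j)(1-y/x_j)},$$ where $T_{q^{\pm1},x_i}$ replaces $x_i$ by $q^{\pm1}x_i$. For a partition $\lambda=(\lambda_1\ge\dots\ge\lambda_n\ge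 0)$ let $m_\lambda$ be the sum of the distinct monomials in the orbit of $x^\lambda$ under $W=S_n\ltimes(\mathbb Z/2\mathbb Z)^n$ (permutations and inversions of the variables), and let $$d_\lambda=\sum_{j=1}^n\langle \alpha t^{n-j}q^{\lambda_j};\alpha t^{n-j}\rangle,\qquad \langle x;y\rangle=x+x^{-1}-y-y^{-1}.$$ Write $\mu<\lambda$ if $\mu\ne\lambda$ and $\mu_1+\dots+\mu_k\le\lambda_1+\dots+\lambda_k$ for $1\le k\le n$. A *Koornwinder polynomial* with index $\lambda$ is a $W$-invariant Laurent polynomial $P$ over $K$ in $x$ such that (a) $P=m_\lambda+\sum_{\mu<\lambda}u_{\mu}m_\mu$ for some $u_\mu\in K$, and (b) $\mathcal D_xP=d_\lambda P$. The *Macdonald polynomial* $P^{(D_n)}_{\lambda}(x;q,t)$ of type $D_n$ is the Koornwinder polynomial with $(a,b,c,d)=(-1,1,-q^{1/2},q^{1/2})$, so that $\alpha=1$. Let $(r)=(r,0,\dots,0)$. **Theorem.** Let $$ \Psi_r(x)=\frac{(q;q)_r}{(t;q)_r}\sum_{\theta}\ \prod_{k\in I}\frac{(t;q)_{\theta_k}}{(q;q)_{\theta_k}}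 \prod_{1\le l\le n-1}\frac{(t^{n-l-1}q^{\theta_l+A_l+1};q)_{\theta_{\bar l}}\,(t^{n-l}q^{A_l};q)_{\theta_{\bar l}}}{(t^{n-l}q^{\theta_l+A_l};q)_{\theta_{\bar l}}\,(t^{n-l-1}q^{A_l+1};q)_{\theta_{\bar l}}}\; x_1^{\theta_1-\theta_{\bar 1}}\cdots x_n^{\theta_n-\theta_{\bar n}}, $$ where $I=\{1,\dots,n,\bar n,\dots,\bar 1\}$, the sum is over all $\theta=(\theta_k)_{k\in I}$ of nonnegative integers with $\sum_{k\in I}\theta_k=r$ and $\theta_n\theta_{\bar n}=0$, and $A_l=\sum_{k=l+1}^n(\theta_k+\theta_{\bar k})$. Then $$P^{(D_n)}_{(r)}(x;q,t)=\Psi_r(x).$$ More precisely, $\Psi_r$ is $W$-invariant and satisfies (a) and (b) for $\lambda=(r)$ and $(a,b,c,d)=(-1,1,-q^{1/2},q^{1/2})$; and if moreover $d_\mu\ne d_{(r)}$ (with $\alpha=1$) for all partitions $\mu<(r)$, then $\Psi_r$ is the only $W$-invariant Laurent polynomial with these two properties. -/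

import Mathlib

noncomputable section

namespace OneRowD

/-- The `q`-shifted factorial `(z;q)_k = (1 - z)(1 - qz)⋯(1 - q^{k-1}z)` for `k ≥ 0`. -/
def qPoch {K : Type*} [Field K] (z q : K) (k : ℕ) : K :=
  ∏ i ∈ Finset.range k, (1 - z * q ^ i)

/-- Laurent polynomials in the independent indeterminates `x_1, …, x_n` over `K`:
the exponent vector `m : Fin n → ℤ` stands for `x_1^{m_1} ⋯ x_n^{m_n}`.
The variable `x_{i+1}` is indexed by `i : Fin n`. -/
abbrev Laurent (K : Type*) [Field K] (n : ℕ) : Type _ := AddMonoidAlgebra K (Fin n → ℤ)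

/-- The field of rational functions in `x_1, …, x_n`. -/
abbrev RatFun (K : Type*) [Field K] (n : ℕ) : Type _ := FractionRing (Laurent K n)

variable {K : Type*} [Field K] {n : ℕ}

/-- The monomial `x^m`. -/
def mono (m : Fin n → ℤ) : Laurent K n := AddMonoidAlgebra.single m 1

/-- The variable `x_i`, as a rational function. -/
def X (i : Fin n) : RatFun K n := algebraMap (Laurent K n) (RatFun K n) (mono (Pi.single i 1))

/-- A scalar, as a rational function. -/
def scal (c : K) : RatFun K n := algebraMap K (RatFun K n) c

/-- The shift operator `T_{c,x_i}`, `f(…, x_i, …) ↦ f(…, c x_i, …)`, on Laurent polynomials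
(`c ≠ 0`): it multiplies the coefficient of `x^m` by `c^{m_i}`. -/
def shift (c : K) (i : Fin n) (f : Laurent K n) : Laurent K n :=
  f.coeff.sum fun m a => AddMonoidAlgebra.single m (a * c ^ m i)

theorem shift_single (c : K) (i : Fin n) (m : Fin n → ℤ) (a : K) :
    shift c i (AddMonoidAlgebra.single m a) = AddMonoidAlgebra.single m (a * c ^ m i) := by
  simp [shift]

/-- The coefficient functions of Koornwinder's operator: the coefficient of `T_{q,x_i} - 1` is
obtained for `y = x_i`, that of `T_{q⁻¹,x_i} - 1` for `y = 1/x_i`, in the expression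
`(1-ay)(1-by)(1-cy)(1-dy) / (α t^{n-1} (1-y²)(1-qy²)) * ∏_{j≠i} (1-t y x_j)(1-t y/x_j) / ((1-y x_j)(1-y/x_j))`. -/
def koornwinderCoeff (a b c d α q t : K) (i : Fin n) (y : RatFun K n) : RatFun K n :=
  ((1 - scal a * y) * (1 - scal b * y) * (1 - scal c * y) * (1 - scal d * y)) /
      (scal (α * t ^ (n - 1)) * (1 - y ^ 2) * (1 - scal q * y ^ 2)) *
    ∏ j ∈ Finset.univ.erase i,
      ((1 - scal t * y * X j) * (1 - scal t * y / X j)) / ((1 - y * X j) * (1 - y / X j))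

/-- Koornwinder's `q`-difference operator `𝒟_x(a,b,c,d|q,t)`, applied to a Laurent polynomial.
Here `α` is a square root of `abcd/q`. -/
def koornwinderOp (a b c d α q t : K) (f : Laurent K n) : RatFun K n :=
  ∑ i : Fin n,
      koornwinderCoeff a b c d α q t i (X i) *
        algebraMap (Laurent K n) (RatFun K n) (shift q i f - f) +
    ∑ i : Fin n,
      koornwinderCoeff a b c d α q t i (X i)⁻¹ *
        algebraMap (Laurent K n) (RatFun K n) (shift q⁻¹ i f - f)

/-- `⟨x; y⟩ = x + x⁻¹ - y - y⁻¹`. -/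
def bracket (x y : K) : K := x + x⁻¹ - y - y⁻¹

/-- Koornwinder's eigenvalue `d_λ = ∑_{j=1}^n ⟨α t^{n-j} q^{λ_j}; α t^{n-j}⟩`. -/
def koornwinderEigenvalue (α q t : K) (lam : Fin n → ℕ) : K :=
  ∑ j : Fin n, bracket (α * t ^ (n - 1 - (j : ℕ)) * q ^ lam j) (α * t ^ (n - 1 - (j : ℕ)))

/-- The action of `(σ, ε) ∈ S_n ⋉ (ℤ/2ℤ)^n` on exponent vectors. -/
def signedPerm (σ : Equiv.Perm (Fin n)) (ε : Fin n → ℤˣ) (m : Fin n → ℤ) : Fin n → ℤ :=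
  fun i => (ε i : ℤ) * m (σ i)

/-- The `S_n ⋉ (ℤ/2ℤ)^n`-orbit of a partition. -/
def orbit (lam : Fin n → ℕ) : Finset (Fin n → ℤ) :=
  Finset.univ.image fun g : Equiv.Perm (Fin n) × (Fin n → ℤˣ) =>
    signedPerm g.1 g.2 fun i => (lam i : ℤ)

/-- The monomial symmetric Laurent polynomial `m_λ`. -/
def monoSymm (K : Type*) [Field K] {n : ℕ} (lam : Fin n → ℕ) : Laurent K n :=
  ∑ m ∈ orbit lam, mono m

/-- Strict dominance order on partitions with at most `n` parts (not necessarily of equal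
weight): `μ ≠ λ` and `μ_1 + ⋯ + μ_k ≤ λ_1 + ⋯ + λ_k` for `k = 1, …, n`. -/
def DomLT (mu lam : Fin n → ℕ) : Prop :=
  mu ≠ lam ∧ ∀ k : Fin n, ∑ i ∈ Finset.Iic k, mu i ≤ ∑ i ∈ Finset.Iic k, lam i

/-- `P` is a Koornwinder polynomial `P_λ(x;a,b,c,d,q,t)`; partitions are antitone
functions `Fin n → ℕ`, and `α` is a square root of `abcd/q`. -/
structure IsKoornwinder (a b c d α q t : K) (lam : Fin n → ℕ) (P : Laurent K n) : Prop where
  invariant : ∀ (σ : Equiv.Perm (Fin n)) (ε : Fin n → ℤˣ) (m : Fin n → ℤ),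
    P.coeff (signedPerm σ ε m) = P.coeff m
  triangular : ∃ u : (Fin n → ℕ) →₀ K,
    (∀ mu ∈ u.support, Antitone mu ∧ DomLT mu lam) ∧
      P = monoSymm K lam + u.sum fun mu e => e • monoSymm K mu
  eigen : koornwinderOp a b c d α q t P =
    scal (koornwinderEigenvalue α q t lam) * algebraMap (Laurent K n) (RatFun K n) P

/-- `P` is a Macdonald polynomial `P_λ^{(D_n)}(x;q,t)`, where `q = s²`: the Koornwinder
polynomial with `(a,b,c,d) = (-1, 1, -q^{1/2}, q^{1/2})`, for which `abcd/q = 1` and `α = 1`. -/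
def IsMacdonaldD (s t : K) (lam : Fin n → ℕ) (P : Laurent K n) : Prop :=
  IsKoornwinder (-1) 1 (-s) s 1 (s ^ 2) t lam P

/-- The one-row partition `(r) = (r, 0, …, 0)`. -/
def oneRow (n r : ℕ) : Fin n → ℕ := fun i => if (i : ℕ) = 0 then r else 0

/-- The index set `I = {1, …, n, n̄, …, 1̄}`: `Sum.inl i` is the letter `i + 1` and
`Sum.inr i` is the barred letter. -/
abbrev Letter (n : ℕ) : Type := Fin n ⊕ Fin n

/-- One-row fillings of size `r` of type `D_n`, given by the multiplicities `θ_k` of the letters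
`k ∈ I`: `∑_k θ_k = r` and `θ_n θ_{n̄} = 0`. -/
def fillings (n r : ℕ) : Finset (Letter n → ℕ) :=
  {θ ∈ Finset.univ.piAntidiag r |
    ∀ i : Fin n, (i : ℕ) + 1 = n → θ (Sum.inl i) * θ (Sum.inr i) = 0}

/-- `θ_{l+1} + ⋯ + θ_n + θ_{n̄} + ⋯ + θ_{\overline{l+1}}`. -/
def innerSum (θ : Letter n → ℕ) (l : Fin n) : ℕ :=
  ∑ k ∈ Finset.Ioi l, (θ (Sum.inl k) + θ (Sum.inr k))

/-- The `l`-th factor of the weight of a filling; for `l : Fin n` the number `n - l` of the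
one-based formula is `n - (l + 1)`. -/
def factor (q t : K) (θ : Letter n → ℕ) (l : Fin n) : K :=
  (qPoch (t ^ (n - ((l : ℕ) + 1) - 1) * q ^ (θ (Sum.inl l) + innerSum θ l + 1)) q (θ (Sum.inr l)) *
      qPoch (t ^ (n - ((l : ℕ) + 1)) * q ^ innerSum θ l) q (θ (Sum.inr l))) /
    (qPoch (t ^ (n - ((l : ℕ) + 1)) * q ^ (θ (Sum.inl l) + innerSum θ l)) q (θ (Sum.inr l)) *
      qPoch (t ^ (n - ((l : ℕ) + 1) - 1) * q ^ (innerSum θ l + 1)) q (θ (Sum.inr l)))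

/-- The tableau sum of type `D_n` for the one-row diagram `(r)`. -/
def tableauSum (n r : ℕ) (q t : K) : Laurent K n :=
  (qPoch q q r / qPoch t q r) •
    ∑ θ ∈ fillings n r,
      ((∏ k : Letter n, qPoch t q (θ k) / qPoch q q (θ k)) *
          ∏ l ∈ Finset.univ.filter (fun l : Fin n => (l : ℕ) + 1 < n), factor q t θ l) •
        mono fun i => (θ (Sum.inl i) : ℤ) - (θ (Sum.inr i) : ℤ)

end OneRowD

end

/-! Attach to each of the `2n` letters `z = x_i^{±1}` the series `∑_k (t;q)_k/(q;q)_k (zu)^k`, and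
let the kernel function `G(x;u) = ∑_r g_r u^r` be their product. It is invariant under signed
permutations. Let `P_m` (`oneRowFun`) be the tableau sum without the normalising factor
`(q;q)_m/(t;q)_m`; removing the letters `1` and its bar from a filling expresses it through the same
functions in one variable less (`fillingSum_eq`).

Expansion. `G = ∑_m F_m(u²) P_m u^m`, where `F_m` is an explicit series with constant term `1`
(`kernelCoeff_expansion`). By induction on the number of variables this reduces to one identity
between terminating basic hypergeometric sums (`sum_binCoeff_branch`). That identity is proved by
interpolation (`termDiff_eq_zero`): for fixed `p = UV` it is polynomial in `U` of degree at most
`2N`, and it holds at `2N + 1` points, at most of which it reduces to a smaller instance of itself.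
Since the expansion is unitriangular, the invariance of `G` passes to every `P_m`
(`signedMap_oneRowFun`), although the tableau formula does not display it.

Eigenvalue equation. For the parameters of type `D_n` the numerator of Koornwinder's coefficient
cancels against `(1-y²)(1-qy²)`. A shift of one variable multiplies `G` by a rational function of
the letter, so partial fractions (`sum_shiftWeight_div`) convert the operator in `x`, applied to
`G`, into a `q`-difference operator in `u` (`sum_shiftWeight_kernel`, `kernelVal_equation`). Each
`u^m F_m(u²)` is an eigenfunction of the latter, with the eigenvalue expected of `P_m`
(`connSeries_equation`). Hence `∑_m F_m(u²) u^m (𝒟 P_m - d_{(m)} P_m) = 0`, and unitriangularity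
makes every bracket vanish (`shiftOp_oneRowFun`).

Triangularity. Being dominated by `(r)` only means having weight at most `r`, so it follows from
invariance, a degree bound and the coefficient of `x_1^r` (`triangular_of_invariant`,
`coeff_tableauSum_oneRow`).

Uniqueness. Expanded for `x_1 ≫ x_2 ≫ ⋯`, the operator multiplies the lexicographically leading
coefficient at a partition `μ` by `d_μ` (`ratLead_shiftOp`, `sum_weightLead`). The leading exponent
of a difference of two solutions is a partition `μ < λ`, which forces `d_μ = d_λ`. -/

noncomputable section
namespace OneRowD
variable {K : Type*} [Field K]

/-! ### Shifted factorials -/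

@[simp] theorem qPoch_zero (z q : K) : qPoch z q 0 = 1 := by simp [qPoch]

theorem qPoch_succ (z q : K) (k : ℕ) : qPoch z q (k + 1) = qPoch z q k * (1 - z * q ^ k) := by
  simp [qPoch, Finset.prod_range_succ]

theorem qPoch_add (z q : K) (a b : ℕ) :
    qPoch z q (a + b) = qPoch z q a * qPoch (z * q ^ a) q b := by
  simp only [qPoch, Finset.prod_range_add, pow_add, mul_assoc]

theorem qPoch_ne_zero {z q : K} {k : ℕ} (h : ∀ i < k, z * q ^ i ≠ 1) : qPoch z q k ≠ 0 :=
  Finset.prod_ne_zero_iff.mpr fun i hi =>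
    sub_ne_zero.mpr (h i (Finset.mem_range.mp hi)).symm

theorem qPoch_eq_zero {z q : K} {k i : ℕ} (hi : i < k) (h : z * q ^ i = 1) : qPoch z q k = 0 :=
  Finset.prod_eq_zero (Finset.mem_range.mpr hi) (by rw [h, sub_self])

theorem qPoch_self_ne_zero {q : K} (hq : ∀ j, 1 ≤ j → q ^ j ≠ 1) (k : ℕ) : qPoch q q k ≠ 0 :=
  qPoch_ne_zero fun i _ => by rw [← pow_succ']; exact hq _ (by omega)

/-- The coefficient `(t;q)_k / (q;q)_k` of the `q`-binomial series. -/
def binCoeff (q t : K) (k : ℕ) : K := qPoch t q k / qPoch q q k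

@[simp] theorem binCoeff_zero (q t : K) : binCoeff q t 0 = 1 := by simp [binCoeff]

/-! ### Functions of one variable that are regular at a point -/

/-- `f` is given by a rational function without a pole at `a`. -/
def RegularAt (f : K → K) (a : K) : Prop :=
  ∃ p d : Polynomial K, d.eval a ≠ 0 ∧ ∀ x, d.eval x ≠ 0 → f x * d.eval x = p.eval x

namespace RegularAt
variable {f g : K → K} {a : K}

theorem const (c a : K) : RegularAt (fun _ => c) a := ⟨Polynomial.C c, 1, by simp, by simp⟩

theorem id (a : K) : RegularAt (fun x => x) a := ⟨Polynomial.X, 1, by simp, by simp⟩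

theorem mul (hf : RegularAt f a) (hg : RegularAt g a) : RegularAt (fun x => f x * g x) a := by
  obtain ⟨p, d, hd, h⟩ := hf
  obtain ⟨p', d', hd', h'⟩ := hg
  refine ⟨p * p', d * d', by simp [hd, hd'], fun x hx => ?_⟩
  simp only [Polynomial.eval_mul, mul_ne_zero_iff] at hx ⊢
  rw [← h x hx.1, ← h' x hx.2]; ring

theorem add (hf : RegularAt f a) (hg : RegularAt g a) : RegularAt (fun x => f x + g x) a := by
  obtain ⟨p, d, hd, h⟩ := hf
  obtain ⟨p', d', hd', h'⟩ := hg
  refine ⟨p * d' + p' * d, d * d', by simp [hd, hd'], fun x hx => ?_⟩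
  simp only [Polynomial.eval_mul, Polynomial.eval_add, mul_ne_zero_iff] at hx ⊢
  rw [← h x hx.1, ← h' x hx.2]; ring

theorem sub (hf : RegularAt f a) (hg : RegularAt g a) : RegularAt (fun x => f x - g x) a := by
  simpa [sub_eq_add_neg] using hf.add ((const (-1) a).mul hg)

theorem div (hf : RegularAt f a) (hg : RegularAt g a) (h0 : g a ≠ 0) :
    RegularAt (fun x => f x / g x) a := by
  obtain ⟨p, d, hd, h⟩ := hf
  obtain ⟨p', d', hd', h'⟩ := hg
  have h1 : p'.eval a ≠ 0 := by rw [← h' a hd']; exact mul_ne_zero h0 hd'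
  -- The factor `p'` of the denominator excludes the zeros of `g`, where the quotient takes the
  -- default value `0`.
  refine ⟨p * d' * d', d * d' * p', by simp [hd, hd', h1], fun x hx => ?_⟩
  simp only [Polynomial.eval_mul, mul_ne_zero_iff] at hx ⊢
  obtain ⟨⟨hx1, hx2⟩, hx3⟩ := hx
  have hg : g x ≠ 0 := fun h0 => hx3 (by rw [← h' x hx2, h0, zero_mul])
  rw [← h x hx1, ← h' x hx2]
  field_simp

theorem prod {ι : Type*} (s : Finset ι) {f : ι → K → K} (h : ∀ i ∈ s, RegularAt (f i) a) :
    RegularAt (fun x => ∏ i ∈ s, f i x) a := by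
  classical
  induction s using Finset.induction_on with
  | empty => simpa using const 1 a
  | insert i s hi ih =>
    simp only [Finset.prod_insert hi]
    exact (h i (by simp)).mul (ih fun j hj => h j (by simp [hj]))

theorem sum {ι : Type*} (s : Finset ι) {f : ι → K → K} (h : ∀ i ∈ s, RegularAt (f i) a) :
    RegularAt (fun x => ∑ i ∈ s, f i x) a := by
  classical
  induction s using Finset.induction_on with
  | empty => simpa using const 0 a
  | insert i s hi ih =>
    simp only [Finset.sum_insert hi]
    exact (h i (by simp)).add (ih fun j hj => h j (by simp [hj]))

theorem qPoch (hf : RegularAt f a) (q : K) (k : ℕ) :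
    RegularAt (fun x => OneRowD.qPoch (f x) q k) a :=
  prod _ fun _ _ => (const 1 a).sub (hf.mul (const _ a))

theorem binCoeff (hf : RegularAt f a) {q : K} (hq : ∀ j, 1 ≤ j → q ^ j ≠ 1) (k : ℕ) :
    RegularAt (fun x => OneRowD.binCoeff q (f x) k) a :=
  (hf.qPoch q k).div (const _ a) (qPoch_self_ne_zero hq k)

/-- A polynomial with infinitely many roots is zero. Thus an identity known for all but finitely
many values of a parameter extends to every value where it is regular. -/
theorem eq_zero [Infinite K] (hf : RegularAt f a) (s : Finset K) (h : ∀ x ∉ s, f x = 0) :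
    f a = 0 := by
  obtain ⟨p, d, hd, hpd⟩ := hf
  have h0 : p * d = 0 := by
    refine Polynomial.eq_zero_of_infinite_isRoot _ ((s.finite_toSet.infinite_compl).mono ?_)
    intro x hx
    by_cases hdx : d.eval x = 0
    · simp [Polynomial.IsRoot, hdx]
    · have := hpd x hdx
      rw [h x (by simpa using hx), zero_mul] at this
      simp [Polynomial.IsRoot, ← this]
  have hd0 : d ≠ 0 := fun h => hd (by simp [h])
  have := hpd a hd
  rw [(mul_eq_zero.mp h0).resolve_right hd0, Polynomial.eval_zero] at this
  exact (mul_eq_zero.mp this).resolve_right hd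

end RegularAt

/-! ### Polynomial functions of bounded degree -/

/-- Away from `0` the function `f` is a polynomial of degree at most `d`. -/
def PolyLe (d : ℕ) (f : K → K) : Prop :=
  ∃ p : Polynomial K, p.natDegree ≤ d ∧ ∀ x, x ≠ 0 → p.eval x = f x

namespace PolyLe
variable {f g : K → K} {d e : ℕ}

theorem const_mul (c : K) (hf : PolyLe d f) : PolyLe d (fun x => c * f x) := by
  obtain ⟨p, hp, h⟩ := hf
  exact ⟨Polynomial.C c * p, (Polynomial.natDegree_C_mul_le _ _).trans hp,
    fun x hx => by simp [h x hx]⟩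

theorem mul (hf : PolyLe d f) (hg : PolyLe e g) : PolyLe (d + e) (fun x => f x * g x) := by
  obtain ⟨p, hp, h⟩ := hf
  obtain ⟨p', hp', h'⟩ := hg
  exact ⟨p * p', Polynomial.natDegree_mul_le_of_le hp hp', fun x hx => by simp [h x hx, h' x hx]⟩

theorem sub (hf : PolyLe d f) (hg : PolyLe d g) : PolyLe d (fun x => f x - g x) := by
  obtain ⟨p, hp, h⟩ := hf
  obtain ⟨p', hp', h'⟩ := hg
  exact ⟨p - p', (Polynomial.natDegree_sub_le _ _).trans (max_le hp hp'),
    fun x hx => by simp [h x hx, h' x hx]⟩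

theorem sum {ι : Type*} (s : Finset ι) {f : ι → K → K} (h : ∀ i ∈ s, PolyLe d (f i)) :
    PolyLe d (fun x => ∑ i ∈ s, f i x) := by
  choose! p hp hf using h
  exact ⟨∑ i ∈ s, p i, Polynomial.natDegree_sum_le_of_forall_le s p hp,
    fun x hx => by rw [Polynomial.eval_finsetSum]; exact Finset.sum_congr rfl fun i hi => hf i hi x hx⟩

theorem qPoch_mul (c q : K) (k : ℕ) : PolyLe k (fun x => qPoch (c * x) q k) := by
  refine ⟨∏ i ∈ Finset.range k, (1 - Polynomial.C (c * q ^ i) * Polynomial.X), ?_, fun x _ => ?_⟩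
  · refine (Polynomial.natDegree_prod_le _ _).trans ?_
    refine (Finset.sum_le_card_nsmul _ _ 1 fun i _ => ?_).trans (by simp)
    compute_degree
  · simp only [Polynomial.eval_prod, qPoch]
    refine Finset.prod_congr rfl fun i _ => ?_
    simp; ring

/-- Each factor absorbs one power of `x`: `x (1 - c q^i / x) = x - c q^i`. -/
theorem pow_mul_qPoch_div (c q : K) (k : ℕ) : PolyLe k (fun x => x ^ k * qPoch (c / x) q k) := by
  refine ⟨∏ i ∈ Finset.range k, (Polynomial.X - Polynomial.C (c * q ^ i)), ?_, fun x hx => ?_⟩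
  · refine (Polynomial.natDegree_prod_le _ _).trans ?_
    refine (Finset.sum_le_card_nsmul _ _ 1 fun i _ => ?_).trans (by simp)
    compute_degree
  · simp only [Polynomial.eval_prod, qPoch]
    have : x ^ k = ∏ _i ∈ Finset.range k, x := by simp
    rw [this, ← Finset.prod_mul_distrib]
    refine Finset.prod_congr rfl fun i _ => ?_
    simp; field_simp

theorem eq_zero_of_card (hf : PolyLe d f) (s : Finset K) (hs : d < s.card)
    (h0 : ∀ x ∈ s, x ≠ 0) (h : ∀ x ∈ s, f x = 0) {x : K} (hx : x ≠ 0) : f x = 0 := by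
  obtain ⟨p, hp, hpf⟩ := hf
  have : p = 0 := Polynomial.eq_zero_of_natDegree_lt_card_of_eval_eq_zero' p s
    (fun y hy => by rw [hpf y (h0 y hy), h y hy]) (hp.trans_lt hs)
  rw [← hpf x hx, this, Polynomial.eval_zero]

end PolyLe
end OneRowD
end

noncomputable section
namespace OneRowD
variable {K : Type*} [Field K]

/-! ### A transformation of terminating basic hypergeometric sums -/

/-- The `k`-th term of the left-hand side of `sum_leftTerm`. -/
def leftTerm (q t U V : K) (N k : ℕ) : K :=
  binCoeff q t (N - k) * binCoeff q t k *
    (qPoch (t * U) q k * qPoch (U * q ^ (k + 1)) q (N - k)) *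
    (qPoch (t * V) q (N - k) * qPoch (V * q ^ (N - k + 1)) q k)

/-- The part of `rightTerm` that depends on the product `p = U V` only. -/
def rightCoeff (q t p : K) (N b : ℕ) : K :=
  binCoeff q t (N - b) * binCoeff q t b *
    (qPoch (t ^ 2 * p * q ^ (2 * b)) q (N - b) * qPoch (p * q ^ (b + 1)) q b) /
    (qPoch (t * p * q ^ (2 * b + 1)) q (N - b) * qPoch (t * p * q ^ b) q b)

/-- The `b`-th term of the right-hand side of `sum_leftTerm`. -/
def rightTerm (q t p U V : K) (N b : ℕ) : K :=
  rightCoeff q t p N b *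
    (qPoch (t * U) q b * qPoch (U * q ^ (b + 1)) q (N - b)) *
    (qPoch (t * V) q b * qPoch (V * q ^ (b + 1)) q (N - b))

/-- The difference of the two sides of `sum_leftTerm`. -/
def termDiff (q t p U V : K) (N : ℕ) : K :=
  ∑ k ∈ Finset.range (N + 1), leftTerm q t U V N k -
    ∑ b ∈ Finset.range (N + 1), rightTerm q t p U V N b

/-- Exchanging `U` and `V` reverses the left-hand sum and fixes each term on the right. It turns a
zero at `U = q^{-j}` into one at `V = q^{-j}`. -/
theorem termDiff_symm (q t p U V : K) (N : ℕ) : termDiff q t p U V N = termDiff q t p V U N := by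
  unfold termDiff
  congr 1
  · rw [← Finset.sum_range_reflect]
    refine Finset.sum_congr rfl fun k hk => ?_
    have hk : k ≤ N := by simpa [Nat.lt_succ_iff] using hk
    have h1 : N + 1 - 1 - k = N - k := by omega
    have h2 : N - (N - k) = k := by omega
    simp only [leftTerm, h1, h2]
    ring
  · refine Finset.sum_congr rfl fun b _ => ?_
    simp only [rightTerm]
    ring

/-- At `U = q^{-j}` the symbols of length beyond `j` split after `j` factors; what remains is a term
of the sum of size `k + l` with `q^j` in place of `U`. -/
theorem leftTerm_shift {q t U : K} (hq : ∀ j, 1 ≤ j → q ^ j ≠ 1) {j : ℕ} (hU : U * q ^ j = 1)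
    (V : K) (k l : ℕ) :
    leftTerm q t U V (j + (k + l)) (j + k) =
      qPoch (t * U) q j * qPoch t q j * qPoch q q (k + l) / qPoch q q (j + (k + l)) *
        qPoch (V * q ^ (k + l + 1)) q j * leftTerm q t (q ^ j) V (k + l) k := by
  have hN := fun m => qPoch_self_ne_zero hq m
  have e1 : j + (k + l) - (j + k) = l := by omega
  have e2 : k + l - k = l := by omega
  simp only [leftTerm, e1, e2, binCoeff]
  have a1 : qPoch (t * U) q (j + k) = qPoch (t * U) q j * qPoch t q k := by
    rw [qPoch_add, mul_assoc t U, hU, mul_one]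
  have a2 : U * q ^ (j + k + 1) = q * q ^ k := by
    rw [show U * q ^ (j + k + 1) = (U * q ^ j) * q ^ (k + 1) by ring, hU]; ring
  have a3 : qPoch t q (j + k) = qPoch t q j * qPoch (t * q ^ j) q k := qPoch_add ..
  have a4 : qPoch q q (k + l) = qPoch q q k * qPoch (q * q ^ k) q l := qPoch_add ..
  have a5 : qPoch q q (j + (k + l)) = qPoch q q (j + k) * qPoch (q ^ j * q ^ (k + 1)) q l := by
    rw [← add_assoc, qPoch_add]; congr 2; ring
  have a6 : qPoch (V * q ^ (l + 1)) q (j + k) =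
      qPoch (V * q ^ (l + 1)) q k * qPoch (V * q ^ (k + l + 1)) q j := by
    rw [add_comm j k, qPoch_add]; congr 2; ring
  have h5 := hN (j + (k + l))
  rw [a5] at h5 ⊢
  rw [a1, a2, a3, a4, a6]
  have h6 := hN (j + k)
  have h7 := hN k
  have h8 := hN l
  have h9 := right_ne_zero_of_mul h5
  field_simp

/-- The prefactor depends on `b` and `l` only through `b + l`, and is the same as in
`leftTerm_shift`; so the difference of the two sums scales as a whole. -/
theorem rightTerm_shift {q t p U V : K} (hq : ∀ j, 1 ≤ j → q ^ j ≠ 1) {j : ℕ}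
    (hU : U * q ^ j = 1) (hV : V = p * q ^ j) (b l : ℕ)
    (h : ∀ i, 1 ≤ i → i ≤ 2 * (j + (b + l)) → t * p * q ^ i ≠ 1) (hj : 1 ≤ j) :
    rightTerm q t p U V (j + (b + l)) (j + b) =
      qPoch (t * U) q j * qPoch t q j * qPoch q q (b + l) / qPoch q q (j + (b + l)) *
        qPoch (V * q ^ (b + l + 1)) q j * rightTerm q t (p * q ^ (2 * j)) (q ^ j) V (b + l) b := by
  have hN := fun m => qPoch_self_ne_zero hq m
  have e1 : j + (b + l) - (j + b) = l := by omega
  have e2 : b + l - b = l := by omega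
  simp only [rightTerm, rightCoeff, e1, e2, binCoeff]
  have a1 : qPoch (t * U) q (j + b) = qPoch (t * U) q j * qPoch t q b := by
    rw [qPoch_add, mul_assoc t U, hU, mul_one]
  have a2 : U * q ^ (j + b + 1) = q * q ^ b := by
    rw [show U * q ^ (j + b + 1) = (U * q ^ j) * q ^ (b + 1) by ring, hU]; ring
  have a3 : qPoch t q (j + b) = qPoch t q j * qPoch (t * q ^ j) q b := qPoch_add ..
  have a4 : qPoch q q (b + l) = qPoch q q b * qPoch (q * q ^ b) q l := qPoch_add ..
  have a5 : qPoch q q (j + (b + l)) = qPoch q q (j + b) * qPoch (q ^ j * q ^ (b + 1)) q l := by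
    rw [← add_assoc, qPoch_add]; congr 2; ring
  have b1 : t ^ 2 * (p * q ^ (2 * j)) * q ^ (2 * b) = t ^ 2 * p * q ^ (2 * (j + b)) := by ring
  have b2 : t * (p * q ^ (2 * j)) * q ^ (2 * b + 1) = t * p * q ^ (2 * (j + b) + 1) := by ring
  have b3 : qPoch (p * q ^ (j + b + 1)) q (j + b) =
      qPoch (V * q ^ (b + 1)) q j * qPoch (p * q ^ (2 * j) * q ^ (b + 1)) q b := by
    rw [qPoch_add, hV]; congr 2 <;> ring
  have b4 : qPoch (t * p * q ^ (j + b)) q (j + b) =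
      qPoch (t * V * q ^ b) q j * qPoch (t * (p * q ^ (2 * j)) * q ^ b) q b := by
    rw [qPoch_add, hV]; congr 2 <;> ring
  have b5 : qPoch (t * V) q (j + b) = qPoch (t * V) q b * qPoch (t * V * q ^ b) q j := by
    rw [add_comm j b, qPoch_add]
  -- Both sides are `(V q^{b+1};q)_{j+l}`, split in two ways.
  have b6 : qPoch (V * q ^ (b + 1)) q j * qPoch (V * q ^ (j + b + 1)) q l =
      qPoch (V * q ^ (b + 1)) q l * qPoch (V * q ^ (b + l + 1)) q j := by
    have h1 := qPoch_add (V * q ^ (b + 1)) q j l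
    have h2 := qPoch_add (V * q ^ (b + 1)) q l j
    rw [add_comm l j, h1] at h2
    convert h2 using 3 <;> ring
  have h5 := hN (j + (b + l))
  rw [a5] at h5 ⊢
  rw [a1, a2, a3, a4, b1, b2, b3, b4, b5]
  have h6 := hN (j + b)
  have h7 := hN b
  have h8 := hN l
  have h9 := right_ne_zero_of_mul h5
  have c1 : qPoch (t * V * q ^ b) q j ≠ 0 := qPoch_ne_zero fun i hi => by
    rw [hV, show t * (p * q ^ j) * q ^ b * q ^ i = t * p * q ^ (j + b + i) by ring]
    exact h _ (by omega) (by omega)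
  have c2 : qPoch (t * (p * q ^ (2 * j)) * q ^ b) q b ≠ 0 := qPoch_ne_zero fun i hi => by
    rw [show t * (p * q ^ (2 * j)) * q ^ b * q ^ i = t * p * q ^ (2 * j + b + i) by ring]
    exact h _ (by omega) (by omega)
  have c3 : qPoch (t * p * q ^ (2 * (j + b) + 1)) q l ≠ 0 := qPoch_ne_zero fun i hi => by
    rw [mul_assoc, ← pow_add]
    exact h _ (by omega) (by omega)
  generalize qPoch (V * q ^ (b + 1)) q j = x1 at *
  generalize qPoch (V * q ^ (j + b + 1)) q l = x2 at *
  generalize qPoch (V * q ^ (b + 1)) q l = x3 at *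
  generalize qPoch (V * q ^ (b + l + 1)) q j = x4 at *
  generalize qPoch (t * V * q ^ b) q j = x5 at *
  generalize qPoch (t * (p * q ^ (2 * j)) * q ^ b) q b = x6 at *
  generalize qPoch (t * p * q ^ (2 * (j + b) + 1)) q l = x7 at *
  generalize qPoch (q ^ j * q ^ (b + 1)) q l = x8 at *
  field_simp
  linear_combination (qPoch t q l * qPoch t q j * qPoch (t * q ^ j) q b *
    qPoch (t ^ 2 * p * q ^ (2 * (j + b))) q l * qPoch (p * q ^ (2 * j) * q ^ (b + 1)) q b *
    qPoch (t * U) q j * qPoch t q b * qPoch (q * q ^ b) q l * qPoch (t * V) q b) * b6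

/-- Terms of index below `j` contain the factor `1 - U q^j = 0`; the others scale uniformly. This is
the recursion behind the induction on the size of the sum. -/
theorem termDiff_shift {q t p U V : K} (hq : ∀ j, 1 ≤ j → q ^ j ≠ 1) {j : ℕ}
    (hU : U * q ^ j = 1) (hV : V = p * q ^ j) (N : ℕ)
    (h : ∀ i, 1 ≤ i → i ≤ 2 * (j + N) → t * p * q ^ i ≠ 1) (hj : 1 ≤ j) :
    termDiff q t p U V (j + N) =
      qPoch (t * U) q j * qPoch t q j * qPoch q q N / qPoch q q (j + N) *
        qPoch (V * q ^ (N + 1)) q j * termDiff q t (p * q ^ (2 * j)) (q ^ j) V N := by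
  have z : ∀ k < j, qPoch (U * q ^ (k + 1)) q (j + N - k) = 0 := fun k hk =>
    qPoch_eq_zero (i := j - k - 1) (by omega) (by
      rw [mul_assoc, ← pow_add, show k + 1 + (j - k - 1) = j by omega, hU])
  unfold termDiff
  rw [add_assoc j N 1, Finset.sum_range_add _ j, Finset.sum_range_add _ j, mul_sub, Finset.mul_sum,
    Finset.mul_sum]
  rw [Finset.sum_eq_zero (s := Finset.range j) (f := fun k => leftTerm q t U V (j + N) k),
    Finset.sum_eq_zero (s := Finset.range j) (f := fun k => rightTerm q t p U V (j + N) k)]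
  · rw [zero_add, zero_add]
    congr 1 <;> refine Finset.sum_congr rfl fun k hk => ?_
    all_goals
      obtain ⟨l, rfl⟩ := Nat.exists_eq_add_of_le (Nat.lt_succ_iff.mp (Finset.mem_range.mp hk))
    · exact leftTerm_shift hq hU V k l
    · exact rightTerm_shift hq hU hV k l h hj
  · intro k hk
    simp [rightTerm, z k (Finset.mem_range.mp hk)]
  · intro k hk
    simp [leftTerm, z k (Finset.mem_range.mp hk)]

end OneRowD
end

/-! ### Proof of the transformation by interpolation -/

noncomputable section
namespace OneRowD
variable {K : Type*} [Field K]

/-- In every term the two symbols in `V = p / x` have total length `N`, and so have the two in `U =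
x`. The remaining factors depend on `p` only. -/
theorem polyLe_pow_mul_termDiff (q t p : K) (N : ℕ) :
    PolyLe (2 * N) (fun x => x ^ N * termDiff q t p x (p / x) N) := by
  have key : ∀ (c : K) (a b m : ℕ) (u v w z : K), a + b = N → m = N →
      PolyLe (2 * N) (fun x => c * ((x ^ a * qPoch (u / x) q a) * (x ^ b * qPoch (v / x) q b) *
        (qPoch (w * x) q b * qPoch (z * x) q a))) := by
    intro c a b m u v w z h _
    have h1 := ((PolyLe.pow_mul_qPoch_div u q a).mul (PolyLe.pow_mul_qPoch_div v q b)).mul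
      ((PolyLe.qPoch_mul w q b).mul (PolyLe.qPoch_mul z q a))
    rw [show a + b + (b + a) = 2 * N by omega] at h1
    exact h1.const_mul c
  have h1 : PolyLe (2 * N) (fun x =>
      ∑ k ∈ Finset.range (N + 1), x ^ N * leftTerm q t x (p / x) N k) := by
    refine PolyLe.sum _ fun k hk => ?_
    have hk : k ≤ N := Nat.lt_succ_iff.mp (Finset.mem_range.mp hk)
    convert key (binCoeff q t (N - k) * binCoeff q t k) (N - k) k N (t * p)
      (p * q ^ (N - k + 1)) t (q ^ (k + 1)) (by omega) rfl using 2 with x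
    obtain ⟨l, rfl⟩ := Nat.exists_eq_add_of_le hk
    simp only [leftTerm, Nat.add_sub_cancel_left]
    rw [mul_div_assoc, mul_div_right_comm, mul_comm x, pow_add]
    ring
  have h2 : PolyLe (2 * N) (fun x =>
      ∑ b ∈ Finset.range (N + 1), x ^ N * rightTerm q t p x (p / x) N b) := by
    refine PolyLe.sum _ fun b hb => ?_
    have hb : b ≤ N := Nat.lt_succ_iff.mp (Finset.mem_range.mp hb)
    convert key (rightCoeff q t p N b) (N - b) b N (p * q ^ (b + 1)) (t * p) t (q ^ (b + 1))
      (by omega) rfl using 2 with x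
    obtain ⟨l, rfl⟩ := Nat.exists_eq_add_of_le hb
    simp only [rightTerm, Nat.add_sub_cancel_left]
    rw [mul_div_assoc, mul_div_right_comm, mul_comm x, pow_add]
    ring_nf
  convert h1.sub h2 using 2 with x
  rw [termDiff, mul_sub, Finset.mul_sum, Finset.mul_sum]

/-- The factor `(tU;q)_k` vanishes for `k ≥ 1`, so each sum has only its term of index `0`; these
agree because `tV = t²p` and `Vq = tpq`. -/
theorem termDiff_inv {q t p : K} (ht : t ≠ 0) (N : ℕ)
    (h : ∀ i, 1 ≤ i → i ≤ 2 * N → t * p * q ^ i ≠ 1) :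
    termDiff q t p t⁻¹ (p / t⁻¹) N = 0 := by
  have z : ∀ k, qPoch (t * t⁻¹) q (k + 1) = 0 := fun k =>
    qPoch_eq_zero (i := 0) (by omega) (by simp [ht])
  have h1 : qPoch (t * p * q) q N ≠ 0 := qPoch_ne_zero fun i hi => by
    rw [mul_assoc, ← pow_succ']; exact h _ (by omega) (by omega)
  unfold termDiff
  rw [Finset.sum_eq_single_of_mem 0 (by simp), Finset.sum_eq_single_of_mem 0 (by simp)]
  · simp only [leftTerm, rightTerm, rightCoeff]
    simp only [tsub_zero, binCoeff_zero, qPoch_zero, mul_zero, pow_zero, zero_add, pow_one, mul_one,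
      one_mul, div_inv_eq_mul]
    rw [show t * (p * t) = t ^ 2 * p by ring, show p * t * q = t * p * q by ring]
    generalize qPoch (t * p * q) q N = y at *
    field_simp
    ring
  · intro b _ hb
    obtain ⟨b, rfl⟩ := Nat.exists_eq_succ_of_ne_zero hb
    simp [rightTerm, z]
  · intro b _ hb
    obtain ⟨b, rfl⟩ := Nat.exists_eq_succ_of_ne_zero hb
    simp [leftTerm, z]

theorem pow_injective_of_ne_one {q : K} (hq0 : q ≠ 0) (hq : ∀ j, 1 ≤ j → q ^ j ≠ 1) :
    Function.Injective fun j : ℕ => q ^ j := by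
  intro a b hab
  wlog h : a ≤ b generalizing a b
  · exact (this hab.symm (by omega)).symm
  obtain ⟨c, rfl⟩ := Nat.exists_eq_add_of_le h
  by_contra hne
  refine hq c (by omega) ?_
  have : q ^ a * 1 = q ^ a * q ^ c := by simpa [pow_add] using hab
  exact (mul_left_cancel₀ (pow_ne_zero a hq0) this).symm

/-- The `2N + 1` zeros in `U` are `q^{-j}` and `p q^j` for `1 ≤ j ≤ N`, and `t⁻¹`. The conditions on
`t` and `p` make them distinct. -/
theorem termDiff_eq_zero_of_generic {q t : K} (hq0 : q ≠ 0) (hq : ∀ j, 1 ≤ j → q ^ j ≠ 1)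
    (ht : t ≠ 0) (N : ℕ) (htq : ∀ j ≤ N, t ≠ q ^ j)
    (ih : ∀ M < N, ∀ p U V : K, U * V = p → U ≠ 0 → V ≠ 0 →
      (∀ j, 1 ≤ j → j ≤ 2 * M → t * p * q ^ j ≠ 1) → (∀ j, 1 ≤ j → j ≤ 2 * M → p * q ^ j ≠ 1) →
      termDiff q t p U V M = 0)
    {p U V : K} (hp : U * V = p) (hU : U ≠ 0) (hV : V ≠ 0)
    (h1 : ∀ j, 1 ≤ j → j ≤ 2 * N → t * p * q ^ j ≠ 1)
    (h2 : ∀ j, 1 ≤ j → j ≤ 2 * N → p * q ^ j ≠ 1) :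
    termDiff q t p U V N = 0 := by
  classical
  have hp0 : p ≠ 0 := hp ▸ mul_ne_zero hU hV
  have hinj := pow_injective_of_ne_one hq0 hq
  -- At `U = q^{-j}`, `V = p q^j`, the claim reduces to size `N - j` with the parameters `q^j` and
  -- `V`, whose product is `p q^{2j}`.
  have van : ∀ j, 1 ≤ j → j ≤ N → termDiff q t p (q ^ j)⁻¹ (p * q ^ j) N = 0 := by
    intro j hj hjN
    obtain ⟨M, rfl⟩ := Nat.exists_eq_add_of_le hjN
    have hqj := pow_ne_zero j hq0
    rw [termDiff_shift hq (inv_mul_cancel₀ hqj) rfl M h1 hj, ih M (by omega), mul_zero]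
    · ring
    · exact hqj
    · exact mul_ne_zero hp0 hqj
    · intro i hi hi'
      rw [show t * (p * q ^ (2 * j)) * q ^ i = t * p * q ^ (2 * j + i) by ring]
      exact h1 _ (by omega) (by omega)
    · intro i hi hi'
      rw [mul_assoc, ← pow_add]
      exact h2 _ (by omega) (by omega)
  -- The set `A` collects the points `U = q^{-j}`, and `B` the points with `V = q^{-j}`.
  let A := (Finset.Icc 1 N).image fun j => (q ^ j)⁻¹
  let B := (Finset.Icc 1 N).image fun j => p * q ^ j
  have hA : A.card = N := by
    rw [Finset.card_image_of_injective _ fun a b h => hinj (inv_injective h)]; simp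
  have hB : B.card = N := by
    rw [Finset.card_image_of_injective _ fun a b h => hinj (mul_left_cancel₀ hp0 h)]; simp
  have hAB : Disjoint A B := by
    rw [Finset.disjoint_left]
    intro x hx hx'
    simp only [A, B, Finset.mem_image, Finset.mem_Icc] at hx hx'
    obtain ⟨i, hi, rfl⟩ := hx
    obtain ⟨j, hj, h⟩ := hx'
    refine h2 (j + i) (by omega) (by omega) ?_
    rw [pow_add, ← mul_assoc, h, inv_mul_cancel₀ (pow_ne_zero _ hq0)]
  have htA : t⁻¹ ∉ A ∪ B := by
    simp only [A, B, Finset.mem_union, Finset.mem_image, Finset.mem_Icc, not_or]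
    constructor
    · rintro ⟨j, hj, h⟩
      exact htq j hj.2 (inv_injective h).symm
    · rintro ⟨j, hj, h⟩
      refine h1 j hj.1 (by omega) ?_
      rw [mul_assoc, h, mul_inv_cancel₀ ht]
  have hV' : V = p / U := by rw [← hp]; field_simp
  have := (polyLe_pow_mul_termDiff q t p N).eq_zero_of_card (insert t⁻¹ (A ∪ B))
    (by rw [Finset.card_insert_of_notMem htA, Finset.card_union_of_disjoint hAB, hA, hB]; omega)
    ?_ ?_ hU
  · rw [← hV'] at this
    exact (mul_eq_zero.mp this).resolve_left (pow_ne_zero _ hU)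
  · intro x hx
    simp only [A, B, Finset.mem_insert, Finset.mem_union, Finset.mem_image] at hx
    rcases hx with rfl | ⟨j, -, rfl⟩ | ⟨j, -, rfl⟩
    · exact inv_ne_zero ht
    · exact inv_ne_zero (pow_ne_zero _ hq0)
    · exact mul_ne_zero hp0 (pow_ne_zero _ hq0)
  · intro x hx
    simp only [A, B, Finset.mem_insert, Finset.mem_union, Finset.mem_image, Finset.mem_Icc] at hx
    rcases hx with rfl | ⟨j, hj, rfl⟩ | ⟨j, hj, rfl⟩
    · rw [termDiff_inv ht N h1, mul_zero]
    · rw [div_inv_eq_mul, van j hj.1 hj.2, mul_zero]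
    · rw [termDiff_symm, div_mul_cancel_left₀ hp0, van j hj.1 hj.2, mul_zero]

/-- For `t = q^j` two interpolation nodes collide. Such `t` are reached by continuation: the
difference is a rational function of `t`, regular at the given value, and zero for all but finitely
many others. The induction therefore quantifies over `t`. -/
theorem termDiff_eq_zero {q : K} (hq0 : q ≠ 0) (hq : ∀ j, 1 ≤ j → q ^ j ≠ 1) (N : ℕ) :
    ∀ t p U V : K, t ≠ 0 → U * V = p → U ≠ 0 → V ≠ 0 →
      (∀ j, 1 ≤ j → j ≤ 2 * N → t * p * q ^ j ≠ 1) → (∀ j, 1 ≤ j → j ≤ 2 * N → p * q ^ j ≠ 1) →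
      termDiff q t p U V N = 0 := by
  classical
  have : Infinite K := Infinite.of_injective _ (pow_injective_of_ne_one hq0 hq)
  induction N using Nat.strong_induction_on with
  | _ N ih =>
  intro t p U V _ hp hU hV h1 h2
  have hid := RegularAt.id t
  have hc := fun c : K => RegularAt.const c t
  have hb := fun k => hid.binCoeff hq k
  have hreg : RegularAt (fun x => termDiff q x p U V N) t := by
    refine (RegularAt.sum _ fun k _ => ?_).sub (RegularAt.sum _ fun b hb' => ?_)
    · exact (((hb _).mul (hb _)).mul (((hid.mul (hc _)).qPoch q _).mul (hc _))).mul
        (((hid.mul (hc _)).qPoch q _).mul (hc _))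
    · have hb' : b ≤ N := Nat.lt_succ_iff.mp (Finset.mem_range.mp hb')
      refine RegularAt.mul (RegularAt.mul (RegularAt.div ?_ ?_ ?_) ?_) ?_
      · have : RegularAt (fun x => x ^ 2) t := by simpa [pow_two] using hid.mul hid
        exact ((hb _).mul (hb _)).mul ((((this.mul (hc _)).mul (hc _)).qPoch q _).mul (hc _))
      · exact (((hid.mul (hc _)).mul (hc _)).qPoch q _).mul
          (((hid.mul (hc _)).mul (hc _)).qPoch q _)
      · refine mul_ne_zero (qPoch_ne_zero fun i hi => ?_) (qPoch_ne_zero fun i hi => ?_) <;>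
        · rw [mul_assoc, ← pow_add]
          exact h1 _ (by omega) (by omega)
      · exact ((hid.mul (hc _)).qPoch q _).mul (hc _)
      · exact ((hid.mul (hc _)).qPoch q _).mul (hc _)
  -- Outside this finite set `x` meets all the conditions of the generic case: it is nonzero, not a
  -- power `q^j` with `j ≤ N`, and `x p q^j ≠ 1`.
  refine hreg.eq_zero (insert 0 ((Finset.range (N + 1)).image (fun j => q ^ j) ∪
    (Finset.range (2 * N + 1)).image fun j => (p * q ^ j)⁻¹)) fun x hx => ?_
  simp only [Finset.mem_insert, Finset.mem_union, Finset.mem_image, Finset.mem_range, not_or,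
    not_exists, not_and] at hx
  obtain ⟨hx0, hx1, hx2⟩ := hx
  refine termDiff_eq_zero_of_generic hq0 hq hx0 N (fun j hj h => hx1 j (by omega) h.symm)
    (fun M hM p U V => ih M hM x p U V hx0) hp hU hV (fun j _ hj h => hx2 j (by omega) ?_) h2
  rw [mul_assoc] at h
  exact (eq_inv_of_mul_eq_one_left h).symm

/-! ### The transformation in the form needed for branching -/

/-- The symmetric factor attached to a pair of multiplicities `a`, `b`. -/
def branchFactor (q t W : K) (a b : ℕ) : K :=
  qPoch (W * q ^ (a + 1)) q b * qPoch (t * W) q b /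
    (qPoch (t * W * q ^ a) q b * qPoch (W * q) q b)

/-- Completing the symbols by their first `a` factors yields an expression visibly symmetric in `a`
and `b`. -/
theorem branchFactor_eq {q t W : K} (h2 : ∀ j, 1 ≤ j → W * q ^ j ≠ 1)
    (h3 : ∀ j, t * W * q ^ j ≠ 1) (a b : ℕ) :
    branchFactor q t W a b = qPoch (W * q) q (a + b) * (qPoch (t * W) q a * qPoch (t * W) q b) /
      (qPoch (W * q) q a * qPoch (W * q) q b * qPoch (t * W) q (a + b)) := by
  have n1 : ∀ k, qPoch (W * q) q k ≠ 0 := fun k => qPoch_ne_zero fun i _ => by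
    rw [mul_assoc, ← pow_succ']; exact h2 _ (by omega)
  have n2 : ∀ k, qPoch (t * W) q k ≠ 0 := fun k => qPoch_ne_zero fun i _ => h3 i
  have m1 := n1 (a + b)
  have m2 := n2 (a + b)
  have e : W * q * q ^ a = W * q ^ (a + 1) := by ring
  rw [qPoch_add] at m1 m2
  rw [branchFactor, qPoch_add, qPoch_add, e]
  rw [e] at m1
  have := n1 a
  have := n1 b
  have := n2 a
  have := right_ne_zero_of_mul m1
  have := right_ne_zero_of_mul m2
  generalize qPoch (t * W * q ^ a) q b = x1 at *
  generalize qPoch (t * W) q a = x2 at *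
  field_simp

theorem branchFactor_comm {q t W : K} (h2 : ∀ j, 1 ≤ j → W * q ^ j ≠ 1)
    (h3 : ∀ j, t * W * q ^ j ≠ 1) (a b : ℕ) :
    branchFactor q t W a b = branchFactor q t W b a := by
  rw [branchFactor_eq h2 h3, branchFactor_eq h2 h3, add_comm a b]
  ring

/-- The transformation in the form used for the branching of one-row functions. -/
theorem sum_binCoeff_branch {q t W : K} (hq0 : q ≠ 0) (hq : ∀ j, 1 ≤ j → q ^ j ≠ 1) (ht : t ≠ 0)
    (hW : W ≠ 0) (h2 : ∀ j, 1 ≤ j → W * q ^ j ≠ 1) (h3 : ∀ j, t * W * q ^ j ≠ 1) (A B : ℕ) :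
    ∑ k ∈ Finset.range (min A B + 1), binCoeff q t (A - k) * binCoeff q t (B - k) *
        (binCoeff q t k * (qPoch (t * W) q k / qPoch (W * q) q k)) =
      ∑ k ∈ Finset.range (min A B + 1), binCoeff q t (A - k) * binCoeff q t (B - k) *
        branchFactor q t W (A - k) (B - k) *
        (binCoeff q t k * (qPoch (t ^ 2 * W * q ^ (A - k + (B - k))) q k /
          qPoch (t * W * q ^ (A - k + (B - k) + 1)) q k)) := by
  wlog hAB : B ≤ A generalizing A B
  · have := this B A (by omega)
    rw [min_comm]
    convert this using 2 with k _ k _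
    · rw [mul_comm (binCoeff q t (A - k))]
    · rw [mul_comm (binCoeff q t (A - k)), branchFactor_comm h2 h3, add_comm (A - k)]
  obtain ⟨e, rfl⟩ := Nat.exists_eq_add_of_le hAB
  rw [min_eq_right hAB]
  have hN := qPoch_self_ne_zero hq
  have n1 : ∀ k, qPoch (W * q) q k ≠ 0 := fun k => qPoch_ne_zero fun i _ => by
    rw [mul_assoc, ← pow_succ']; exact h2 _ (by omega)
  -- With `A = B + e`, the transformation is used for `N = B`, `U = W`, `V = q^e`.
  have key := termDiff_eq_zero hq0 hq B t (W * q ^ e) W (q ^ e) ht rfl hW (pow_ne_zero _ hq0)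
    (fun j _ _ => by rw [← mul_assoc, mul_assoc, ← pow_add]; exact h3 _)
    (fun j _ _ => by rw [mul_assoc, ← pow_add]; exact h2 _ (by omega))
  rw [termDiff, sub_eq_zero] at key
  have hC : qPoch q q (B + e) * qPoch (W * q) q B ≠ 0 := mul_ne_zero (hN _) (n1 _)
  refine mul_left_cancel₀ hC ?_
  rw [Finset.mul_sum, Finset.mul_sum]
  have k1 : ∀ k ∈ Finset.range (B + 1), qPoch q q (B + e) * qPoch (W * q) q B *
      (binCoeff q t (B + e - k) * binCoeff q t (B - k) *
        (binCoeff q t k * (qPoch (t * W) q k / qPoch (W * q) q k))) =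
      qPoch t q e * leftTerm q t W (q ^ e) B k := by
    intro k hk
    obtain ⟨l, rfl⟩ := Nat.exists_eq_add_of_le (Nat.lt_succ_iff.mp (Finset.mem_range.mp hk))
    have e1 : k + l + e - k = e + l := by omega
    simp only [leftTerm, e1, Nat.add_sub_cancel_left, binCoeff]
    have a1 : qPoch q q (k + l + e) = qPoch q q (e + l) * qPoch (q ^ e * q ^ (l + 1)) q k := by
      rw [show k + l + e = e + l + k by ring, qPoch_add]; congr 2; ring
    have a2 : qPoch (W * q) q (k + l) = qPoch (W * q) q k * qPoch (W * q ^ (k + 1)) q l := by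
      rw [qPoch_add]; congr 2; ring
    rw [a1, a2, qPoch_add t q e l]
    have := hN (e + l)
    have := hN k
    have := hN l
    have := n1 k
    field_simp
  -- On this side the summation indices are related by `k = B - b`; the sum is reversed at the end.
  have k2 : ∀ b ∈ Finset.range (B + 1), qPoch t q e * rightTerm q t (W * q ^ e) W (q ^ e) B b =
      qPoch q q (B + e) * qPoch (W * q) q B *
      (binCoeff q t (B + e - (B - b)) * binCoeff q t (B - (B - b)) *
        branchFactor q t W (B + e - (B - b)) (B - (B - b)) *
        (binCoeff q t (B - b) *
          (qPoch (t ^ 2 * W * q ^ (B + e - (B - b) + (B - (B - b)))) q (B - b) /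
          qPoch (t * W * q ^ (B + e - (B - b) + (B - (B - b)) + 1)) q (B - b)))) := by
    intro b hb
    obtain ⟨l, rfl⟩ := Nat.exists_eq_add_of_le (Nat.lt_succ_iff.mp (Finset.mem_range.mp hb))
    have e1 : b + l - b = l := by omega
    have e2 : b + l + e - l = e + b := by omega
    have e3 : b + l - l = b := by omega
    simp only [rightTerm, rightCoeff, branchFactor, e1, e2, e3, binCoeff]
    have a1 : qPoch q q (b + l + e) = qPoch q q (e + b) * qPoch (q ^ e * q ^ (b + 1)) q l := by
      rw [show b + l + e = e + b + l by ring, qPoch_add]; congr 2; ring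
    have a2 : qPoch (W * q) q (b + l) = qPoch (W * q) q b * qPoch (W * q ^ (b + 1)) q l := by
      rw [qPoch_add]; congr 2; ring
    have a3 : t ^ 2 * (W * q ^ e) * q ^ (2 * b) = t ^ 2 * W * q ^ (e + b + b) := by ring
    have a4 : W * q ^ e * q ^ (b + 1) = W * q ^ (e + b + 1) := by ring
    have a5 : t * (W * q ^ e) * q ^ (2 * b + 1) = t * W * q ^ (e + b + b + 1) := by ring
    have a6 : t * (W * q ^ e) * q ^ b = t * W * q ^ (e + b) := by ring
    rw [a1, a2, qPoch_add t q e b, a3, a4, a5, a6]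
    have := hN (e + b)
    have := hN b
    have := hN l
    have := n1 b
    have c1 : qPoch (t * W * q ^ (e + b + b + 1)) q l ≠ 0 := qPoch_ne_zero fun i _ => by
      rw [mul_assoc, ← pow_add]; exact h3 _
    have c2 : qPoch (t * W * q ^ (e + b)) q b ≠ 0 := qPoch_ne_zero fun i _ => by
      rw [mul_assoc, ← pow_add]; exact h3 _
    generalize qPoch (t * W * q ^ (e + b + b + 1)) q l = x1 at *
    generalize qPoch (t * W * q ^ (e + b)) q b = x2 at *
    field_simp
  rw [Finset.sum_congr rfl k1, ← Finset.mul_sum, key, Finset.mul_sum, Finset.sum_congr rfl k2]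
  convert Finset.sum_range_reflect _ (B + 1) using 2
  simp only [Nat.add_sub_cancel]

end OneRowD
end

noncomputable section
namespace OneRowD
open Finset.HasAntidiagonal (antidiagonal)
variable {K : Type*} [Field K] {M : Type*} [AddCommMonoid M]

/-! ### Rearranging sums over pairs with a given sum -/

/-- Both sides run over the quadruples `(a, b, m, k)` with `a + b + m + 2k = r`: the amount `2k` is
stored either with `m` or as `k` with each of `a` and `b`. -/
theorem sum_antidiagonal_shift (F : ℕ → ℕ → ℕ → ℕ → M) (r : ℕ) :
    ∑ x ∈ antidiagonal r, ∑ y ∈ antidiagonal x.1,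
        ∑ k ∈ Finset.range (x.2 / 2 + 1), F y.1 y.2 (x.2 - 2 * k) k =
      ∑ x ∈ antidiagonal r, ∑ y ∈ antidiagonal x.1,
        ∑ k ∈ Finset.range (min y.1 y.2 + 1), F (y.1 - k) (y.2 - k) x.2 k := by
  simp only [Finset.sum_sigma']
  refine Finset.sum_nbij'
    (fun z => ⟨(z.1.1 + 2 * z.2.2, z.1.2 - 2 * z.2.2),
      ⟨(z.2.1.1 + z.2.2, z.2.1.2 + z.2.2), z.2.2⟩⟩)
    (fun z => ⟨(z.1.1 - 2 * z.2.2, z.1.2 + 2 * z.2.2),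
      ⟨(z.2.1.1 - z.2.2, z.2.1.2 - z.2.2), z.2.2⟩⟩)
    ?_ ?_ ?_ ?_ ?_ <;> rintro ⟨⟨x1, x2⟩, ⟨⟨y1, y2⟩, k⟩⟩ h <;>
    simp only [Finset.mem_sigma, Finset.HasAntidiagonal.mem_antidiagonal, Finset.mem_range] at h ⊢
  · omega
  · omega
  · congr 3 <;> omega
  · congr 3 <;> omega
  · congr 1 <;> omega

/-- The quadruples of `sum_antidiagonal_shift`, now with `k` chosen first. -/
theorem sum_range_antidiagonal_shift (F : ℕ → ℕ → ℕ → ℕ → M) (r : ℕ) :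
    ∑ k ∈ Finset.range (r / 2 + 1), ∑ x ∈ antidiagonal (r - 2 * k),
        ∑ y ∈ antidiagonal x.1, F y.1 y.2 x.2 k =
      ∑ x ∈ antidiagonal r, ∑ y ∈ antidiagonal x.1,
        ∑ k ∈ Finset.range (min y.1 y.2 + 1), F (y.1 - k) (y.2 - k) x.2 k := by
  simp only [Finset.sum_sigma']
  refine Finset.sum_nbij'
    (fun z => ⟨(z.2.1.1 + 2 * z.1, z.2.1.2), ⟨(z.2.2.1 + z.1, z.2.2.2 + z.1), z.1⟩⟩)
    (fun z => ⟨z.2.2, ⟨(z.1.1 - 2 * z.2.2, z.1.2), (z.2.1.1 - z.2.2, z.2.1.2 - z.2.2)⟩⟩)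
    ?_ ?_ ?_ ?_ ?_
  · rintro ⟨k, ⟨⟨x1, x2⟩, ⟨y1, y2⟩⟩⟩ h
    simp only [Finset.mem_sigma, Finset.HasAntidiagonal.mem_antidiagonal, Finset.mem_range] at h ⊢
    omega
  · rintro ⟨⟨x1, x2⟩, ⟨⟨y1, y2⟩, k⟩⟩ h
    simp only [Finset.mem_sigma, Finset.HasAntidiagonal.mem_antidiagonal, Finset.mem_range] at h ⊢
    omega
  · rintro ⟨k, ⟨⟨x1, x2⟩, ⟨y1, y2⟩⟩⟩ h
    simp
  · rintro ⟨⟨x1, x2⟩, ⟨⟨y1, y2⟩, k⟩⟩ h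
    simp only [Finset.mem_sigma, Finset.HasAntidiagonal.mem_antidiagonal, Finset.mem_range] at h ⊢
    congr 3 <;> omega
  · rintro ⟨k, ⟨⟨x1, x2⟩, ⟨y1, y2⟩⟩⟩ h
    simp

/-- Pairs with a given sum, sorted by their minimum. -/
theorem sum_antidiagonal_eq_sum_range (F : ℕ → ℕ → M) (r : ℕ) :
    ∑ x ∈ antidiagonal r, F x.1 x.2 =
      ∑ k ∈ Finset.range (r / 2 + 1),
        if r - 2 * k = 0 then F k k else F (r - 2 * k + k) k + F k (r - 2 * k + k) := by
  induction r using Nat.strong_induction_on generalizing F with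
  | _ r ih =>
  match r with
  | 0 => simp
  | 1 => simp [Finset.Nat.antidiagonal_succ, add_comm]
  | r + 2 =>
    -- Apart from the two pairs with minimum `0`, all pairs are `(a + 1, b + 1)` with `a + b = r`.
    rw [Finset.Nat.antidiagonal_succ_succ', Finset.sum_cons, Finset.sum_cons, Finset.sum_map,
      show (r + 2) / 2 + 1 = r / 2 + 1 + 1 by omega, Finset.sum_range_succ', ← add_assoc,
      add_comm (F 0 (r + 2) + F (r + 2) 0)]
    congr 1
    · refine (ih r (by omega) fun a b => F (a + 1) (b + 1)).trans ?_
      refine Finset.sum_congr rfl fun k _ => ?_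
      rw [show r + 2 - 2 * (k + 1) = r - 2 * k by omega]
      rfl
    · simp [add_comm]


/-! ### The kernel function and its coefficients -/

theorem mono_add {n : ℕ} (m m' : Fin n → ℤ) : mono (m + m') = mono m * (mono m' : Laurent K n) := by
  simp [mono, AddMonoidAlgebra.single_mul_single]

theorem mono_zero {n : ℕ} : mono 0 = (1 : Laurent K n) := rfl

theorem mono_nsmul {n : ℕ} (k : ℕ) (m : Fin n → ℤ) : mono (k • m) = (mono m ^ k : Laurent K n) := by
  induction k with
  | zero => simp [mono_zero]
  | succ k ih => rw [succ_nsmul, mono_add, ih, pow_succ]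

/-- The series `∑ (t;q)_k / (q;q)_k (w u)^k` in `u`. -/
def binSeries (q t : K) {R : Type*} [CommRing R] [Algebra K R] (w : R) : PowerSeries R :=
  PowerSeries.mk fun k => binCoeff q t k • w ^ k

theorem map_binSeries (q t : K) {R S : Type*} [CommRing R] [Algebra K R] [CommRing S] [Algebra K S]
    (f : R →ₐ[K] S) (w : R) :
    PowerSeries.map (f : R →+* S) (binSeries q t w) = binSeries q t (f w) := by
  ext k
  simp [binSeries]

/-- The kernel function `∏_i ∑_k (t;q)_k / (q;q)_k (x_i u)^k ∑_k (t;q)_k / (q;q)_k (u / x_i)^k`. -/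
def kernelSeries (q t : K) (n : ℕ) : PowerSeries (Laurent K n) :=
  ∏ i : Fin n, (binSeries q t (mono (Pi.single i 1)) * binSeries q t (mono (-Pi.single i 1)))

/-- The coefficients of the kernel function. -/
def kernelCoeff (q t : K) (n r : ℕ) : Laurent K n := PowerSeries.coeff r (kernelSeries q t n)

/-- Adding a first exponent `0`. -/
def consZeroHom (n : ℕ) : (Fin n → ℤ) →+ (Fin (n + 1) → ℤ) where
  toFun m := Fin.cons 0 m
  map_zero' := by ext i; refine Fin.cases ?_ (fun _ => ?_) i <;> simp
  map_add' m m' := by ext i; refine Fin.cases ?_ (fun _ => ?_) i <;> simp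

/-- The embedding `x_i ↦ x_{i+1}` of Laurent polynomials. -/
def tailEmb (K : Type*) [Field K] (n : ℕ) : Laurent K n →ₐ[K] Laurent K (n + 1) :=
  AddMonoidAlgebra.mapDomainAlgHom K K (consZeroHom n)

theorem tailEmb_mono {n : ℕ} (m : Fin n → ℤ) :
    tailEmb K n (mono m) = mono (Fin.cons 0 m : Fin (n + 1) → ℤ) := by
  simp [tailEmb, mono, AddMonoidAlgebra.mapDomain_single, consZeroHom]

theorem cons_zero_single {n : ℕ} (i : Fin n) (a : ℤ) :
    (Fin.cons 0 (Pi.single i a) : Fin (n + 1) → ℤ) = Pi.single i.succ a := by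
  ext j
  refine Fin.cases ?_ (fun j => ?_) j
  · simp
  · simp [Pi.single_apply]

theorem kernelSeries_succ (q t : K) (n : ℕ) :
    kernelSeries q t (n + 1) =
      binSeries q t (mono (Pi.single 0 1)) * binSeries q t (mono (-Pi.single 0 1)) *
        PowerSeries.map (tailEmb K n : Laurent K n →+* Laurent K (n + 1)) (kernelSeries q t n) := by
  rw [kernelSeries, Fin.prod_univ_succ, kernelSeries, map_prod]
  congr 1
  refine Finset.prod_congr rfl fun i _ => ?_
  rw [map_mul, map_binSeries, map_binSeries, tailEmb_mono, tailEmb_mono, cons_zero_single,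
    ← Pi.single_neg, ← Pi.single_neg, cons_zero_single]

theorem mono_single_pow_mul {n : ℕ} (i : Fin n) (a b : ℕ) :
    (mono (Pi.single i 1) ^ a * mono (-Pi.single i 1) ^ b : Laurent K n) =
      mono (Pi.single i ((a : ℤ) - b)) := by
  rw [← mono_nsmul, ← mono_nsmul, ← mono_add]
  congr 1
  ext j
  by_cases h : j = i
  · subst h; simp; ring
  · simp [h]

theorem coeff_binSeries_mul (q t : K) {n : ℕ} (i : Fin n) (r : ℕ) :
    PowerSeries.coeff r (binSeries q t (mono (Pi.single i 1)) *
      binSeries q t (mono (-Pi.single i 1)) : PowerSeries (Laurent K n)) =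
      ∑ y ∈ antidiagonal r, (binCoeff q t y.1 * binCoeff q t y.2) •
        mono (Pi.single i ((y.1 : ℤ) - y.2)) := by
  rw [PowerSeries.coeff_mul]
  refine Finset.sum_congr rfl fun y _ => ?_
  rw [binSeries, binSeries, PowerSeries.coeff_mk, PowerSeries.coeff_mk, smul_mul_smul_comm,
    mono_single_pow_mul]

theorem kernelCoeff_succ (q t : K) (n r : ℕ) :
    kernelCoeff q t (n + 1) r =
      ∑ x ∈ antidiagonal r, ∑ y ∈ antidiagonal x.1, (binCoeff q t y.1 * binCoeff q t y.2) •
        (mono (Pi.single 0 ((y.1 : ℤ) - y.2)) * tailEmb K n (kernelCoeff q t n x.2)) := by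
  rw [kernelCoeff, kernelSeries_succ, PowerSeries.coeff_mul]
  refine Finset.sum_congr rfl fun x _ => ?_
  rw [coeff_binSeries_mul, PowerSeries.coeff_map, Finset.sum_mul]
  refine Finset.sum_congr rfl fun y _ => ?_
  rw [smul_mul_assoc]
  rfl

/-! ### The one-row functions, and the expansion of the kernel function -/

/-- The one-row function in `N + 1` variables, defined by branching. -/
def oneRowFun (q t : K) : (N r : ℕ) → Laurent K (N + 1)
  | 0, r => if r = 0 then 1 else
      binCoeff q t r • (mono (Pi.single 0 (r : ℤ)) + mono (Pi.single 0 (-(r : ℤ))))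
  | N + 1, r => ∑ x ∈ antidiagonal r, ∑ y ∈ antidiagonal x.1,
      (binCoeff q t y.1 * binCoeff q t y.2 * branchFactor q t (t ^ N * q ^ x.2) y.1 y.2) •
        (mono (Pi.single 0 ((y.1 : ℤ) - y.2)) * tailEmb K (N + 1) (oneRowFun q t N x.2))

/-- The coefficients of the expansion of the kernel function in one-row functions. -/
def connCoeff (q t : K) (N m k : ℕ) : K :=
  binCoeff q t k * (qPoch (t ^ (N + 1) * q ^ m) q k / qPoch (t ^ N * q ^ (m + 1)) q k)

/-- Pairs `(a, b)` of minimum `k` and difference `m = r - 2k` contribute `x^{±m}`, with coefficient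
`binCoeff (m + k) * binCoeff k`; this is `connCoeff` times the coefficient `binCoeff m` of the
one-row function. -/
theorem kernelCoeff_one {q t : K} (hq : ∀ j, 1 ≤ j → q ^ j ≠ 1) (r : ℕ) :
    kernelCoeff q t 1 r =
      ∑ k ∈ Finset.range (r / 2 + 1), connCoeff q t 0 (r - 2 * k) k •
        oneRowFun q t 0 (r - 2 * k) := by
  have h1 : kernelCoeff q t 1 r = ∑ y ∈ antidiagonal r, (binCoeff q t y.1 * binCoeff q t y.2) •
        mono (Pi.single 0 ((y.1 : ℤ) - y.2)) := by
    rw [kernelCoeff, kernelSeries, Fin.prod_univ_one, coeff_binSeries_mul]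
  have hN := qPoch_self_ne_zero hq
  have h2 : ∀ m k, connCoeff q t 0 m k * binCoeff q t m = binCoeff q t (m + k) * binCoeff q t k := by
    intro m k
    have e1 := qPoch_add t q m k
    have e2 := qPoch_add q q m k
    have e3 := hN (m + k)
    rw [e2] at e3
    have := hN k
    have := right_ne_zero_of_mul e3
    have := hN m
    have e4 : q ^ (m + 1) = q * q ^ m := pow_succ' q m
    simp only [connCoeff, binCoeff, e1, e2, pow_zero, one_mul, zero_add, pow_one, e4]
    field_simp
  rw [h1, sum_antidiagonal_eq_sum_range (fun a b => (binCoeff q t a * binCoeff q t b) •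
        mono (Pi.single 0 ((a : ℤ) - b)))]
  refine Finset.sum_congr rfl fun k _ => ?_
  generalize r - 2 * k = m
  split_ifs with h
  · subst h
    have := h2 0 k
    rw [binCoeff_zero, mul_one, zero_add] at this
    simp [oneRowFun, this, mono_zero]
  · rw [oneRowFun, if_neg h, smul_smul, h2, smul_add, mul_comm (binCoeff q t k)]
    congr 4
    · push_cast; ring
    · push_cast; ring

/-- Splitting off `x_1` on both sides and comparing the terms with a fixed pair of multiplicities
and a fixed one-row function `P_m` of the other variables leaves `sum_binCoeff_branch` with `W = t^N
q^m`. -/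
theorem kernelCoeff_expansion {q t : K} (hq0 : q ≠ 0) (ht : t ≠ 0) (N : ℕ)
    (hqt : ∀ a b : ℕ, a ≤ N + 1 → (a, b) ≠ (0, 0) → t ^ a * q ^ b ≠ 1) (r : ℕ) :
    kernelCoeff q t (N + 1) r =
      ∑ k ∈ Finset.range (r / 2 + 1), connCoeff q t N (r - 2 * k) k •
        oneRowFun q t N (r - 2 * k) := by
  have hq : ∀ j, 1 ≤ j → q ^ j ≠ 1 := fun j hj => by
    simpa using hqt 0 j (by omega) (by simp; omega)
  induction N generalizing r with
  | zero => exact kernelCoeff_one hq r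
  | succ N ih =>
    have ih := ih fun a b ha => hqt a b (by omega)
    rw [kernelCoeff_succ]
    have e1 : ∀ x ∈ antidiagonal r, ∀ y ∈ antidiagonal x.1, (binCoeff q t y.1 * binCoeff q t y.2) •
        (mono (Pi.single 0 ((y.1 : ℤ) - y.2)) * tailEmb K (N + 1) (kernelCoeff q t (N + 1) x.2)) =
        ∑ k ∈ Finset.range (x.2 / 2 + 1),
          (binCoeff q t y.1 * binCoeff q t y.2 * connCoeff q t N (x.2 - 2 * k) k) •
          (mono (Pi.single 0 ((y.1 : ℤ) - y.2)) *
            tailEmb K (N + 1) (oneRowFun q t N (x.2 - 2 * k))) := by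
      intro x _ y _
      rw [ih, map_sum, Finset.mul_sum, Finset.smul_sum]
      refine Finset.sum_congr rfl fun k _ => ?_
      rw [map_smul, mul_smul_comm, smul_smul]
    rw [Finset.sum_congr rfl fun x hx => Finset.sum_congr rfl (e1 x hx)]
    rw [sum_antidiagonal_shift (fun a b m k =>
      (binCoeff q t a * binCoeff q t b * connCoeff q t N m k) •
          (mono (Pi.single 0 ((a : ℤ) - b)) * tailEmb K (N + 1) (oneRowFun q t N m)))]
    have e2 : ∀ k ∈ Finset.range (r / 2 + 1), connCoeff q t (N + 1) (r - 2 * k) k •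
        oneRowFun q t (N + 1) (r - 2 * k) =
        ∑ x ∈ antidiagonal (r - 2 * k), ∑ y ∈ antidiagonal x.1,
          (binCoeff q t y.1 * binCoeff q t y.2 * branchFactor q t (t ^ N * q ^ x.2) y.1 y.2 *
            connCoeff q t (N + 1) (y.1 + y.2 + x.2) k) •
        (mono (Pi.single 0 ((y.1 : ℤ) - y.2)) * tailEmb K (N + 1) (oneRowFun q t N x.2)) := by
      intro k _
      rw [oneRowFun, Finset.smul_sum]
      refine Finset.sum_congr rfl fun x hx => ?_
      rw [Finset.smul_sum]
      refine Finset.sum_congr rfl fun y hy => ?_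
      rw [Finset.HasAntidiagonal.mem_antidiagonal] at hx hy
      rw [smul_smul, hy, hx, mul_comm]
    rw [Finset.sum_congr rfl e2, sum_range_antidiagonal_shift (fun a b m k =>
      (binCoeff q t a * binCoeff q t b * branchFactor q t (t ^ N * q ^ m) a b *
            connCoeff q t (N + 1) (a + b + m) k) •
        (mono (Pi.single 0 ((a : ℤ) - b)) * tailEmb K (N + 1) (oneRowFun q t N m)))]
    refine Finset.sum_congr rfl fun x _ => Finset.sum_congr rfl fun y _ => ?_
    -- Lowering both multiplicities by `k` does not change the monomial in `x_1`, so the sum over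
    -- `k` is a scalar.
    have hexp : ∀ k ∈ Finset.range (min y.1 y.2 + 1),
        ((y.1 - k : ℕ) : ℤ) - ((y.2 - k : ℕ) : ℤ) = (y.1 : ℤ) - y.2 := fun k hk => by
      have := Finset.mem_range.mp hk
      omega
    have e3 : ∀ (c : ℕ → K) (Z : Laurent K (N + 2)), ∑ k ∈ Finset.range (min y.1 y.2 + 1),
        c k • (mono (Pi.single 0 (((y.1 - k : ℕ) : ℤ) - ((y.2 - k : ℕ) : ℤ))) * Z) =
        (∑ k ∈ Finset.range (min y.1 y.2 + 1), c k) •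
          (mono (Pi.single 0 ((y.1 : ℤ) - y.2)) * Z) := fun c Z => by
      rw [Finset.sum_smul]
      exact Finset.sum_congr rfl fun k hk => by rw [hexp k hk]
    refine (e3 _ _).trans (Eq.trans ?_ (e3 _ _).symm)
    congr 1
    have := sum_binCoeff_branch hq0 hq ht (W := t ^ N * q ^ x.2)
      (mul_ne_zero (pow_ne_zero _ ht) (pow_ne_zero _ hq0))
      (fun j hj => by rw [mul_assoc, ← pow_add]; exact hqt _ _ (by omega) (by simp; omega))
      (fun j => by
        rw [mul_assoc, mul_assoc, ← pow_add, ← mul_assoc, ← pow_succ']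
        exact hqt _ _ (by omega) (by simp)) y.1 y.2
    convert this using 2 with k _ k _
    · simp only [connCoeff]
      congr 4 <;> ring
    · simp only [connCoeff]
      congr 4 <;> ring

end OneRowD
end

noncomputable section
namespace OneRowD

/-! ### A partial fraction identity -/

section PartialFractions
variable {M : Type*} [Field M] {n : ℕ}

/-- The product `∏_{j ≠ i} (1 - t y x_j)(1 - t y / x_j) / ((1 - y x_j)(1 - y / x_j))`. -/
def shiftWeight (t : M) (x : Fin n → M) (i : Fin n) (y : M) : M :=
  ∏ j ∈ Finset.univ.erase i,
    ((1 - t * y * x j) * (1 - t * y / x j)) / ((1 - y * x j) * (1 - y / x j))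

/-- The variables and their inverses. -/
def letterVal (x : Fin n → M) : Letter n → M := Sum.elim x fun i => (x i)⁻¹

/-- The index of the variable of a letter. -/
def letterIdx : Letter n → Fin n := Sum.elim id id

/-- The polynomial `(X - x)(X - x⁻¹)`. -/
def quadPoly (x : M) : Polynomial M :=
  Polynomial.X ^ 2 - Polynomial.C (x + x⁻¹) * Polynomial.X + 1

/-- The polynomial `(X - t x)(X - t x⁻¹)`. -/
def quadPolyT (t x : M) : Polynomial M :=
  Polynomial.X ^ 2 - Polynomial.C (t * (x + x⁻¹)) * Polynomial.X + Polynomial.C (t ^ 2)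

theorem eval_quadPoly {x : M} (hx : x ≠ 0) (v : M) :
    (quadPoly x).eval v = (v - x) * (v - x⁻¹) := by
  simp [quadPoly]; field_simp; ring

theorem eval_quadPolyT {x : M} (hx : x ≠ 0) (t v : M) :
    (quadPolyT t x).eval v = (v - t * x) * (v - t * x⁻¹) := by
  simp [quadPolyT]; field_simp; ring

theorem monic_quadPoly (x : M) : (quadPoly x).Monic := by
  unfold quadPoly; monicity!

theorem monic_quadPolyT (t x : M) : (quadPolyT t x).Monic := by
  unfold quadPolyT; monicity!

theorem natDegree_quadPoly (x : M) : (quadPoly x).natDegree = 2 := by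
  unfold quadPoly; compute_degree!

theorem natDegree_quadPolyT (t x : M) : (quadPolyT t x).natDegree = 2 := by
  unfold quadPolyT; compute_degree!

theorem quadPolyT_eq (t x : M) :
    quadPolyT t x = Polynomial.C t * quadPoly x +
      (Polynomial.X ^ 2 - Polynomial.C t) * Polynomial.C (1 - t) := by
  simp only [quadPolyT, quadPoly, map_mul, map_add, map_sub, map_pow, map_one]; ring

/-- Modulo `X² - t` every `quadPolyT` equals `t` times `quadPoly`, by `quadPolyT_eq`. -/
theorem dvd_prod_quadPolyT_sub (t : M) (x : Fin n → M) :
    Polynomial.X ^ 2 - Polynomial.C t ∣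
      ∏ i, quadPolyT t (x i) - Polynomial.C (t ^ n) * ∏ i, quadPoly (x i) := by
  have h : Polynomial.C (t ^ n) * ∏ i, quadPoly (x i) =
      ∏ i, (Polynomial.C t * quadPoly (x i)) := by
    rw [Finset.prod_mul_distrib]; simp
  rw [h]
  refine (Ideal.Quotient.eq_zero_iff_dvd _ _).mp ?_
  rw [map_sub, map_prod, map_prod, sub_eq_zero]
  refine Finset.prod_congr rfl fun i _ => ?_
  rw [← sub_eq_zero, ← map_sub, Ideal.Quotient.eq_zero_iff_dvd]
  exact ⟨Polynomial.C (1 - t), by rw [quadPolyT_eq]; ring⟩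

/-- The numerator of the sum of partial fractions. -/
def fracNum (t : M) (x : Fin n → M) : Polynomial M :=
  (1 - Polynomial.X ^ 2) * ∏ i, quadPolyT t (x i) +
    (Polynomial.X ^ 2 - Polynomial.C (t + (1 - t) * t ^ n)) * ∏ i, quadPoly (x i)

/-- Modulo `X² = t` the first product is `t^n` times the second; the constant `t + (1-t) t^n` in
`fracNum` is the one that makes the sum vanish. -/
theorem dvd_fracNum (t : M) (x : Fin n → M) :
    Polynomial.X ^ 2 - Polynomial.C t ∣ fracNum t x := by
  obtain ⟨S, hS⟩ := dvd_prod_quadPolyT_sub t x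
  refine ⟨(1 - Polynomial.X ^ 2) * S +
    (1 - Polynomial.C (t ^ n)) * ∏ i, quadPoly (x i), ?_⟩
  rw [sub_eq_iff_eq_add] at hS
  rw [fracNum, hS]
  simp only [map_mul, map_add, map_sub, map_pow, map_one]
  ring

theorem natDegree_prod_quadPoly (x : Fin n → M) : (∏ i, quadPoly (x i)).natDegree = 2 * n := by
  rw [Polynomial.natDegree_prod_of_monic _ _ fun i _ => monic_quadPoly _]
  simp [natDegree_quadPoly, mul_comm]

theorem natDegree_prod_quadPolyT (t : M) (x : Fin n → M) :
    (∏ i, quadPolyT t (x i)).natDegree = 2 * n := by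
  rw [Polynomial.natDegree_prod_of_monic _ _ fun i _ => monic_quadPolyT _ _]
  simp [natDegree_quadPolyT, mul_comm]

/-- Both products are monic of degree `2n`, so the terms `∓X^{2n+2}` cancel. -/
theorem degree_fracNum_lt (t : M) (x : Fin n → M) : (fracNum t x).degree < (2 * n + 2 : ℕ) := by
  have m1 : (∏ i, quadPoly (x i)).Monic := Polynomial.monic_prod_of_monic _ _ fun i _ => monic_quadPoly _
  have m2 : (∏ i, quadPolyT t (x i)).Monic :=
    Polynomial.monic_prod_of_monic _ _ fun i _ => monic_quadPolyT _ _
  have d1 : (∏ i, quadPoly (x i)).degree = (2 * n : ℕ) := by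
    rw [Polynomial.degree_eq_natDegree m1.ne_zero, natDegree_prod_quadPoly]
  have d2 : (∏ i, quadPolyT t (x i)).degree = (2 * n : ℕ) := by
    rw [Polynomial.degree_eq_natDegree m2.ne_zero, natDegree_prod_quadPolyT]
  have h : (∏ i, quadPoly (x i) - ∏ i, quadPolyT t (x i)).degree < (2 * n : ℕ) := by
    rw [← d1]
    exact Polynomial.degree_sub_lt_left (d1.trans d2.symm) m1.ne_zero
      (by rw [m1.leadingCoeff, m2.leadingCoeff])
  have e : fracNum t x = Polynomial.X ^ 2 * (∏ i, quadPoly (x i) - ∏ i, quadPolyT t (x i)) +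
      (∏ i, quadPolyT t (x i) - Polynomial.C (t + (1 - t) * t ^ n) * ∏ i, quadPoly (x i)) := by
    rw [fracNum]; ring
  rw [e]
  refine (Polynomial.degree_add_le _ _).trans_lt (max_lt ?_ ?_)
  · rw [Polynomial.degree_mul, Polynomial.degree_X_pow, add_comm]
    rw [Nat.cast_add]
    exact WithBot.add_lt_add_right (by simp) h
  · refine (Polynomial.degree_sub_le _ _).trans_lt (max_lt ?_ ?_)
    · rw [d2]; exact_mod_cast (by omega)
    · rw [← Polynomial.smul_eq_C_mul]
      refine (Polynomial.degree_smul_le _ _).trans_lt ?_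
      rw [d1]; exact_mod_cast (by omega)

/-- The sum of partial fractions, as an interpolation polynomial. -/
def fracInterp (t : M) (x : Fin n → M) : Polynomial M :=
  ∑ k : Letter n, Polynomial.C ((1 - t) * shiftWeight t x (letterIdx k) (letterVal x k)) *
    ((∏ j ∈ Finset.univ.erase (letterIdx k), quadPoly (x j)) *
      (1 - Polynomial.C (letterVal x k)⁻¹ * Polynomial.X))

theorem degree_fracInterp_lt (t : M) (x : Fin n → M) :
    (fracInterp t x).degree < (2 * n : ℕ) := by
  refine (Polynomial.degree_sum_le _ _).trans_lt ?_
  rw [Finset.sup_lt_iff (WithBot.bot_lt_coe _)]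
  intro k _
  have hn : 0 < n := (letterIdx k).pos
  rw [← Polynomial.smul_eq_C_mul]
  refine (Polynomial.degree_smul_le _ _).trans_lt ?_
  refine (Polynomial.degree_mul_le _ _).trans_lt ?_
  have h1 : (∏ j ∈ Finset.univ.erase (letterIdx k), quadPoly (x j)).degree ≤ (2 * (n - 1) : ℕ) := by
    refine Polynomial.degree_le_of_natDegree_le ?_
    rw [Polynomial.natDegree_prod_of_monic _ _ fun i _ => monic_quadPoly _]
    simp [natDegree_quadPoly, mul_comm]
  have h2 : (1 - Polynomial.C (letterVal x k)⁻¹ * Polynomial.X : Polynomial M).degree ≤ (1 : ℕ) := by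
    refine Polynomial.degree_le_of_natDegree_le ?_
    compute_degree
  refine (add_le_add h1 h2).trans_lt ?_
  rw [← Nat.cast_add]
  exact_mod_cast (by omega)

theorem letterVal_ne_zero {x : Fin n → M} (hx : ∀ i, x i ≠ 0) (k : Letter n) :
    letterVal x k ≠ 0 := by
  rcases k with i | i
  · exact hx i
  · exact inv_ne_zero (hx i)

theorem letterVal_swap (x : Fin n → M) (k : Letter n) :
    letterVal x k.swap = (letterVal x k)⁻¹ := by
  rcases k with i | i <;> simp [letterVal]

theorem letterIdx_swap (k : Letter n) : letterIdx k.swap = letterIdx k := by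
  rcases k with i | i <;> simp [letterIdx]

theorem eval_quadPoly_letter {x : Fin n → M} (hx : ∀ i, x i ≠ 0) (k : Letter n) (v : M) :
    (quadPoly (x (letterIdx k))).eval v = (1 - v * letterVal x k) * (1 - v * (letterVal x k)⁻¹) := by
  have := hx (letterIdx k)
  rcases k with i | i <;> simp only [letterIdx, letterVal, Sum.elim_inl, Sum.elim_inr, id] at * <;>
    rw [eval_quadPoly this] <;> field_simp <;> ring

theorem eval_quadPolyT_letter {x : Fin n → M} (hx : ∀ i, x i ≠ 0) (k : Letter n) (t : M) :
    (quadPolyT t (x (letterIdx k))).eval (letterVal x k) =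
      (1 - t) * ((letterVal x k) ^ 2 - t) := by
  have := hx (letterIdx k)
  rcases k with i | i <;> simp only [letterIdx, letterVal, Sum.elim_inl, Sum.elim_inr, id] at * <;>
    rw [eval_quadPolyT this] <;> field_simp

theorem eval_quadPoly_ne_zero {x : Fin n → M} (hx : ∀ i, x i ≠ 0)
    (hinj : Function.Injective (letterVal x)) (k : Letter n) {j : Fin n} (hj : j ≠ letterIdx k) :
    (quadPoly (x j)).eval (letterVal x k) ≠ 0 := by
  rw [eval_quadPoly (hx j)]
  refine mul_ne_zero (sub_ne_zero.mpr fun h => ?_) (sub_ne_zero.mpr fun h => ?_)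
  · have : k = Sum.inl j := hinj (by rw [h]; rfl)
    exact hj (by rw [this]; rfl)
  · have : k = Sum.inr j := hinj (by rw [h]; rfl)
    exact hj (by rw [this]; rfl)

theorem shiftWeight_inv {x : Fin n → M} (hx : ∀ i, x i ≠ 0) (t : M) (i : Fin n) {y : M}
    (hy : y ≠ 0) : shiftWeight t x i y⁻¹ =
      ∏ j ∈ Finset.univ.erase i, (quadPolyT t (x j)).eval y / (quadPoly (x j)).eval y := by
  refine Finset.prod_congr rfl fun j _ => ?_
  have hj := hx j
  have e1 : (quadPolyT t (x j)).eval y =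
      y ^ 2 * ((1 - t * y⁻¹ * x j) * (1 - t * y⁻¹ / x j)) := by
    rw [eval_quadPolyT hj]; field_simp
  have e2 : (quadPoly (x j)).eval y = y ^ 2 * ((1 - y⁻¹ * x j) * (1 - y⁻¹ / x j)) := by
    rw [eval_quadPoly hj]; field_simp
  rw [e1, e2, mul_div_mul_left _ _ (pow_ne_zero 2 hy)]

/-- Only the summand of the inverse letter survives: a letter of another variable brings the factor
`quadPoly` vanishing at this point, and the letter itself the factor `1 - z⁻¹ z`. -/
theorem eval_fracInterp_letter {x : Fin n → M} (hx : ∀ i, x i ≠ 0)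
    (hinj : Function.Injective (letterVal x)) (t : M) (k : Letter n) :
    (fracInterp t x).eval (letterVal x k) = (1 - t) * (1 - letterVal x k ^ 2) *
      ∏ j ∈ Finset.univ.erase (letterIdx k), (quadPolyT t (x j)).eval (letterVal x k) := by
  have hy := letterVal_ne_zero hx k
  rw [fracInterp, Polynomial.eval_finsetSum, Finset.sum_eq_single k.swap]
  · simp only [Polynomial.eval_mul, Polynomial.eval_C, Polynomial.eval_prod, Polynomial.eval_sub,
      Polynomial.eval_one, Polynomial.eval_X, letterIdx_swap, letterVal_swap, inv_inv]
    rw [shiftWeight_inv hx t _ hy, Finset.prod_div_distrib]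
    have : ∏ j ∈ Finset.univ.erase (letterIdx k), (quadPoly (x j)).eval (letterVal x k) ≠ 0 :=
      Finset.prod_ne_zero_iff.mpr fun j hj =>
        eval_quadPoly_ne_zero hx hinj k (Finset.ne_of_mem_erase hj)
    field_simp
  · intro k' _ hk'
    simp only [Polynomial.eval_mul, Polynomial.eval_C, Polynomial.eval_prod, Polynomial.eval_sub,
      Polynomial.eval_one, Polynomial.eval_X]
    by_cases h : letterIdx k' = letterIdx k
    · have : k' = k := by
        rcases k with i | i <;> rcases k' with j | j <;> simp_all [letterIdx]
      subst this
      rw [inv_mul_cancel₀ hy, sub_self, mul_zero, mul_zero]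
    · rw [Finset.prod_eq_zero (i := letterIdx k)
        (Finset.mem_erase.mpr ⟨Ne.symm h, Finset.mem_univ _⟩), zero_mul, mul_zero]
      rw [eval_quadPoly_letter hx k, mul_inv_cancel₀ hy, sub_self, mul_zero]
  · simp

/-- The quotient by `X² - t` and the interpolation polynomial both have degree below `2n` and agree
at the `2n` distinct letters, where `z² ≠ t` allows the division. -/
theorem fracNum_eq {x : Fin n → M} (hx : ∀ i, x i ≠ 0)
    (hinj : Function.Injective (letterVal x)) {t : M} (ht : ∀ k, letterVal x k ^ 2 ≠ t) :
    fracNum t x = (Polynomial.X ^ 2 - Polynomial.C t) * fracInterp t x := by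
  obtain ⟨S, hS⟩ := dvd_fracNum t x
  suffices h : S = fracInterp t x by rw [← h, hS]
  refine Polynomial.eq_of_degrees_lt_of_eval_index_eq (s := Finset.univ) (v := letterVal x)
    hinj.injOn ?_ ?_ ?_
  · have h1 := degree_fracNum_lt t x
    have h2 : (Polynomial.X ^ 2 - Polynomial.C t : Polynomial M).degree = (2 : ℕ) :=
      Polynomial.degree_X_pow_sub_C (by norm_num) t
    have h3 : (Finset.univ : Finset (Letter n)).card = 2 * n := by simp; ring
    rw [h3]
    rw [hS, Polynomial.degree_mul, h2] at h1
    by_cases hS0 : S = 0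
    · rw [hS0, Polynomial.degree_zero]; exact WithBot.bot_lt_coe _
    · rw [Polynomial.degree_eq_natDegree hS0] at h1 ⊢
      norm_cast at h1 ⊢
      omega
  · have h3 : (Finset.univ : Finset (Letter n)).card = 2 * n := by simp; ring
    rw [h3]
    exact degree_fracInterp_lt t x
  · intro k _
    have hy := letterVal_ne_zero hx k
    have h0 : letterVal x k ^ 2 - t ≠ 0 := sub_ne_zero.mpr (ht k)
    refine mul_left_cancel₀ h0 ?_
    have h1 := congrArg (Polynomial.eval (letterVal x k)) hS
    simp only [fracNum, Polynomial.eval_mul, Polynomial.eval_C, Polynomial.eval_prod,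
      Polynomial.eval_add, Polynomial.eval_pow,
      Polynomial.eval_sub, Polynomial.eval_one, Polynomial.eval_X] at h1
    rw [eval_fracInterp_letter hx hinj, ← h1, Finset.prod_eq_zero (i := letterIdx k)
      (f := fun j => Polynomial.eval (letterVal x k) (quadPoly (x j))) (Finset.mem_univ _),
      ← Finset.mul_prod_erase Finset.univ _ (Finset.mem_univ (letterIdx k)),
      eval_quadPolyT_letter hx]
    · ring
    · rw [eval_quadPoly_letter hx k, mul_inv_cancel₀ hy, sub_self, mul_zero]

/-- The partial fraction identity for `∑_z A_z / (1 - v z)`. -/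
theorem sum_shiftWeight_div {x : Fin n → M} (hx : ∀ i, x i ≠ 0)
    (hinj : Function.Injective (letterVal x)) {t : M} (ht : ∀ k, letterVal x k ^ 2 ≠ t) {v : M}
    (hv : ∀ k, 1 - v * letterVal x k ≠ 0) :
    (v ^ 2 - t) * ((1 - t) *
      ∑ k, shiftWeight t x (letterIdx k) (letterVal x k) / (1 - v * letterVal x k)) *
        ∏ i, (quadPoly (x i)).eval v =
      (1 - v ^ 2) * ∏ i, (quadPolyT t (x i)).eval v +
        (v ^ 2 - (t + (1 - t) * t ^ n)) * ∏ i, (quadPoly (x i)).eval v := by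
  have h := congrArg (Polynomial.eval v) (fracNum_eq hx hinj ht)
  simp only [fracNum, Polynomial.eval_mul, Polynomial.eval_C, Polynomial.eval_prod,
    Polynomial.eval_add, Polynomial.eval_pow,
    Polynomial.eval_sub, Polynomial.eval_one, Polynomial.eval_X] at h
  rw [h, mul_assoc]
  congr 1
  rw [fracInterp, Polynomial.eval_finsetSum, Finset.mul_sum, Finset.sum_mul]
  refine Finset.sum_congr rfl fun k _ => ?_
  simp only [Polynomial.eval_mul, Polynomial.eval_C, Polynomial.eval_prod,
    Polynomial.eval_sub, Polynomial.eval_one, Polynomial.eval_X]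
  rw [← Finset.mul_prod_erase Finset.univ _ (Finset.mem_univ (letterIdx k)),
    eval_quadPoly_letter hx k]
  have := hv k
  field_simp

end PartialFractions
end OneRowD
end

noncomputable section
namespace OneRowD

/-! ### The difference equation of the kernel function -/

section KernelEquation
variable {M : Type*} [Field M] {n : ℕ}

/-- The difference operator applied to the kernel function, in terms of shifts of the auxiliary
variable `u`. Here `Φ`, `Φp`, `Φm` are the kernel function at `u`, `q u`, `u / q`, and `Φz k` is
the kernel function with the variable of the letter `k` shifted. -/
theorem sum_shiftWeight_kernel {x : Fin n → M} (hn : 1 ≤ n) (hx : ∀ i, x i ≠ 0)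
    (hinj : Function.Injective (letterVal x)) {q t u : M} (hq : q ≠ 0) (ht0 : t ≠ 0)
    (hu : u ≠ 0)
    (ht : ∀ k, letterVal x k ^ 2 ≠ t) (h1 : ∀ k, 1 - t * u * letterVal x k ≠ 0)
    (h2 : ∀ k, 1 - u * letterVal x k / q ≠ 0)
    {Φ Φp Φm : M} {Φz : Letter n → M}
    (hz : ∀ k, (1 - t * u * letterVal x k) * (1 - u * (letterVal x k)⁻¹ / q) * Φz k =
      (1 - u * letterVal x k) * (1 - t * u * (letterVal x k)⁻¹ / q) * Φ)
    (hp : (∏ k, (1 - t * u * letterVal x k)) * Φp = (∏ k, (1 - u * letterVal x k)) * Φ)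
    (hm : (∏ k, (1 - u * letterVal x k / q)) * Φm = (∏ k, (1 - t * u * letterVal x k / q)) * Φ) :
    t ^ 2 * ((q - t * u ^ 2) * (t * u ^ 2 - 1) * (q ^ 2 - t * u ^ 2)) *
        ∑ k, shiftWeight t x (letterIdx k) (letterVal x k) * (Φz k - Φ) =
      t * (1 - t * (t ^ (n - 1)) ^ 2 + t ^ (n - 1) - t * t ^ (n - 1)) *
          ((q - t * u ^ 2) * (t * u ^ 2 - 1) * (q ^ 2 - t * u ^ 2)) * Φ +
        (t ^ 2 * u ^ 2 - q) * (q ^ 2 - t * u ^ 2) *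
          ((1 - t ^ 2 * u ^ 2) * (t * t ^ (n - 1)) ^ 2 * Φp +
            (t ^ 2 * u ^ 2 - (t + (1 - t) * (t * t ^ (n - 1)))) * Φ) +
        t ^ 2 * (u ^ 2 - q) * (t * u ^ 2 - 1) *
          ((u ^ 2 - q ^ 2) * Φm + (q ^ 2 - (t + (1 - t) * (t * t ^ (n - 1))) * u ^ 2) * Φ) := by
  obtain ⟨N, rfl⟩ := Nat.exists_eq_add_of_le' hn
  simp only [Nat.add_sub_cancel]
  have hT : t ^ (N + 1) = t * t ^ N := pow_succ' t N
  set T := t ^ N with hTdef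
  have hsplit : ∀ f : M → M, ∏ k, f (letterVal x k) = ∏ i, (f (x i) * f (x i)⁻¹) := fun f => by
    rw [Fintype.prod_sum_type, Finset.prod_mul_distrib]; rfl
  have h2' : ∀ k, 1 - u * (letterVal x k)⁻¹ / q ≠ 0 := fun k => by
    rw [← letterVal_swap]; exact h2 _
  have hzu : ∀ k, q * letterVal x k - u ≠ 0 := fun k h => h2' k (by
    have := letterVal_ne_zero hx k
    have e : u = q * letterVal x k := (sub_eq_zero.mp h).symm
    rw [e]; field_simp; ring)
  have h2'' : ∀ k, 1 - q / u * letterVal x k ≠ 0 := fun k h => hzu k (by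
    have : 1 - q / u * letterVal x k = (u - q * letterVal x k) / u := by field_simp
    rw [this, div_eq_zero_iff, or_iff_left hu] at h
    rw [← neg_sub, h, neg_zero])
  -- the values of the partial fraction sum
  have D0 := sum_shiftWeight_div hx hinj ht (v := 0) (by simp)
  have D1 := sum_shiftWeight_div hx hinj ht (v := t * u) h1
  have D2 := sum_shiftWeight_div hx hinj ht (v := q / u) h2''
  set P0 := ∑ k, shiftWeight t x (letterIdx k) (letterVal x k) / (1 - 0 * letterVal x k) with hP0
  set P1 := ∑ k, shiftWeight t x (letterIdx k) (letterVal x k) / (1 - t * u * letterVal x k)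
    with hP1
  set P2 := ∑ k, shiftWeight t x (letterIdx k) (letterVal x k) / (1 - q / u * letterVal x k)
    with hP2
  have E0 : -t * ((1 - t) * P0) = (t * T) ^ 2 - (t + (1 - t) * (t * T)) := by
    have e1 : ∏ i, (quadPoly (x i)).eval 0 = 1 := by simp [quadPoly]
    have e2 : ∏ i, (quadPolyT t (x i)).eval 0 = (t * T) ^ 2 := by
      simp only [quadPolyT]; simp; rw [← hT]; ring
    rw [e1, e2, hT] at D0
    linear_combination D0
  -- At `v = tu` the ratio of the two products is `t^{2n} Φ(qu)/Φ(u)`.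
  have E1 : (t ^ 2 * u ^ 2 - t) * ((1 - t) * P1) * Φ =
      (1 - t ^ 2 * u ^ 2) * (t * T) ^ 2 * Φp + (t ^ 2 * u ^ 2 - (t + (1 - t) * (t * T))) * Φ := by
    have e1 : ∏ i, (quadPoly (x i)).eval (t * u) = ∏ k, (1 - t * u * letterVal x k) := by
      rw [hsplit fun z => 1 - t * u * z]
      refine Finset.prod_congr rfl fun i _ => ?_
      have := hx i
      rw [eval_quadPoly this]; field_simp; ring
    have e2 : ∏ i, (quadPolyT t (x i)).eval (t * u) =
        (t * T) ^ 2 * ∏ k, (1 - u * letterVal x k) := by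
      rw [hsplit fun z => 1 - u * z, ← hT, ← pow_mul, mul_comm (N + 1) 2, pow_mul]
      have : (t ^ 2) ^ (N + 1) = ∏ _i : Fin (N + 1), t ^ 2 := by simp
      rw [this, ← Finset.prod_mul_distrib]
      refine Finset.prod_congr rfl fun i _ => ?_
      have := hx i
      rw [eval_quadPolyT this]; field_simp; ring
    have e3 : ∏ k, (1 - t * u * letterVal x k) ≠ 0 := Finset.prod_ne_zero_iff.mpr fun k _ => h1 k
    rw [e1, e2, hT] at D1
    refine mul_left_cancel₀ e3 ?_
    linear_combination Φ * D1 - (1 - t ^ 2 * u ^ 2) * (t * T) ^ 2 * hp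
  -- At `v = q/u` the ratio is `Φ(u/q)/Φ(u)`.
  have E2 : (q ^ 2 - t * u ^ 2) * ((1 - t) * P2) * Φ =
      (u ^ 2 - q ^ 2) * Φm + (q ^ 2 - (t + (1 - t) * (t * T)) * u ^ 2) * Φ := by
    have e1 : ∏ i, (quadPoly (x i)).eval (q / u) =
        ((q / u) ^ 2) ^ (N + 1) * ∏ k, (1 - u * letterVal x k / q) := by
      rw [hsplit fun z => 1 - u * z / q]
      have : ((q / u) ^ 2) ^ (N + 1) = ∏ _i : Fin (N + 1), (q / u) ^ 2 := by simp
      rw [this, ← Finset.prod_mul_distrib]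
      refine Finset.prod_congr rfl fun i _ => ?_
      have := hx i
      rw [eval_quadPoly this]; field_simp
    have e2 : ∏ i, (quadPolyT t (x i)).eval (q / u) =
        ((q / u) ^ 2) ^ (N + 1) * ∏ k, (1 - t * u * letterVal x k / q) := by
      rw [hsplit fun z => 1 - t * u * z / q]
      have : ((q / u) ^ 2) ^ (N + 1) = ∏ _i : Fin (N + 1), (q / u) ^ 2 := by simp
      rw [this, ← Finset.prod_mul_distrib]
      refine Finset.prod_congr rfl fun i _ => ?_
      have := hx i
      rw [eval_quadPolyT this]; field_simp
    have e3 : ∏ k, (1 - u * letterVal x k / q) ≠ 0 := Finset.prod_ne_zero_iff.mpr fun k _ => h2 k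
    have e4 : ((q / u) ^ 2) ^ (N + 1) ≠ 0 := pow_ne_zero _ (pow_ne_zero _ (div_ne_zero hq hu))
    rw [e1, e2, hT] at D2
    refine mul_left_cancel₀ (mul_ne_zero e4 e3) ?_
    have e5 : (q / u) ^ 2 * u ^ 2 = q ^ 2 := by field_simp
    generalize ((q / u) ^ 2) ^ (N + 1) = c at *
    generalize q / u = w at *
    rw [← e5]
    linear_combination u ^ 2 * Φ * D2 - c * u ^ 2 * (1 - w ^ 2) * hm
  -- As a function of the letter `z`, the quotient `Φz/Φ - 1` has poles only at `z = 1/(tu)` and `z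
  -- = u/q`, so it is a combination of `1`, `1/(1 - tuz)` and `1/(1 - (q/u)z)`. The two poles
  -- coincide when `q = tu²`.
  have S : (q - t * u ^ 2) * ∑ k, shiftWeight t x (letterIdx k) (letterVal x k) * (Φz k - Φ) =
      (t - 1) * ((q / t - t * u ^ 2) * P1 + (u ^ 2 - q) * (P0 - P2) + (q - q / t) * P0) * Φ := by
    rw [hP0, hP1, hP2]
    simp only [← Finset.sum_sub_distrib, Finset.mul_sum, ← Finset.sum_add_distrib, Finset.sum_mul]
    refine Finset.sum_congr rfl fun k _ => ?_
    have hz := hz k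
    have a1 := h1 k
    have a2 := h2' k
    have a3 := h2'' k
    have a4 := letterVal_ne_zero hx k
    have a5 := hzu k
    generalize letterVal x k = z at *
    generalize shiftWeight t x (letterIdx k) z = A at *
    have b1 : 1 - u * z⁻¹ / q = (q * z - u) / (q * z) := by field_simp
    have b2 : 1 - q / u * z = -(q * z - u) / u := by field_simp; ring
    have b3 : Φz k = (1 - u * z) * (1 - t * u * z⁻¹ / q) * Φ /
        ((1 - t * u * z) * ((q * z - u) / (q * z))) := by
      rw [← b1, eq_div_iff (mul_ne_zero a1 a2), ← hz]; ring
    rw [b3, b2]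
    field_simp
    ring
  have hw : q / t * t = q := by field_simp
  generalize q / t = w at *
  linear_combination t ^ 2 * (t * u ^ 2 - 1) * (q ^ 2 - t * u ^ 2) * S +
    (t ^ 2 * u ^ 2 - q) * (q ^ 2 - t * u ^ 2) * E1 + t ^ 2 * (u ^ 2 - q) * (t * u ^ 2 - 1) * E2 -
    (q - t * u ^ 2) * (t * u ^ 2 - 1) * (q ^ 2 - t * u ^ 2) * Φ * E0 +
    t * (t * u ^ 2 - 1) * (q ^ 2 - t * u ^ 2) * (t - 1) * (P1 - P0) * Φ * hw

end KernelEquation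
end OneRowD
end

noncomputable section
namespace OneRowD
variable {K : Type*} [Field K]
open PowerSeries (C coeff rescale)

/-! ### The difference equation of the connection series -/

theorem coeff_succ_linear (a b : K) (φ : PowerSeries K) (k : ℕ) :
    coeff (k + 1) ((C a + C b * PowerSeries.X) * φ) = a * coeff (k + 1) φ + b * coeff k φ := by
  rw [add_mul, map_add, PowerSeries.coeff_C_mul, mul_assoc, PowerSeries.coeff_C_mul,
    PowerSeries.coeff_succ_X_mul]

theorem coeff_zero_linear (a b : K) (φ : PowerSeries K) :
    coeff 0 ((C a + C b * PowerSeries.X) * φ) = a * coeff 0 φ := by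
  rw [add_mul, map_add, PowerSeries.coeff_C_mul, mul_assoc, PowerSeries.coeff_C_mul,
    PowerSeries.coeff_zero_X_mul]
  ring

/-- The series of the connection coefficients. -/
def connSeries (q t : K) (N m : ℕ) : PowerSeries K := PowerSeries.mk (connCoeff q t N m)

theorem connCoeff_succ {q t : K} (N : ℕ)
    (hqt : ∀ a b : ℕ, a ≤ N + 1 → (a, b) ≠ (0, 0) → t ^ a * q ^ b ≠ 1) (m k : ℕ) :
    connCoeff q t N m (k + 1) = connCoeff q t N m k *
      ((1 - t * q ^ k) * (1 - t * (t ^ N * q ^ m) * q ^ k)) /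
        ((1 - q * q ^ k) * (1 - q * (t ^ N * q ^ m) * q ^ k)) := by
  have hq : ∀ j, 1 ≤ j → q ^ j ≠ 1 := fun j hj => by
    simpa using hqt 0 j (by omega) (by simp; omega)
  have h1 := qPoch_self_ne_zero hq k
  have h2 : 1 - q * q ^ k ≠ 0 := by
    rw [← pow_succ', sub_ne_zero]; exact (hq _ (by omega)).symm
  have h3 : qPoch (t ^ N * q ^ (m + 1)) q k ≠ 0 := qPoch_ne_zero fun i _ => by
    rw [mul_assoc, ← pow_add]; exact hqt _ _ (by omega) (by simp)
  have h4 : 1 - q * (t ^ N * q ^ m) * q ^ k ≠ 0 := by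
    rw [sub_ne_zero, show q * (t ^ N * q ^ m) * q ^ k = t ^ N * q ^ (1 + m + k) by ring]
    exact (hqt _ _ (by omega) (by simp)).symm
  have e1 : t ^ (N + 1) * q ^ m = t * (t ^ N * q ^ m) := by ring
  have e2 : t ^ N * q ^ (m + 1) * q ^ k = q * (t ^ N * q ^ m) * q ^ k := by ring
  simp only [connCoeff, binCoeff, qPoch_succ, e1, e2]
  generalize qPoch (t ^ N * q ^ (m + 1)) q k = y at *
  field_simp

/-- This is the eigenvalue equation of `u^m F_m(u²)` under the operator in `u` of
`kernelVal_equation`, with `X` standing for `u²` and `w = q^m` coming from the shift of `u^m`. Each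
coefficient involves at most four consecutive connection coefficients, all multiples of the lowest
one by `connCoeff_succ`. -/
theorem connSeries_equation {q t : K} (hq0 : q ≠ 0) (ht : t ≠ 0) (N : ℕ)
    (hqt : ∀ a b : ℕ, a ≤ N + 1 → (a, b) ≠ (0, 0) → t ^ a * q ^ b ≠ 1) (m : ℕ) {T d w γ : K}
    (hT : T = t ^ N) (hw : w = q ^ m) (hd : d = (T * w + (T * w)⁻¹ - T - T⁻¹))
    (hγ : γ = t + (1 - t) * (t * T)) :
    (C q + C (-t) * PowerSeries.X) * ((C (-1) + C t * PowerSeries.X) *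
      ((C (q ^ 2) + C (-t) * PowerSeries.X) *
        (C (T * t ^ 2 * d - t * (1 - t * T ^ 2 + T - t * T)) * connSeries q t N m))) =
    (C (-q) + C (t ^ 2) * PowerSeries.X) * ((C (q ^ 2) + C (-t) * PowerSeries.X) *
      ((C 1 + C (-t ^ 2) * PowerSeries.X) *
          (C ((t * T) ^ 2 * w) * rescale (q ^ 2) (connSeries q t N m)) +
        (C (-γ) + C (t ^ 2) * PowerSeries.X) * connSeries q t N m)) +
    (C (-q) + C 1 * PowerSeries.X) * ((C (-1) + C t * PowerSeries.X) *
      ((C (-q ^ 2) + C 1 * PowerSeries.X) *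
          (C (t ^ 2 * w⁻¹) * rescale (q⁻¹ ^ 2) (connSeries q t N m)) +
        (C (q ^ 2) + C (-γ) * PowerSeries.X) * (C (t ^ 2) * connSeries q t N m))) := by
  have hq : ∀ j, 1 ≤ j → q ^ j ≠ 1 := fun j hj => by
    simpa using hqt 0 j (by omega) (by simp; omega)
  have hT0 : T ≠ 0 := hT ▸ pow_ne_zero _ ht
  have hw0 : w ≠ 0 := hw ▸ pow_ne_zero _ hq0
  have hf := connCoeff_succ N hqt m
  have hd' : T * d = T ^ 2 * w + w⁻¹ - T ^ 2 - 1 := by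
    rw [hd]; field_simp
  have hC : T * t ^ 2 * d = t ^ 2 * (T ^ 2 * w + w⁻¹ - T ^ 2 - 1) := by
    rw [← hd']; ring
  rw [hC, hγ]
  have n1 : ∀ k : ℕ, 1 - q * q ^ k ≠ 0 := fun k => by
    rw [← pow_succ', sub_ne_zero]; exact (hq _ (by omega)).symm
  have n2 : ∀ k : ℕ, 1 - q * T * w * q ^ k ≠ 0 := fun k => by
    rw [sub_ne_zero, hT, hw, show q * t ^ N * q ^ m * q ^ k = t ^ N * q ^ (1 + m + k) by ring]
    exact (hqt _ _ (by omega) (by simp)).symm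
  rw [← hT, ← hw] at hf
  have hf0 : connCoeff q t N m 0 = 1 := by simp [connCoeff]
  have hg : ∀ k, connCoeff q t N m (k + 1) = connCoeff q t N m k *
      ((1 - t * q ^ k) * (1 - t * T * w * q ^ k)) /
        ((1 - q * q ^ k) * (1 - q * T * w * q ^ k)) := fun k => by
    rw [hf]; simp only [mul_assoc]
  clear hf hd hd' hC hqt hγ hq hT hw
  ext k
  simp only [connSeries]
  generalize connCoeff q t N m = f at *
  -- The equation has degree three in `X`, so the first three coefficients are truncated and checked
  -- separately.
  obtain _ | _ | _ | k := k
  · simp only [coeff_zero_linear, map_add, PowerSeries.coeff_C_mul, PowerSeries.coeff_rescale,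
      PowerSeries.coeff_mk, hf0]
    field_simp
    ring
  · have m1 := n1 0
    have m2 := n2 0
    have g1 := hg 0
    simp only [pow_zero, mul_one] at m1 m2 g1
    simp only [coeff_zero_linear, coeff_succ_linear, map_add, PowerSeries.coeff_C_mul,
      PowerSeries.coeff_rescale, PowerSeries.coeff_mk, hf0, g1, zero_add]
    clear n1 n2 hg
    field_simp
    ring
  · have g1 := hg 0
    have g2 := hg 1
    simp only [pow_zero, mul_one, zero_add, pow_one] at g1 g2
    have m1 := mul_ne_zero (n1 0) (n2 0)
    have m2 := mul_ne_zero (n1 1) (n2 1)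
    simp only [pow_zero, mul_one, pow_one] at m1 m2
    -- The denominators stay atomic until fractions are cleared, and are expanded only for the final
    -- polynomial identity.
    obtain ⟨D1, e1⟩ : ∃ D, D = (1 - q) * (1 - q * T * w) := ⟨_, rfl⟩
    obtain ⟨D2, e2⟩ : ∃ D, D = (1 - q * q) * (1 - q * T * w * q) := ⟨_, rfl⟩
    rw [← e1] at m1 g1
    rw [← e2] at m2 g2
    simp only [coeff_zero_linear, coeff_succ_linear, map_add, PowerSeries.coeff_C_mul,
      PowerSeries.coeff_rescale, PowerSeries.coeff_mk, hf0, g1, g2, zero_add]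
    clear n1 n2 hg g1 g2 hf0
    simp only [one_mul, mul_one, pow_zero, pow_one, ← pow_mul, Nat.reduceAdd, Nat.reduceMul,
      inv_pow]
    field_simp
    rw [e1, e2]
    ring
  · have hQ : q ^ k ≠ 0 := pow_ne_zero _ hq0
    have g1 := hg k
    have g2 := hg (k + 1)
    have g3 := hg (k + 1 + 1)
    have m1 := mul_ne_zero (n1 k) (n2 k)
    have m2 := mul_ne_zero (n1 (k + 1)) (n2 (k + 1))
    have m3 := mul_ne_zero (n1 (k + 1 + 1)) (n2 (k + 1 + 1))
    have r1 : (q ^ 2) ^ k = (q ^ k) ^ 2 := by ring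
    have r2 : (q⁻¹ ^ 2) ^ k = ((q ^ k)⁻¹) ^ 2 := by
      rw [← pow_mul, mul_comm 2 k, pow_mul, inv_pow]
    simp only [pow_succ _ k, pow_succ _ (k + 1)] at g2 g3 m2 m3
    simp only [coeff_succ_linear, map_add, PowerSeries.coeff_C_mul,
      PowerSeries.coeff_rescale, PowerSeries.coeff_mk, pow_succ _ k, pow_succ _ (k + 1),
      pow_succ _ (k + 1 + 1), r1, r2]
    generalize q ^ k = Q at *
    obtain ⟨D1, e1⟩ : ∃ D, D = (1 - q * Q) * (1 - q * T * w * Q) := ⟨_, rfl⟩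
    obtain ⟨D2, e2⟩ : ∃ D, D = (1 - q * (Q * q)) * (1 - q * T * w * (Q * q)) := ⟨_, rfl⟩
    obtain ⟨D3, e3⟩ : ∃ D, D = (1 - q * (Q * q * q)) * (1 - q * T * w * (Q * q * q)) := ⟨_, rfl⟩
    rw [← e1] at m1 g1
    rw [← e2] at m2 g2
    rw [← e3] at m3 g3
    rw [g3, g2, g1]
    clear n1 n2 hg g1 g2 g3 hf0 r1 r2
    generalize f k = F at *
    field_simp
    rw [e1, e2, e3]
    ring

end OneRowD
end

noncomputable section
namespace OneRowD
variable {K : Type*} [Field K]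
open PowerSeries (C coeff rescale)

/-! ### Series of the form `∑_m F_m(u²) a_m u^m` -/

section Conn
variable {L : Type*} [CommRing L] [Algebra K L]

/-- The series `∑_m F_m(u²) a_m u^m`. -/
def conn (F : ℕ → PowerSeries K) (a : ℕ → L) : PowerSeries L :=
  PowerSeries.mk fun r =>
    ∑ k ∈ Finset.range (r / 2 + 1), coeff k (F (r - 2 * k)) • a (r - 2 * k)

theorem conn_add (F G : ℕ → PowerSeries K) (a : ℕ → L) :
    conn (fun m => F m + G m) a = conn F a + conn G a := by
  ext r
  simp [conn, add_smul, Finset.sum_add_distrib]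

theorem conn_C_mul (c : K) (F : ℕ → PowerSeries K) (a : ℕ → L) :
    conn (fun m => C c * F m) a = C (algebraMap K L c) * conn F a := by
  ext r
  simp [conn, PowerSeries.coeff_C_mul, Finset.mul_sum, Algebra.smul_def, mul_assoc]

theorem conn_X_mul (F : ℕ → PowerSeries K) (a : ℕ → L) :
    conn (fun m => PowerSeries.X * F m) a = PowerSeries.X ^ 2 * conn F a := by
  ext r
  rw [PowerSeries.coeff_X_pow_mul']
  simp only [conn, PowerSeries.coeff_mk]
  rw [Finset.sum_range_succ', PowerSeries.coeff_zero_X_mul, zero_smul, add_zero]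
  simp only [PowerSeries.coeff_succ_X_mul]
  split_ifs with h
  · rw [show r / 2 = (r - 2) / 2 + 1 by omega]
    refine Finset.sum_congr rfl fun k _ => ?_
    rw [show r - 2 * (k + 1) = r - 2 - 2 * k by omega]
  · rw [show r / 2 = 0 by omega, Finset.sum_range_zero]

theorem conn_linear_mul (c d : K) (F : ℕ → PowerSeries K) (a : ℕ → L) :
    conn (fun m => (C c + C d * PowerSeries.X) * F m) a =
      (C (algebraMap K L c) + C (algebraMap K L d) * PowerSeries.X ^ 2) * conn F a := by
  rw [add_mul, mul_assoc, ← conn_C_mul, ← conn_X_mul, ← conn_C_mul, ← conn_add]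
  simp only [add_mul, mul_assoc]

/-- Replacing `u` by `cu` multiplies `u^m` by `c^m` and rescales the series in `u²` by `c²`. -/
theorem conn_rescale (c e : K) (F : ℕ → PowerSeries K) (a : ℕ → L) :
    conn (fun m => C (e * c ^ m) * rescale (c ^ 2) (F m)) a =
      C (algebraMap K L e) * rescale (algebraMap K L c) (conn F a) := by
  ext r
  simp only [conn, PowerSeries.coeff_C_mul, PowerSeries.coeff_rescale, PowerSeries.coeff_mk]
  simp only [Finset.mul_sum, Algebra.smul_def, map_mul, map_pow]
  refine Finset.sum_congr rfl fun k hk => ?_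
  have : k ≤ r / 2 := Nat.lt_succ_iff.mp (Finset.mem_range.mp hk)
  have h : algebraMap K L c ^ r = algebraMap K L c ^ (r - 2 * k) * (algebraMap K L c ^ 2) ^ k := by
    rw [← pow_mul, ← pow_add]; congr 1; omega
  rw [h]; ring

theorem conn_smul (d : ℕ → K) (F : ℕ → PowerSeries K) (a : ℕ → L) :
    conn (fun m => C (d m) * F m) a = conn F (fun m => d m • a m) := by
  ext r
  simp only [conn, PowerSeries.coeff_C_mul, PowerSeries.coeff_mk, mul_smul]
  exact Finset.sum_congr rfl fun k _ => smul_comm _ _ _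

theorem conn_sub (F : ℕ → PowerSeries K) (a b : ℕ → L) :
    conn F (fun m => a m - b m) = conn F a - conn F b := by
  ext r
  simp [conn, smul_sub, Finset.sum_sub_distrib]

/-- The coefficient of `u^r` is `a r` plus a combination of the `a (r - 2k)` with `k ≥ 1`. -/
theorem eq_zero_of_conn_eq_zero {F : ℕ → PowerSeries K} (hF : ∀ m, coeff 0 (F m) = 1)
    {a : ℕ → L} (h : conn F a = 0) (r : ℕ) : a r = 0 := by
  induction r using Nat.strong_induction_on with
  | _ r ih =>
  have hr := congrArg (coeff r) h
  simp only [conn, PowerSeries.coeff_mk] at hr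
  rw [Finset.sum_range_succ', Finset.sum_eq_zero, zero_add] at hr
  · simpa [hF] using hr
  · intro k hk
    have := Finset.mem_range.mp hk
    rw [ih _ (by omega), smul_zero]

end Conn

/-! ### Functional equations of the binomial series -/

theorem binCoeff_succ {q : K} (hq : ∀ j, 1 ≤ j → q ^ j ≠ 1) (t : K) (k : ℕ) :
    binCoeff q t (k + 1) * (1 - q ^ (k + 1)) = binCoeff q t k * (1 - t * q ^ k) := by
  have h1 := qPoch_self_ne_zero hq k
  have h2 : 1 - q * q ^ k ≠ 0 := by
    rw [← pow_succ', sub_ne_zero]; exact (hq _ (by omega)).symm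
  simp only [binCoeff, qPoch_succ, pow_succ']
  generalize 1 - q * q ^ k = D at *
  generalize qPoch q q k = P at *
  field_simp

section Series
variable {L : Type*} [Field L] [Algebra K L]

/-- Formal version of the effect of `z ↦ qz` on `(tz;q)_∞/(z;q)_∞`; coefficientwise it is
`binCoeff_succ`. -/
theorem binSeries_shift {q : K} (hq : ∀ j, 1 ≤ j → q ^ j ≠ 1) (t : K) (w : L) :
    (1 - C (algebraMap K L t * w) * PowerSeries.X) * binSeries q t (algebraMap K L q * w) =
      (1 - C w * PowerSeries.X) * binSeries q t w := by
  ext k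
  rw [sub_mul, sub_mul, one_mul, one_mul, map_sub, map_sub, mul_assoc, mul_assoc,
    PowerSeries.coeff_C_mul, PowerSeries.coeff_C_mul]
  cases k with
  | zero => simp [binSeries]
  | succ k =>
    rw [PowerSeries.coeff_succ_X_mul, PowerSeries.coeff_succ_X_mul]
    have h := congrArg (algebraMap K L) (binCoeff_succ hq t k)
    simp only [map_mul, map_sub, map_one, map_pow] at h
    simp only [binSeries, PowerSeries.coeff_mk, Algebra.smul_def, mul_pow]
    linear_combination (-w ^ (k + 1)) * h

theorem rescale_binSeries (q t : K) (a w : L) :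
    rescale a (binSeries q t w) = binSeries q t (a * w) := by
  ext k
  simp [binSeries, PowerSeries.coeff_rescale, Algebra.smul_def, mul_pow]
  ring

variable {n : ℕ}

/-- The kernel function for elements `x_i` of a field. -/
def kernelVal (q t : K) (x : Fin n → L) : PowerSeries L :=
  ∏ k : Letter n, binSeries q t (letterVal x k)

/-- The kernel function with the variable `z` of the letter `k` replaced by `q z`. -/
def kernelShift (q t : K) (x : Fin n → L) (k : Letter n) : PowerSeries L :=
  binSeries q t (algebraMap K L q * letterVal x k) *
    binSeries q t ((algebraMap K L q)⁻¹ * (letterVal x k)⁻¹) *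
      ∏ j ∈ Finset.univ.erase (letterIdx k), (binSeries q t (x j) * binSeries q t (x j)⁻¹)

theorem kernelVal_eq_prod (q t : K) (x : Fin n → L) :
    kernelVal q t x = ∏ j, (binSeries q t (x j) * binSeries q t (x j)⁻¹) := by
  rw [kernelVal, Fintype.prod_sum_type, Finset.prod_mul_distrib]; rfl

/-- Only the factors of `z` and `z⁻¹` change: `binSeries_shift` is used forwards at `z` and
backwards at `q⁻¹z⁻¹`. -/
theorem kernelShift_equation {q : K} (hq0 : q ≠ 0) (hq : ∀ j, 1 ≤ j → q ^ j ≠ 1) (t : K)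
    (x : Fin n → L) (k : Letter n) :
    (1 - C (algebraMap K L t * letterVal x k) * PowerSeries.X) *
        (1 - C ((algebraMap K L q)⁻¹ * (letterVal x k)⁻¹) * PowerSeries.X) * kernelShift q t x k =
      (1 - C (letterVal x k) * PowerSeries.X) *
        (1 - C (algebraMap K L t * ((algebraMap K L q)⁻¹ * (letterVal x k)⁻¹)) * PowerSeries.X) *
          kernelVal q t x := by
  have hq' : algebraMap K L q ≠ 0 := by simpa using hq0
  have h1 := binSeries_shift hq t (letterVal x k)
  have h2 := binSeries_shift hq t ((algebraMap K L q)⁻¹ * (letterVal x k)⁻¹)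
  rw [mul_inv_cancel_left₀ hq'] at h2
  have h3 : kernelVal q t x = binSeries q t (letterVal x k) * binSeries q t (letterVal x k)⁻¹ *
      ∏ j ∈ Finset.univ.erase (letterIdx k), (binSeries q t (x j) * binSeries q t (x j)⁻¹) := by
    rw [kernelVal_eq_prod, ← Finset.mul_prod_erase Finset.univ _ (Finset.mem_univ (letterIdx k))]
    congr 1
    rcases k with i | i <;> simp only [letterIdx, letterVal, Sum.elim_inl, Sum.elim_inr, id]
    rw [inv_inv, mul_comm]
  rw [h3, kernelShift]
  set R := ∏ j ∈ Finset.univ.erase (letterIdx k), (binSeries q t (x j) * binSeries q t (x j)⁻¹)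
  calc _ = ((1 - C (algebraMap K L t * letterVal x k) * PowerSeries.X) *
        binSeries q t (algebraMap K L q * letterVal x k)) *
        ((1 - C ((algebraMap K L q)⁻¹ * (letterVal x k)⁻¹) * PowerSeries.X) *
          binSeries q t ((algebraMap K L q)⁻¹ * (letterVal x k)⁻¹)) * R := by ring
    _ = _ := by rw [h1, ← h2]; ring

theorem kernelVal_rescale {q : K} (hq : ∀ j, 1 ≤ j → q ^ j ≠ 1) (t : K)
    (x : Fin n → L) :
    (∏ k, (1 - C (algebraMap K L t * letterVal x k) * PowerSeries.X)) *
        rescale (algebraMap K L q) (kernelVal q t x) =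
      (∏ k, (1 - C (letterVal x k) * PowerSeries.X)) * kernelVal q t x := by
  rw [kernelVal, map_prod, ← Finset.prod_mul_distrib, ← Finset.prod_mul_distrib]
  exact Finset.prod_congr rfl fun k _ => by rw [rescale_binSeries, binSeries_shift hq]

theorem kernelVal_rescale_inv {q : K} (hq0 : q ≠ 0) (hq : ∀ j, 1 ≤ j → q ^ j ≠ 1) (t : K)
    (x : Fin n → L) :
    (∏ k, (1 - C ((algebraMap K L q)⁻¹ * letterVal x k) * PowerSeries.X)) *
        rescale (algebraMap K L q)⁻¹ (kernelVal q t x) =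
      (∏ k, (1 - C (algebraMap K L t * ((algebraMap K L q)⁻¹ * letterVal x k)) * PowerSeries.X)) *
        kernelVal q t x := by
  have hq' : algebraMap K L q ≠ 0 := by simpa using hq0
  rw [kernelVal, map_prod, ← Finset.prod_mul_distrib, ← Finset.prod_mul_distrib]
  refine Finset.prod_congr rfl fun k _ => ?_
  have h := binSeries_shift hq t ((algebraMap K L q)⁻¹ * letterVal x k)
  rw [mul_inv_cancel_left₀ hq'] at h
  rw [rescale_binSeries, h]

theorem map_shiftWeight {M : Type*} [Field M] (f : L →+* M) (t : L) (x : Fin n → L) (i : Fin n)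
    (y : L) : f (shiftWeight t x i y) = shiftWeight (f t) (fun j => f (x j)) i (f y) := by
  simp [shiftWeight, map_prod]

theorem map_letterVal {M : Type*} [Field M] (f : L →+* M) (x : Fin n → L) (k : Letter n) :
    letterVal (fun j => f (x j)) k = f (letterVal x k) := by
  rcases k with i | i <;> simp [letterVal]

/-- The difference equation of the kernel function, as an identity of power series. -/
theorem kernelVal_equation (hn : 1 ≤ n) {q : K} (hq0 : q ≠ 0) (hq : ∀ j, 1 ≤ j → q ^ j ≠ 1)
    {t : K} (ht0 : t ≠ 0) {x : Fin n → L} (hx : ∀ i, x i ≠ 0)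
    (hinj : Function.Injective (letterVal x)) (ht : ∀ k, letterVal x k ^ 2 ≠ algebraMap K L t)
    {T γ e : K} (hT : T = t ^ (n - 1)) (hγ : γ = t + (1 - t) * (t * T))
    (he : e = t * (1 - t * T ^ 2 + T - t * T)) :
    (C (algebraMap K L q) + C (algebraMap K L (-t)) * PowerSeries.X ^ 2) *
      ((C (algebraMap K L (-1)) + C (algebraMap K L t) * PowerSeries.X ^ 2) *
        ((C (algebraMap K L (q ^ 2)) + C (algebraMap K L (-t)) * PowerSeries.X ^ 2) *
          (C (algebraMap K L (t ^ 2)) *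
            ∑ k, C (shiftWeight (algebraMap K L t) x (letterIdx k) (letterVal x k)) *
              (kernelShift q t x k - kernelVal q t x) - C (algebraMap K L e) * kernelVal q t x))) =
      (C (algebraMap K L (-q)) + C (algebraMap K L (t ^ 2)) * PowerSeries.X ^ 2) *
        ((C (algebraMap K L (q ^ 2)) + C (algebraMap K L (-t)) * PowerSeries.X ^ 2) *
          ((C (algebraMap K L 1) + C (algebraMap K L (-t ^ 2)) * PowerSeries.X ^ 2) *
            (C (algebraMap K L ((t * T) ^ 2)) * rescale (algebraMap K L q) (kernelVal q t x)) +
          (C (algebraMap K L (-γ)) + C (algebraMap K L (t ^ 2)) * PowerSeries.X ^ 2) *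
            kernelVal q t x)) +
      (C (algebraMap K L (-q)) + C (algebraMap K L 1) * PowerSeries.X ^ 2) *
        ((C (algebraMap K L (-1)) + C (algebraMap K L t) * PowerSeries.X ^ 2) *
          ((C (algebraMap K L (-q ^ 2)) + C (algebraMap K L 1) * PowerSeries.X ^ 2) *
            (C (algebraMap K L (t ^ 2)) * rescale (algebraMap K L q⁻¹) (kernelVal q t x)) +
          (C (algebraMap K L (q ^ 2)) + C (algebraMap K L (-γ)) * PowerSeries.X ^ 2) *
            (C (algebraMap K L (t ^ 2)) * kernelVal q t x))) := by
  -- `sum_shiftWeight_kernel` requires a field, so it is applied in the fraction field with `u = X`;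
  -- its denominators have constant term `1` and are nonzero there.
  let φ : PowerSeries L →+* FractionRing (PowerSeries L) := algebraMap _ _
  have hφ : Function.Injective φ := IsFractionRing.injective _ _
  let f : L →+* FractionRing (PowerSeries L) := φ.comp C
  have hf : ∀ c, φ (C c) = f c := fun _ => rfl
  have hq' : algebraMap K L q ≠ 0 := by simpa using hq0
  have ht' : algebraMap K L t ≠ 0 := by simpa using ht0
  have hunit : ∀ c : L, φ (1 - C c * PowerSeries.X) ≠ 0 := fun c h => by
    have h0 : (1 - C c * PowerSeries.X : PowerSeries L) = 0 := hφ (by rw [h, map_zero])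
    have := congrArg (coeff 0) h0
    simp at this
  have hlin : ∀ c : L, φ (1 - C c * PowerSeries.X) = 1 - f c * φ PowerSeries.X := fun c => by
    rw [map_sub, map_one, map_mul, hf]
  have key := sum_shiftWeight_kernel (x := fun j => f (x j)) hn (q := f (algebraMap K L q))
    (t := f (algebraMap K L t)) (u := φ PowerSeries.X) (Φ := φ (kernelVal q t x))
    (Φp := φ (rescale (algebraMap K L q) (kernelVal q t x)))
    (Φm := φ (rescale (algebraMap K L q)⁻¹ (kernelVal q t x)))
    (Φz := fun k => φ (kernelShift q t x k))
    (fun i => by simpa using hx i)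
    (fun k l h => hinj (f.injective (by rwa [map_letterVal, map_letterVal] at h)))
    (by simpa using hq') (by simpa using ht')
    (fun h => PowerSeries.X_ne_zero (hφ (by rw [h, map_zero])))
    (fun k h => ht k (f.injective (by rwa [map_letterVal, ← map_pow] at h)))
    (fun k => by
      have := hunit (algebraMap K L t * letterVal x k)
      rw [hlin] at this
      rw [map_letterVal]
      convert this using 2
      rw [map_mul]; ring)
    (fun k => by
      have := hunit ((algebraMap K L q)⁻¹ * letterVal x k)
      rw [hlin] at this
      rw [map_letterVal]
      convert this using 2
      rw [map_mul, map_inv₀]; ring)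
    (fun k => by
      have := congrArg φ (kernelShift_equation hq0 hq t x k)
      simp only [map_mul φ, hlin] at this
      simp only [map_mul, map_inv₀] at this
      rw [map_letterVal]
      convert this using 3 <;> ring_nf)
    (by
      have := congrArg φ (kernelVal_rescale hq t x)
      simp only [map_mul φ, map_prod, hlin] at this
      simp only [map_mul] at this
      convert this using 4 with k _ k _ <;> rw [map_letterVal] <;> ring)
    (by
      have := congrArg φ (kernelVal_rescale_inv hq0 hq t x)
      simp only [map_mul φ, map_prod, hlin] at this
      simp only [map_mul, map_inv₀] at this
      convert this using 4 with k _ k _ <;> rw [map_letterVal] <;> ring)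
  apply hφ
  have hsum : φ (∑ k, C (shiftWeight (algebraMap K L t) x (letterIdx k) (letterVal x k)) *
      (kernelShift q t x k - kernelVal q t x)) =
      ∑ k, shiftWeight (f (algebraMap K L t)) (fun j => f (x j)) (letterIdx k)
        (letterVal (fun j => f (x j)) k) * (φ (kernelShift q t x k) - φ (kernelVal q t x)) := by
    rw [map_sum]
    refine Finset.sum_congr rfl fun k _ => ?_
    rw [map_mul, hf, map_shiftWeight, map_sub, map_letterVal]
  rw [he, hγ, hT]
  simp only [map_mul, map_add, map_sub, map_pow, map_neg, map_one, hf, hsum, map_inv₀]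
  linear_combination key

end Series
end OneRowD
end

noncomputable section
namespace OneRowD
variable {K : Type*} [Field K]
open PowerSeries (C coeff rescale)

/-! ### Laurent monomials as rational functions -/

section Monomials
variable {n : ℕ}

/-- The inclusion of Laurent polynomials in rational functions. -/
def toRat (K : Type*) [Field K] (n : ℕ) : Laurent K n →ₐ[K] RatFun K n :=
  IsScalarTower.toAlgHom K (Laurent K n) (RatFun K n)

theorem toRat_apply (f : Laurent K n) : toRat K n f = algebraMap _ _ f := rfl

theorem toRat_injective : Function.Injective (toRat K n) :=
  IsFractionRing.injective (Laurent K n) (RatFun K n)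

theorem toRat_single (m : Fin n → ℤ) (c : K) :
    toRat K n (AddMonoidAlgebra.single m c) = scal c * toRat K n (mono m) := by
  rw [scal, ← Algebra.smul_def, ← map_smul, mono, AddMonoidAlgebra.smul_single, smul_eq_mul,
    mul_one]

theorem mono_injective : Function.Injective (mono : (Fin n → ℤ) → Laurent K n) := fun m m' h => by
  simpa [mono, AddMonoidAlgebra.single_left_inj] using h

theorem mono_mul_mono_neg (m : Fin n → ℤ) : mono m * mono (-m) = (1 : Laurent K n) := by
  rw [← mono_add, add_neg_cancel, mono_zero]

theorem toRat_mono_neg (m : Fin n → ℤ) :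
    toRat K n (mono (-m)) = (toRat K n (mono m))⁻¹ := by
  refine eq_inv_of_mul_eq_one_right ?_
  rw [← map_mul, mono_mul_mono_neg, map_one]

theorem toRat_mono_ne_zero (m : Fin n → ℤ) : toRat K n (mono m) ≠ 0 := fun h => by
  have := congrArg (toRat K n) (mono_mul_mono_neg (K := K) m)
  rw [map_mul, h, zero_mul, map_one] at this
  exact zero_ne_one this

/-- Comparison of constant coefficients. It ensures that denominators such as `1 - y²` do not vanish
and that `z² ≠ t` for every letter. -/
theorem scal_mul_mono_ne {m : Fin n → ℤ} (hm : m ≠ 0) (a : K) {b : K} (hb : b ≠ 0) :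
    scal a * toRat K n (mono m) ≠ scal b := fun h => by
  have h1 : (scal b : RatFun K n) = toRat K n (AddMonoidAlgebra.single 0 b) := by
    rw [toRat_single, mono_zero, map_one, mul_one]
  rw [← toRat_single, h1] at h
  have h2 := congrArg (fun f : Laurent K n => f.coeff 0) (toRat_injective h)
  simp only [AddMonoidAlgebra.coeff_single, Finsupp.single_eq_same] at h2
  rw [Finsupp.single_eq_of_ne hm.symm] at h2
  exact hb h2.symm

/-- The exponent vector of a letter. -/
def letterWt : Letter n → Fin n → ℤ := Sum.elim (fun i => Pi.single i 1) fun i => -Pi.single i 1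

theorem letterWt_ne_zero (k : Letter n) : letterWt k ≠ 0 := by
  rcases k with i | i <;> simp [letterWt]

theorem letterWt_injective : Function.Injective (letterWt (n := n)) := by
  rintro (i | i) (j | j) h
  · have := congrFun h i
    by_cases e : i = j
    · rw [e]
    · simp [letterWt, e] at this
  · have := congrFun h i
    by_cases e : i = j
    · subst e; simp [letterWt] at this
    · simp [letterWt, e] at this
  · have := congrFun h i
    by_cases e : i = j
    · subst e; simp [letterWt] at this
    · simp [letterWt, e] at this
  · have := congrFun h i
    by_cases e : i = j
    · rw [e]
    · simp [letterWt, e] at this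

theorem X_eq (i : Fin n) : (X i : RatFun K n) = toRat K n (mono (Pi.single i 1)) := rfl

theorem letterVal_X (k : Letter n) :
    letterVal (X : Fin n → RatFun K n) k = toRat K n (mono (letterWt k)) := by
  rcases k with i | i
  · rfl
  · simp [letterVal, letterWt, toRat_mono_neg, X_eq]

theorem X_ne_zero (i : Fin n) : (X i : RatFun K n) ≠ 0 := toRat_mono_ne_zero _

theorem letterVal_X_injective : Function.Injective (letterVal (X : Fin n → RatFun K n)) :=
  fun k l h => by
  rw [letterVal_X, letterVal_X] at h
  exact letterWt_injective (mono_injective (toRat_injective h))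

theorem scal_mul_letterVal_sq_ne (a : K) {b : K} (hb : b ≠ 0) (k : Letter n) :
    scal a * letterVal (X : Fin n → RatFun K n) k ^ 2 ≠ scal b := by
  rw [letterVal_X, ← map_pow, ← mono_nsmul]
  exact scal_mul_mono_ne (smul_ne_zero two_ne_zero (letterWt_ne_zero k)) a hb

end Monomials

/-! ### The shift operators as algebra homomorphisms -/

section Shift
variable {n : ℕ}

/-- The shift operator `T_{c, x_i}` as an algebra homomorphism. -/
def shiftHom {c : K} (hc : c ≠ 0) (i : Fin n) : Laurent K n →ₐ[K] Laurent K n :=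
  AddMonoidAlgebra.lift K (Laurent K n) (Fin n → ℤ)
    { toFun := fun m => AddMonoidAlgebra.single m.toAdd (c ^ m.toAdd i)
      map_one' := by simp [AddMonoidAlgebra.one_def]
      map_mul' := fun m m' => by
        simp [AddMonoidAlgebra.single_mul_single, zpow_add₀ hc] }

theorem shiftHom_single {c : K} (hc : c ≠ 0) (i : Fin n) (m : Fin n → ℤ) (a : K) :
    shiftHom hc i (AddMonoidAlgebra.single m a) = AddMonoidAlgebra.single m (a * c ^ m i) := by
  simp [shiftHom]

theorem shift_eq {c : K} (hc : c ≠ 0) (i : Fin n) (f : Laurent K n) :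
    shift c i f = shiftHom hc i f := by
  simp [shift, shiftHom, AddMonoidAlgebra.lift_apply]

/-- The shift operator of a letter: `T_{q, x_i}` for `x_i` and `T_{q⁻¹, x_i}` for `x_i⁻¹`. -/
def letterShift {q : K} (hq : q ≠ 0) : Letter n → Laurent K n →ₐ[K] Laurent K n :=
  Sum.elim (fun i => shiftHom hq i) fun i => shiftHom (inv_ne_zero hq) i

/-- The exponent of `q` by which the shift operator of a letter multiplies a monomial. -/
def letterExp (k : Letter n) (m : Fin n → ℤ) : ℤ := Sum.elim (fun i => m i) (fun i => -m i) k

theorem letterShift_single {q : K} (hq : q ≠ 0) (k : Letter n) (m : Fin n → ℤ) (a : K) :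
    letterShift hq k (AddMonoidAlgebra.single m a) =
      AddMonoidAlgebra.single m (a * q ^ letterExp k m) := by
  rcases k with i | i <;> simp [letterShift, letterExp, shiftHom_single]

theorem toRat_letterShift_mono {q : K} (hq : q ≠ 0) (k : Letter n) (m : Fin n → ℤ) :
    toRat K n (letterShift hq k (mono m)) = scal (q ^ letterExp k m) * toRat K n (mono m) := by
  rw [mono, letterShift_single, one_mul, toRat_single, mono]

theorem map_kernelSeries (q t : K) (n : ℕ) {S : Type*} [CommRing S] [Algebra K S]
    (f : Laurent K n →ₐ[K] S) :
    PowerSeries.map (f : Laurent K n →+* S) (kernelSeries q t n) =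
      ∏ i : Fin n, (binSeries q t (f (mono (Pi.single i 1))) *
        binSeries q t (f (mono (-Pi.single i 1)))) := by
  rw [kernelSeries, map_prod]
  exact Finset.prod_congr rfl fun i _ => by rw [map_mul, map_binSeries, map_binSeries]

theorem map_toRat_kernelSeries (q t : K) (n : ℕ) :
    PowerSeries.map (toRat K n : Laurent K n →+* RatFun K n) (kernelSeries q t n) =
      kernelVal q t X := by
  rw [map_kernelSeries, kernelVal_eq_prod]
  simp only [toRat_mono_neg, X_eq]

theorem map_letterShift_kernelSeries {q : K} (hq : q ≠ 0) (t : K) (n : ℕ) (k : Letter n) :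
    PowerSeries.map (((toRat K n).comp (letterShift hq k) : Laurent K n →ₐ[K] RatFun K n) :
      Laurent K n →+* RatFun K n) (kernelSeries q t n) = kernelShift q t X k := by
  rw [map_kernelSeries, kernelShift, ← Finset.mul_prod_erase Finset.univ _
    (Finset.mem_univ (letterIdx k))]
  simp only [AlgHom.comp_apply, toRat_letterShift_mono]
  congr 1
  · rcases k with i | i <;>
      simp [letterExp, letterIdx, letterVal, toRat_mono_neg, X_eq, scal, mul_comm]
  · refine Finset.prod_congr rfl fun j hj => ?_
    have hj := Finset.ne_of_mem_erase hj
    have e : ∀ a : ℤ, letterExp k (Pi.single j a) = 0 := fun a => by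
      rcases k with i | i <;> simp_all [letterExp, letterIdx, Pi.single_apply, eq_comm]
    rw [← Pi.single_neg, e, e, Pi.single_neg]
    simp [scal, toRat_mono_neg, X_eq]

end Shift

/-! ### The eigenvalue equation of the one-row functions -/

section Eigen
variable {n : ℕ}

/-- Koornwinder's operator of type `D_n` without the constant factor, as a linear map. -/
def shiftOp {q : K} (hq : q ≠ 0) (t : K) (n : ℕ) : Laurent K n →ₗ[K] RatFun K n :=
  ∑ k : Letter n,
    LinearMap.mulLeft K (shiftWeight (scal t) X (letterIdx k) (letterVal X k)) ∘ₗ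
      (((toRat K n).comp (letterShift hq k)).toLinearMap - (toRat K n).toLinearMap)

theorem shiftOp_apply {q : K} (hq : q ≠ 0) (t : K) (f : Laurent K n) :
    shiftOp hq t n f = ∑ k : Letter n, shiftWeight (scal t) X (letterIdx k) (letterVal X k) *
      (toRat K n (letterShift hq k f) - toRat K n f) := by
  simp [shiftOp]

/-- With `(a,b,c,d) = (-1,1,-s,s)` and `q = s²` the numerator is `(1-y²)(1-qy²)`. -/
theorem koornwinderCoeff_eq (s t : K) (k : Letter n) :
    koornwinderCoeff (-1) 1 (-s) s 1 (s ^ 2) t (letterIdx k) (letterVal X k) =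
      (scal (t ^ (n - 1)))⁻¹ * shiftWeight (scal t) X (letterIdx k) (letterVal X k) := by
  have h1 := scal_mul_letterVal_sq_ne (1 : K) (one_ne_zero (α := K)) k
  have h2 := scal_mul_letterVal_sq_ne (s ^ 2) (one_ne_zero (α := K)) k
  rw [koornwinderCoeff, shiftWeight]
  congr 1
  generalize letterVal (X : Fin n → RatFun K n) k = y at *
  simp only [scal, map_one, map_neg, map_pow, one_mul] at h1 h2 ⊢
  have h1 : 1 - y ^ 2 ≠ 0 := sub_ne_zero.mpr h1.symm
  have h2 : 1 - (algebraMap K (RatFun K n) s) ^ 2 * y ^ 2 ≠ 0 := sub_ne_zero.mpr h2.symm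
  rw [show (1 - -1 * y) * (1 - y) * (1 - -algebraMap K (RatFun K n) s * y) *
    (1 - algebraMap K (RatFun K n) s * y) =
      (1 - y ^ 2) * (1 - (algebraMap K (RatFun K n) s) ^ 2 * y ^ 2) by ring]
  generalize 1 - y ^ 2 = A at *
  generalize 1 - (algebraMap K (RatFun K n) s) ^ 2 * y ^ 2 = B at *
  rw [mul_assoc, div_mul_cancel_right₀ (mul_ne_zero h1 h2)]

theorem koornwinderOp_eq {s : K} (hq : s ^ 2 ≠ 0) (t : K) (f : Laurent K n) :
    koornwinderOp (-1) 1 (-s) s 1 (s ^ 2) t f =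
      (scal (t ^ (n - 1)))⁻¹ * shiftOp hq t n f := by
  rw [shiftOp_apply, Finset.mul_sum, Fintype.sum_sum_type, koornwinderOp]
  congr 1 <;> refine Finset.sum_congr rfl fun i _ => ?_
  · have := koornwinderCoeff_eq s t (Sum.inl i : Letter n)
    simp only [letterIdx, letterVal, Sum.elim_inl, id] at this ⊢
    rw [this, shift_eq hq, mul_assoc, map_sub]; rfl
  · have := koornwinderCoeff_eq s t (Sum.inr i : Letter n)
    simp only [letterIdx, letterVal, Sum.elim_inr, id] at this ⊢
    rw [this, shift_eq (inv_ne_zero hq), mul_assoc, map_sub]; rfl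

theorem mk_shiftOp_kernelCoeff {q : K} (hq : q ≠ 0) (t : K) (n : ℕ) :
    PowerSeries.mk (fun r => shiftOp hq t n (kernelCoeff q t n r)) =
      ∑ k : Letter n, C (shiftWeight (scal t) X (letterIdx k) (letterVal X k)) *
        (kernelShift q t X k - kernelVal q t X) := by
  ext r
  simp only [PowerSeries.coeff_mk, shiftOp_apply, map_sum, PowerSeries.coeff_C_mul, map_sub,
    ← map_letterShift_kernelSeries hq, ← map_toRat_kernelSeries, PowerSeries.coeff_map, kernelCoeff]
  rfl

theorem kernelVal_X_eq_conn {q t : K} (hq0 : q ≠ 0) (ht : t ≠ 0) (N : ℕ)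
    (hqt : ∀ a b : ℕ, a ≤ N + 1 → (a, b) ≠ (0, 0) → t ^ a * q ^ b ≠ 1) :
    kernelVal q t (X : Fin (N + 1) → RatFun K (N + 1)) =
      conn (connSeries q t N) fun m => toRat K (N + 1) (oneRowFun q t N m) := by
  ext r
  rw [← map_toRat_kernelSeries, PowerSeries.coeff_map]
  change toRat K (N + 1) (kernelCoeff q t (N + 1) r) = _
  rw [kernelCoeff_expansion hq0 ht N hqt]
  simp [conn, connSeries]

theorem mk_shiftOp_eq_conn {q t : K} (hq0 : q ≠ 0) (ht : t ≠ 0) (N : ℕ)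
    (hqt : ∀ a b : ℕ, a ≤ N + 1 → (a, b) ≠ (0, 0) → t ^ a * q ^ b ≠ 1) :
    PowerSeries.mk (fun r => shiftOp hq0 t (N + 1) (kernelCoeff q t (N + 1) r)) =
      conn (connSeries q t N) fun m => shiftOp hq0 t (N + 1) (oneRowFun q t N m) := by
  ext r
  rw [PowerSeries.coeff_mk, kernelCoeff_expansion hq0 ht N hqt]
  simp [conn, connSeries]

theorem connCoeff_zero_right (q t : K) (N m : ℕ) : connCoeff q t N m 0 = 1 := by
  simp [connCoeff, qPoch_zero]

theorem coeff_zero_connSeries (q t : K) (N m : ℕ) : coeff 0 (connSeries q t N m) = 1 := by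
  rw [connSeries, PowerSeries.coeff_mk, connCoeff_zero_right]

theorem linear_ne_zero {L : Type*} [Field L] {c : L} (hc : c ≠ 0) (d : L) :
    (C c + C d * PowerSeries.X ^ 2 : PowerSeries L) ≠ 0 := fun h => by
  have := congrArg (coeff 0) h
  simp [hc] at this

/-- Inserting the expansion of the kernel function into `kernelVal_equation` and comparing with
`connSeries_equation` gives a vanishing sum `∑_m F_m(u²) a_m u^m`, where `a_m` is the defect of the
eigenvalue equation up to the factor `t²`. -/
theorem shiftOp_oneRowFun {q t : K} (hq0 : q ≠ 0) (ht : t ≠ 0) (N : ℕ)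
    (hqt : ∀ a b : ℕ, a ≤ N + 1 → (a, b) ≠ (0, 0) → t ^ a * q ^ b ≠ 1) (m : ℕ) :
    shiftOp hq0 t (N + 1) (oneRowFun q t N m) =
      (t ^ N * (t ^ N * q ^ m + (t ^ N * q ^ m)⁻¹ - t ^ N - (t ^ N)⁻¹)) •
        toRat K (N + 1) (oneRowFun q t N m) := by
  have hq : ∀ j, 1 ≤ j → q ^ j ≠ 1 := fun j hj => by
    simpa using hqt 0 j (by omega) (by simp; omega)
  obtain ⟨T, hT⟩ : ∃ T, T = t ^ N := ⟨_, rfl⟩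
  obtain ⟨γ, hγ⟩ : ∃ γ, γ = t + (1 - t) * (t * T) := ⟨_, rfl⟩
  obtain ⟨e, he⟩ : ∃ e, e = t * (1 - t * T ^ 2 + T - t * T) := ⟨_, rfl⟩
  let d : ℕ → K := fun m => T * q ^ m + (T * q ^ m)⁻¹ - T - T⁻¹
  have h1 := kernelVal_equation (x := (X : Fin (N + 1) → RatFun K (N + 1))) (by omega) hq0 hq ht
    X_ne_zero letterVal_X_injective
    (fun k h => scal_mul_letterVal_sq_ne 1 ht k (by rw [h]; simp [scal]))
    (by rw [hT]; rfl) hγ he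
  -- `connSeries_equation` for all `m` at once, summed against the one-row functions; its right-hand
  -- side becomes the operator in `u` applied to the kernel function.
  have h2 : conn (fun m => _) (fun m => toRat K (N + 1) (oneRowFun q t N m)) = conn (fun m => _) _ :=
    congrArg (fun F : ℕ → PowerSeries K =>
      conn F fun m => toRat K (N + 1) (oneRowFun q t N m))
      (funext fun m => connSeries_equation hq0 ht N hqt m hT rfl (d := d m) rfl hγ)
  rw [← he] at h2
  simp only [← inv_pow q] at h2
  simp only [conn_linear_mul, conn_add, conn_rescale, conn_C_mul] at h2
  rw [← kernelVal_X_eq_conn hq0 ht N hqt, ← h1] at h2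
  have hne : ∀ {c : K}, c ≠ 0 → algebraMap K (RatFun K (N + 1)) c ≠ 0 := fun hc => by simpa using hc
  -- The three linear factors in `u²` have nonzero constant terms and can be cancelled.
  have h3 := mul_left_cancel₀ (linear_ne_zero (hne hq0) _) h2
  have h3 := mul_left_cancel₀ (linear_ne_zero (hne (by simp)) _) h3
  have h3 := mul_left_cancel₀ (linear_ne_zero (hne (pow_ne_zero 2 hq0)) _) h3
  have h4 := mk_shiftOp_kernelCoeff hq0 t (N + 1)
  rw [mk_shiftOp_eq_conn hq0 ht N hqt] at h4
  change _ = C _ * ∑ k : Letter (N + 1), C (shiftWeight (scal t) X (letterIdx k) (letterVal X k)) *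
        (kernelShift q t X k - kernelVal q t X) - _ at h3
  rw [← h4, kernelVal_X_eq_conn hq0 ht N hqt, ← conn_C_mul, ← conn_C_mul, conn_smul,
    conn_smul fun _ => t ^ 2, conn_smul fun _ => e, ← conn_sub] at h3
  have h5 := sub_eq_zero.mpr h3
  rw [← conn_sub] at h5
  have h6 := eq_zero_of_conn_eq_zero (coeff_zero_connSeries q t N) h5 m
  rw [← hT]
  refine smul_right_injective _ (pow_ne_zero 2 ht) ?_
  change t ^ 2 • _ = t ^ 2 • (T * d m) • _
  rw [smul_smul, show t ^ 2 * (T * d m) = (T * t ^ 2 * d m - e) + e by ring, add_smul]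
  exact sub_eq_iff_eq_add.mp (sub_eq_zero.mp h6).symm

theorem koornwinderEigenvalue_oneRow (q t : K) (N m : ℕ) :
    koornwinderEigenvalue 1 q t (oneRow (N + 1) m) =
      t ^ N * q ^ m + (t ^ N * q ^ m)⁻¹ - t ^ N - (t ^ N)⁻¹ := by
  rw [koornwinderEigenvalue, Fin.sum_univ_succ, Finset.sum_eq_zero, add_zero]
  · simp [bracket, oneRow]
  · intro i _
    simp [bracket, oneRow]

theorem koornwinderOp_oneRowFun {s t : K} (N : ℕ) (ht : t ≠ 0) (hq : s ^ 2 ≠ 0)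
    (hqt : ∀ a b : ℕ, a ≤ N + 1 → (a, b) ≠ (0, 0) → t ^ a * (s ^ 2) ^ b ≠ 1) (m : ℕ) :
    koornwinderOp (-1) 1 (-s) s 1 (s ^ 2) t (oneRowFun (s ^ 2) t N m) =
      scal (koornwinderEigenvalue 1 (s ^ 2) t (oneRow (N + 1) m)) *
        algebraMap _ _ (oneRowFun (s ^ 2) t N m) := by
  have hT : (scal (t ^ N) : RatFun K (N + 1)) ≠ 0 := by simpa [scal] using fun h => absurd h ht
  rw [koornwinderOp_eq hq, shiftOp_oneRowFun hq ht N hqt, koornwinderEigenvalue_oneRow,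
    Algebra.smul_def, map_mul, ← mul_assoc, ← mul_assoc]
  rw [Nat.add_sub_cancel]
  change (scal (t ^ N))⁻¹ * scal (t ^ N) * _ * _ = _
  rw [inv_mul_cancel₀ hT, one_mul]
  rfl

end Eigen
end OneRowD
end

noncomputable section
namespace OneRowD
variable {K : Type*} [Field K]
open Finset.HasAntidiagonal (antidiagonal)

/-! ### Invariance under signed permutations -/

section Invariance
variable {n : ℕ}

/-- The action of a signed permutation on exponents, as an additive homomorphism. -/
def signedPermHom (σ : Equiv.Perm (Fin n)) (ε : Fin n → ℤˣ) : (Fin n → ℤ) →+ (Fin n → ℤ) where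
  toFun := signedPerm σ ε
  map_zero' := by ext; simp [signedPerm]
  map_add' m m' := by ext; simp [signedPerm, mul_add]

theorem signedPerm_injective (σ : Equiv.Perm (Fin n)) (ε : Fin n → ℤˣ) :
    Function.Injective (signedPerm σ ε) := fun m m' h => by
  ext i
  have := congrFun h (σ.symm i)
  simpa [signedPerm] using this

/-- The action of a signed permutation on Laurent polynomials. -/
def signedMap (K : Type*) [Field K] (σ : Equiv.Perm (Fin n)) (ε : Fin n → ℤˣ) :
    Laurent K n →ₐ[K] Laurent K n :=
  AddMonoidAlgebra.mapDomainAlgHom K K (signedPermHom σ ε)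

theorem signedMap_mono (σ : Equiv.Perm (Fin n)) (ε : Fin n → ℤˣ) (m : Fin n → ℤ) :
    signedMap K σ ε (mono m) = mono (signedPerm σ ε m) := by
  simp [signedMap, mono, AddMonoidAlgebra.mapDomain_single, signedPermHom]

theorem coeff_signedMap (σ : Equiv.Perm (Fin n)) (ε : Fin n → ℤˣ) (f : Laurent K n)
    (m : Fin n → ℤ) : (signedMap K σ ε f).coeff (signedPerm σ ε m) = f.coeff m :=
  Finsupp.mapDomain_apply (signedPerm_injective σ ε) f.coeff m

theorem signedPerm_single (σ : Equiv.Perm (Fin n)) (ε : Fin n → ℤˣ) (i : Fin n) (a : ℤ) :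
    signedPerm σ ε (Pi.single (σ i) a) = Pi.single i (ε i * a) := by
  ext j
  by_cases h : j = i
  · subst h; simp [signedPerm]
  · simp [signedPerm, h]

theorem map_signedMap_kernelSeries (q t : K) (σ : Equiv.Perm (Fin n)) (ε : Fin n → ℤˣ) :
    PowerSeries.map (signedMap K σ ε : Laurent K n →+* Laurent K n) (kernelSeries q t n) =
      kernelSeries q t n := by
  rw [map_kernelSeries, ← Equiv.prod_comp σ, kernelSeries]
  refine Finset.prod_congr rfl fun i _ => ?_
  simp only [← Pi.single_neg, signedMap_mono, signedPerm_single]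
  rcases Int.units_eq_one_or (ε i) with h | h
  · simp [h]
  · simp [h, mul_comm]

theorem signedMap_kernelCoeff (q t : K) (σ : Equiv.Perm (Fin n)) (ε : Fin n → ℤˣ) (r : ℕ) :
    signedMap K σ ε (kernelCoeff q t n r) = kernelCoeff q t n r := by
  have := congrArg (PowerSeries.coeff r) (map_signedMap_kernelSeries q t σ ε)
  rwa [PowerSeries.coeff_map] at this

/-- In the expansion of the invariant `kernelCoeff`, the function of index `r` has coefficient `1`
and the others are invariant by induction. -/
theorem signedMap_oneRowFun {q t : K} (hq0 : q ≠ 0) (ht : t ≠ 0) (N : ℕ)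
    (hqt : ∀ a b : ℕ, a ≤ N + 1 → (a, b) ≠ (0, 0) → t ^ a * q ^ b ≠ 1)
    (σ : Equiv.Perm (Fin (N + 1))) (ε : Fin (N + 1) → ℤˣ) (r : ℕ) :
    signedMap K σ ε (oneRowFun q t N r) = oneRowFun q t N r := by
  induction r using Nat.strong_induction_on with
  | _ r ih =>
  have h := kernelCoeff_expansion hq0 ht N hqt r
  have h' := congrArg (signedMap K σ ε) h
  rw [signedMap_kernelCoeff, h, map_sum, Finset.sum_range_succ', Finset.sum_range_succ'] at h'
  simp only [map_smul, connCoeff_zero_right, one_smul, mul_zero, Nat.sub_zero] at h'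
  rw [Finset.sum_congr rfl fun k hk => by
    rw [← ih (r - 2 * (k + 1)) (by have := Finset.mem_range.mp hk; omega)]] at h'
  exact (add_left_cancel h').symm

end Invariance

/-! ### The branching of the tableau sum -/

section Branching

/-- The multiplicities of a filling with the multiplicities `a`, `b` of a new first letter and
its barred version added. -/
def consLetter {n : ℕ} (a b : ℕ) (θ : Letter n → ℕ) : Letter (n + 1) → ℕ :=
  Sum.elim (Fin.cons a fun i => θ (Sum.inl i)) (Fin.cons b fun i => θ (Sum.inr i))

/-- The unnormalised tableau sum. -/
def fillingSum (n r : ℕ) (q t : K) : Laurent K n :=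
  ∑ θ ∈ fillings n r,
    ((∏ k : Letter n, qPoch t q (θ k) / qPoch q q (θ k)) *
        ∏ l ∈ Finset.univ.filter (fun l : Fin n => (l : ℕ) + 1 < n), factor q t θ l) •
      mono fun i => (θ (Sum.inl i) : ℤ) - (θ (Sum.inr i) : ℤ)

theorem mem_fillings {n r : ℕ} {θ : Letter n → ℕ} : θ ∈ fillings n r ↔
    ∑ k, θ k = r ∧ ∀ i : Fin n, (i : ℕ) + 1 = n → θ (Sum.inl i) * θ (Sum.inr i) = 0 := by
  simp [fillings]

theorem sum_consLetter {n : ℕ} (a b : ℕ) (θ : Letter n → ℕ) :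
    ∑ k, consLetter a b θ k = a + b + ∑ k, θ k := by
  simp only [Fintype.sum_sum_type, consLetter, Sum.elim_inl, Sum.elim_inr, Fin.sum_univ_succ,
    Fin.cons_zero, Fin.cons_succ]
  ring

/-- The condition `θ_n θ_{n̄} = 0` concerns the last letter, which is not the one added, since at
least two variables are present. -/
theorem consLetter_mem_fillings {N r a b : ℕ} {θ : Letter (N + 1) → ℕ} :
    consLetter a b θ ∈ fillings (N + 2) r ↔
      a + b + ∑ k, θ k = r ∧ θ ∈ fillings (N + 1) (∑ k, θ k) := by
  rw [mem_fillings, mem_fillings, sum_consLetter, Fin.forall_fin_succ]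
  simp [consLetter]

theorem innerSum_consLetter_zero {n : ℕ} (a b : ℕ) (θ : Letter n → ℕ) :
    innerSum (consLetter a b θ) 0 = ∑ k, θ k := by
  simp [innerSum, consLetter, Fin.Ioi_zero_eq_map, Fintype.sum_sum_type, Finset.sum_add_distrib]

theorem innerSum_consLetter_succ {n : ℕ} (a b : ℕ) (θ : Letter n → ℕ) (l : Fin n) :
    innerSum (consLetter a b θ) l.succ = innerSum θ l := by
  rw [innerSum, Fin.Ioi_succ, Finset.sum_map]; rfl

theorem factor_consLetter_zero (q t : K) {N : ℕ} (a b : ℕ) (θ : Letter (N + 1) → ℕ) :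
    factor q t (consLetter a b θ) 0 = branchFactor q t (t ^ N * q ^ ∑ k, θ k) a b := by
  rw [factor, innerSum_consLetter_zero, branchFactor]
  simp [consLetter, pow_add, pow_succ]
  ring_nf

theorem factor_consLetter_succ (q t : K) {n : ℕ} (a b : ℕ) (θ : Letter n → ℕ) (l : Fin n) :
    factor q t (consLetter a b θ) l.succ = factor q t θ l := by
  rw [factor, innerSum_consLetter_succ, factor]
  simp [consLetter]

theorem consLetter_surjective {n : ℕ} (θ : Letter (n + 1) → ℕ) :
    ∃ a b θ', consLetter a b θ' = θ :=
  ⟨θ (Sum.inl 0), θ (Sum.inr 0), Sum.elim (fun i => θ (Sum.inl i.succ)) fun i => θ (Sum.inr i.succ),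
    by ext (i | i) <;> refine Fin.cases ?_ (fun i => ?_) i <;> simp [consLetter]⟩

theorem consLetter_injective {n : ℕ} {a b a' b' : ℕ} {θ θ' : Letter n → ℕ}
    (h : consLetter a b θ = consLetter a' b' θ') : a = a' ∧ b = b' ∧ θ = θ' := by
  refine ⟨congrFun h (Sum.inl 0), congrFun h (Sum.inr 0), funext ?_⟩
  rintro (i | i)
  · exact congrFun h (Sum.inl i.succ)
  · exact congrFun h (Sum.inr i.succ)

theorem mono_consLetter {n : ℕ} (a b : ℕ) (θ : Letter n → ℕ) :
    (mono (fun i => (consLetter a b θ (Sum.inl i) : ℤ) - consLetter a b θ (Sum.inr i)) :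
        Laurent K (n + 1)) =
      mono (Pi.single 0 ((a : ℤ) - b)) *
        tailEmb K n (mono fun i => (θ (Sum.inl i) : ℤ) - θ (Sum.inr i)) := by
  rw [tailEmb_mono, ← mono_add]
  congr 1
  ext i
  refine Fin.cases ?_ (fun i => ?_) i <;> simp [consLetter]

theorem sum_fillings_succ {M : Type*} [AddCommMonoid M] (N r : ℕ) (F : (Letter (N + 2) → ℕ) → M) :
    ∑ θ ∈ fillings (N + 2) r, F θ = ∑ x ∈ antidiagonal r, ∑ y ∈ antidiagonal x.1,
      ∑ θ ∈ fillings (N + 1) x.2, F (consLetter y.1 y.2 θ) := by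
  rw [Finset.sum_sigma', Finset.sum_sigma']
  symm
  refine Finset.sum_bij (fun p _ => consLetter p.1.2.1 p.1.2.2 p.2) ?_ ?_ ?_ fun _ _ => rfl
  · rintro ⟨⟨x, y⟩, θ⟩ h
    simp only [Finset.mem_sigma, Finset.HasAntidiagonal.mem_antidiagonal] at h
    obtain ⟨⟨h1, h2⟩, h3⟩ := h
    have h4 := (mem_fillings.mp h3).1
    rw [consLetter_mem_fillings, h4]
    exact ⟨by dsimp only; omega, h3⟩
  · rintro ⟨⟨x, y⟩, θ⟩ h ⟨⟨x', y'⟩, θ'⟩ h' e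
    simp only [Finset.mem_sigma, Finset.HasAntidiagonal.mem_antidiagonal] at h h'
    obtain ⟨e1, e2, rfl⟩ := consLetter_injective e
    have h3 := (mem_fillings.mp h.2).1
    have h4 := (mem_fillings.mp h'.2).1
    have ey : y = y' := Prod.ext e1 e2
    have ex : x = x' := Prod.ext (by rw [← h.1.2, ← h'.1.2, ey]) (by rw [← h3, ← h4])
    rw [ex, ey]
  · intro θ h
    obtain ⟨a, b, θ', rfl⟩ := consLetter_surjective θ
    rw [consLetter_mem_fillings] at h
    exact ⟨⟨⟨(a + b, ∑ k, θ' k), (a, b)⟩, θ'⟩, by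
      simpa [Finset.HasAntidiagonal.mem_antidiagonal] using h, rfl⟩

theorem fillingSum_one (r : ℕ) (q t : K) : fillingSum 1 r q t = oneRowFun q t 0 r := by
  have hmem : ∀ θ : Letter 1 → ℕ, θ ∈ fillings 1 r ↔
      θ = Sum.elim (fun _ => r) (fun _ => 0) ∨ θ = Sum.elim (fun _ => 0) (fun _ => r) := by
    intro θ
    rw [mem_fillings]
    simp only [Fintype.sum_sum_type, Finset.univ_unique, Fin.default_eq_zero, Finset.sum_singleton]
    constructor
    · rintro ⟨h1, h2⟩
      rcases Nat.mul_eq_zero.mp (h2 0 rfl) with h | h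
      · right
        ext (i | i) <;> rw [Subsingleton.elim i 0] <;> simp <;> omega
      · left
        ext (i | i) <;> rw [Subsingleton.elim i 0] <;> simp <;> omega
    · rintro (rfl | rfl) <;> simp
  have hs : fillings 1 r = {Sum.elim (fun _ => r) (fun _ => 0), Sum.elim (fun _ => 0) (fun _ => r)} := by
    ext θ; rw [hmem]; simp
  have hz : ∀ a : ℤ, (Pi.single 0 a : Fin 1 → ℤ) = fun _ => a := fun a => by
    ext i; rw [Subsingleton.elim i 0, Pi.single_eq_same]
  rw [fillingSum, hs, oneRowFun]
  -- For `r = 0` the two fillings coincide, whence the separate value in `oneRowFun`.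
  split_ifs with h
  · subst h
    simp [Fintype.prod_sum_type, qPoch_zero]
    rfl
  · rw [Finset.sum_pair]
    · simp [Fintype.prod_sum_type, qPoch_zero, binCoeff, hz]
    · intro e
      exact h (by simpa using congrFun e (Sum.inl 0))

/-- The first letter and its bar enter only the first weight factor, which is `branchFactor`; the
later factors are those of the remaining filling. -/
theorem fillingSum_eq (N r : ℕ) (q t : K) : fillingSum (N + 1) r q t = oneRowFun q t N r := by
  induction N generalizing r with
  | zero => exact fillingSum_one r q t
  | succ N ih =>
    rw [fillingSum, sum_fillings_succ, oneRowFun]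
    refine Finset.sum_congr rfl fun x _ => Finset.sum_congr rfl fun y _ => ?_
    rw [← ih, fillingSum, map_sum, Finset.mul_sum, Finset.smul_sum]
    refine Finset.sum_congr rfl fun θ hθ => ?_
    rw [mono_consLetter, map_smul, mul_smul_comm, smul_smul, Finset.prod_filter, Finset.prod_filter,
      Fin.prod_univ_succ]
    simp only [factor_consLetter_zero, factor_consLetter_succ, (mem_fillings.mp hθ).1]
    congr 1
    simp only [Fintype.prod_sum_type, consLetter, Sum.elim_inl, Sum.elim_inr, Fin.prod_univ_succ,
      Fin.cons_zero, Fin.cons_succ, binCoeff, Fin.val_zero, Fin.val_succ, Nat.add_lt_add_iff_right]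
    simp
    ring

theorem tableauSum_eq (N r : ℕ) (q t : K) :
    tableauSum (N + 1) r q t = (qPoch q q r / qPoch t q r) • oneRowFun q t N r := by
  rw [← fillingSum_eq]; rfl

end Branching
end OneRowD
end

noncomputable section
namespace OneRowD
variable {K : Type*} [Field K]

/-! ### Orbits of exponents under signed permutations -/

section Orbits
variable {n : ℕ}

theorem mem_orbit {lam : Fin n → ℕ} {m : Fin n → ℤ} :
    m ∈ orbit lam ↔ ∃ σ ε, signedPerm σ ε (fun i => (lam i : ℤ)) = m := by
  simp [orbit]

theorem self_mem_orbit (lam : Fin n → ℕ) : (fun i => (lam i : ℤ)) ∈ orbit lam :=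
  mem_orbit.mpr ⟨1, 1, by ext; simp [signedPerm]⟩

theorem coeff_mono (m m' : Fin n → ℤ) : (mono m : Laurent K n).coeff m' = if m = m' then 1 else 0 := by
  rw [mono, AddMonoidAlgebra.coeff_single, Finsupp.single_apply]

theorem coeff_monoSymm (lam : Fin n → ℕ) (m : Fin n → ℤ) :
    (monoSymm K lam).coeff m = if m ∈ orbit lam then 1 else 0 := by
  simp [monoSymm, AddMonoidAlgebra.coeff_sum, Finsupp.finsetSum_apply, coeff_mono]

/-- A tuple has only one sorted rearrangement; order duals are taken because sorting is increasing.
-/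
theorem antitone_comp_perm_eq {mu nu : Fin n → ℕ} (hmu : Antitone mu) (hnu : Antitone nu)
    (σ : Equiv.Perm (Fin n)) (h : nu = mu ∘ σ) : nu = mu := by
  have h1 : Monotone ((OrderDual.toDual ∘ mu) ∘ (1 : Equiv.Perm (Fin n))) := hmu.dual_right
  have h2 : Monotone ((OrderDual.toDual ∘ mu) ∘ σ) := by
    rw [Function.comp_assoc, ← h]; exact hnu.dual_right
  have e1 := Tuple.comp_sort_eq_comp_iff_monotone.mpr h1
  have e2 := Tuple.comp_sort_eq_comp_iff_monotone.mpr h2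
  rw [h]
  exact funext fun i => congrArg OrderDual.ofDual (congrFun (e2.trans e1.symm) i)

/-- The partition in the orbit of an exponent. -/
def partOf (m : Fin n → ℤ) : Fin n → ℕ :=
  fun i => (m (Tuple.sort (fun j => OrderDual.toDual (m j).natAbs) i)).natAbs

theorem antitone_partOf (m : Fin n → ℤ) : Antitone (partOf m) :=
  fun _ _ h => Tuple.monotone_sort (fun j => OrderDual.toDual (m j).natAbs) h

theorem natAbs_signedPerm (σ : Equiv.Perm (Fin n)) (ε : Fin n → ℤˣ) (m : Fin n → ℤ) (i : Fin n) :
    (signedPerm σ ε m i).natAbs = (m (σ i)).natAbs := by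
  rw [signedPerm, Int.natAbs_mul, Int.units_natAbs, one_mul]

theorem mem_orbit_partOf (m : Fin n → ℤ) : m ∈ orbit (partOf m) := by
  obtain ⟨σ, hσ⟩ : ∃ σ, σ = Tuple.sort (fun j => OrderDual.toDual (m j).natAbs) := ⟨_, rfl⟩
  refine mem_orbit.mpr ⟨σ.symm, fun i => if 0 ≤ m i then 1 else -1, ?_⟩
  ext i
  rw [signedPerm, partOf, ← hσ, Equiv.apply_symm_apply]
  split_ifs with h
  · simp [abs_of_nonneg h]
  · simp [abs_of_neg (not_le.mp h)]

theorem partOf_eq_of_mem_orbit {mu : Fin n → ℕ} (hmu : Antitone mu) {m : Fin n → ℤ}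
    (h : m ∈ orbit mu) : partOf m = mu := by
  obtain ⟨σ, ε, rfl⟩ := mem_orbit.mp h
  refine antitone_comp_perm_eq hmu (antitone_partOf _)
    ((Tuple.sort (fun j => OrderDual.toDual (signedPerm σ ε (fun i => (mu i : ℤ)) j).natAbs)).trans
      σ) ?_
  ext i
  simp [partOf, natAbs_signedPerm]

theorem sum_partOf (m : Fin n → ℤ) : ∑ i, partOf m i = ∑ i, (m i).natAbs :=
  Equiv.sum_comp (Tuple.sort fun j => OrderDual.toDual (m j).natAbs) fun i => (m i).natAbs

/-- A Laurent polynomial is invariant under signed permutations. -/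
def Invariant (P : Laurent K n) : Prop :=
  ∀ (σ : Equiv.Perm (Fin n)) (ε : Fin n → ℤˣ) (m : Fin n → ℤ),
    P.coeff (signedPerm σ ε m) = P.coeff m

theorem Invariant.coeff_partOf {P : Laurent K n} (hP : Invariant P) (m : Fin n → ℤ) :
    P.coeff (fun i => (partOf m i : ℤ)) = P.coeff m := by
  obtain ⟨σ, ε, h⟩ := mem_orbit.mp (mem_orbit_partOf m)
  rw [← hP σ ε, h]

theorem Invariant.eq_sum {P : Laurent K n} (hP : Invariant P) :
    P = ∑ mu ∈ P.coeff.support.image partOf, P.coeff (fun i => (mu i : ℤ)) • monoSymm K mu := by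
  ext m
  rw [AddMonoidAlgebra.coeff_sum, Finsupp.finsetSum_apply]
  simp only [AddMonoidAlgebra.coeff_smul, Finsupp.smul_apply, coeff_monoSymm, smul_eq_mul]
  by_cases hm : P.coeff m = 0
  · rw [hm, Finset.sum_eq_zero]
    intro mu hmu
    obtain ⟨m', -, rfl⟩ := Finset.mem_image.mp hmu
    split_ifs with h
    · rw [← partOf_eq_of_mem_orbit (antitone_partOf m') h, hP.coeff_partOf, hm, zero_mul]
    · rw [mul_zero]
  · rw [Finset.sum_eq_single (partOf m), if_pos (mem_orbit_partOf m), mul_one, hP.coeff_partOf]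
    · intro mu hmu hne
      obtain ⟨m', -, rfl⟩ := Finset.mem_image.mp hmu
      rw [if_neg, mul_zero]
      exact fun h => hne (partOf_eq_of_mem_orbit (antitone_partOf m') h).symm
    · intro h
      exact absurd (Finset.mem_image_of_mem _ (Finsupp.mem_support_iff.mpr hm)) h

theorem antitone_oneRow (n r : ℕ) : Antitone (oneRow n r) := fun i j h => by
  simp only [oneRow]
  have : (i : ℕ) ≤ j := h
  split_ifs <;> omega

theorem sum_Iic_oneRow {N : ℕ} (r : ℕ) (k : Fin (N + 1)) :
    ∑ i ∈ Finset.Iic k, oneRow (N + 1) r i = r := by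
  rw [Finset.sum_eq_single 0]
  · rfl
  · intro i _ hi
    exact if_neg fun h => hi (Fin.ext h)
  · intro h
    exact absurd (Finset.mem_Iic.mpr (Fin.zero_le k)) h

/-- All partial sums of `(r)` equal `r`, so dominance is implied by the bound on the total degree.
-/
theorem triangular_of_invariant {N r : ℕ} {P : Laurent K (N + 1)} (hP : Invariant P)
    (hsupp : ∀ m, P.coeff m ≠ 0 → ∑ i, (m i).natAbs ≤ r)
    (hlead : P.coeff (fun i => (oneRow (N + 1) r i : ℤ)) = 1) :
    ∃ u : (Fin (N + 1) → ℕ) →₀ K,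
      (∀ mu ∈ u.support, Antitone mu ∧ DomLT mu (oneRow (N + 1) r)) ∧
        P = monoSymm K (oneRow (N + 1) r) + u.sum fun mu e => e • monoSymm K mu := by
  classical
  set lam := oneRow (N + 1) r
  set S := (P.coeff.support.image partOf).erase lam with hS
  let u : (Fin (N + 1) → ℕ) →₀ K := ∑ mu ∈ S, Finsupp.single mu (P.coeff fun i => (mu i : ℤ))
  have hu : u.support ⊆ S := by
    refine (Finsupp.support_finsetSum).trans ?_
    refine Finset.biUnion_subset.mpr fun mu hmu => ?_
    exact Finsupp.support_single_subset.trans (by simpa using hmu)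
  refine ⟨u, fun mu hmu => ?_, ?_⟩
  · obtain ⟨hne, hmem⟩ := Finset.mem_erase.mp (hu hmu)
    obtain ⟨m, hm, rfl⟩ := Finset.mem_image.mp hmem
    refine ⟨antitone_partOf m, hne, fun k => ?_⟩
    rw [sum_Iic_oneRow]
    refine (Finset.sum_le_sum_of_subset (Finset.subset_univ _)).trans ?_
    rw [sum_partOf]
    exact hsupp m (Finsupp.mem_support_iff.mp hm)
  · have hmem : lam ∈ P.coeff.support.image partOf :=
      Finset.mem_image.mpr ⟨_, Finsupp.mem_support_iff.mpr (by rw [hlead]; exact one_ne_zero),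
        partOf_eq_of_mem_orbit (antitone_oneRow _ _) (self_mem_orbit _)⟩
    conv_lhs => rw [hP.eq_sum, ← Finset.add_sum_erase _ _ hmem, hlead, one_smul]
    congr 1
    rw [← Finsupp.sum_finsetSum_index (by simp) (by simp [add_smul])]
    exact Finset.sum_congr rfl fun mu _ => by
      rw [Finsupp.sum_single_index (by simp)]

end Orbits

/-! ### Leading coefficients in the lexicographic order -/

section Leading
variable {n : ℕ}

/-- All exponents of `f` are at most `m` in the lexicographic order, and `c` is the coefficient
of `f` at `m`. -/
def IsLead (f : Laurent K n) (m : Fin n → ℤ) (c : K) : Prop :=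
  (∀ m', f.coeff m' ≠ 0 → toLex m' ≤ toLex m) ∧ f.coeff m = c

theorem IsLead.add {f g : Laurent K n} {m : Fin n → ℤ} {c d : K} (hf : IsLead f m c)
    (hg : IsLead g m d) : IsLead (f + g) m (c + d) := by
  refine ⟨fun m' h => ?_, by rw [AddMonoidAlgebra.coeff_add, Finsupp.add_apply, hf.2, hg.2]⟩
  by_cases h1 : f.coeff m' = 0
  · refine hg.1 m' fun h2 => h ?_
    rw [AddMonoidAlgebra.coeff_add, Finsupp.add_apply, h1, h2, add_zero]
  · exact hf.1 m' h1

theorem coeff_mul_eq (f g : Laurent K n) (p : Fin n → ℤ) :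
    (f * g).coeff p =
      ∑ a ∈ f.coeff.support, ∑ b ∈ g.coeff.support,
        if a + b = p then f.coeff a * g.coeff b else 0 := by
  rw [AddMonoidAlgebra.coeff_mul]
  simp [Finsupp.sum]

/-- The lexicographic order is strictly compatible with addition: `a ≤ m`, `b ≤ p` and `a + b = m +
p` force `a = m` and `b = p`. -/
theorem IsLead.mul {f g : Laurent K n} {m p : Fin n → ℤ} {c d : K} (hf : IsLead f m c)
    (hg : IsLead g p d) : IsLead (f * g) (m + p) (c * d) := by
  constructor
  · intro m' h
    rw [coeff_mul_eq] at h
    obtain ⟨a, ha, h⟩ := Finset.exists_ne_zero_of_sum_ne_zero h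
    obtain ⟨b, hb, h⟩ := Finset.exists_ne_zero_of_sum_ne_zero h
    obtain rfl : a + b = m' := by
      by_contra e; exact h (if_neg e)
    exact add_le_add (hf.1 a (Finsupp.mem_support_iff.mp ha))
      (hg.1 b (Finsupp.mem_support_iff.mp hb))
  · have key : ∀ a ∈ f.coeff.support, ∀ b ∈ g.coeff.support, a + b = m + p → a = m ∧ b = p := by
      intro a ha b hb e
      have h1 := hf.1 a (Finsupp.mem_support_iff.mp ha)
      have h2 := hg.1 b (Finsupp.mem_support_iff.mp hb)
      have e' : toLex a + toLex b = toLex m + toLex p := congrArg toLex e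
      have := (add_eq_add_iff_eq_and_eq h1 h2).mp e'
      exact ⟨toLex.injective this.1, toLex.injective this.2⟩
    rw [coeff_mul_eq, Finset.sum_eq_single m, Finset.sum_eq_single p, if_pos rfl, hf.2, hg.2]
    · intro b _ hb
      exact if_neg fun e => hb (add_left_cancel e)
    · intro h
      rw [if_pos rfl, Finsupp.notMem_support_iff.mp h, mul_zero]
    · intro a ha hne
      refine Finset.sum_eq_zero fun b hb => if_neg fun e => hne (key a ha b hb e).1
    · intro h
      refine Finset.sum_eq_zero fun b _ => ?_
      rw [Finsupp.notMem_support_iff.mp h, zero_mul, ite_self]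

theorem isLead_single (m : Fin n → ℤ) (c : K) : IsLead (AddMonoidAlgebra.single m c) m c := by
  refine ⟨fun m' h => ?_, by simp⟩
  rw [AddMonoidAlgebra.coeff_single, Finsupp.single_apply] at h
  exact (congrArg toLex (by by_contra e; exact h (if_neg fun e' => e e'.symm))).le

theorem isLead_single_of_lt {m p : Fin n → ℤ} (h : toLex m < toLex p) (c : K) :
    IsLead (AddMonoidAlgebra.single m c) p 0 := by
  refine ⟨fun m' h' => ?_, ?_⟩
  · rw [AddMonoidAlgebra.coeff_single, Finsupp.single_apply] at h'
    have : m = m' := by by_contra e; exact h' (if_neg e)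
    exact this ▸ h.le
  · rw [AddMonoidAlgebra.coeff_single, Finsupp.single_apply, if_neg]
    rintro rfl; exact lt_irrefl _ h

/-- Expanded in the order `x_1 ≫ x_2 ≫ ⋯`, the rational function `g` has no exponent larger
than `m`, and `c` is its coefficient at `m`. -/
def RatLead (g : RatFun K n) (m : Fin n → ℤ) (c : K) : Prop :=
  ∃ (D E : Laurent K n) (p : Fin n → ℤ),
    toRat K n D * g = toRat K n E ∧ IsLead D p 1 ∧ IsLead E (p + m) c

theorem RatLead.of_laurent {f : Laurent K n} {m : Fin n → ℤ} {c : K} (h : IsLead f m c) :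
    RatLead (toRat K n f) m c :=
  ⟨1, f, 0, by rw [map_one, one_mul], isLead_single 0 1, by rwa [zero_add]⟩

theorem RatLead.mul {f g : RatFun K n} {m p : Fin n → ℤ} {c d : K} (hf : RatLead f m c)
    (hg : RatLead g p d) : RatLead (f * g) (m + p) (c * d) := by
  obtain ⟨D, E, a, h1, h2, h3⟩ := hf
  obtain ⟨D', E', b, h1', h2', h3'⟩ := hg
  refine ⟨D * D', E * E', a + b, ?_, by simpa using h2.mul h2', ?_⟩
  · rw [map_mul, map_mul, ← h1, ← h1']; ring
  · rw [add_add_add_comm]; exact h3.mul h3'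

theorem RatLead.add {f g : RatFun K n} {m : Fin n → ℤ} {c d : K} (hf : RatLead f m c)
    (hg : RatLead g m d) : RatLead (f + g) m (c + d) := by
  obtain ⟨D, E, a, h1, h2, h3⟩ := hf
  obtain ⟨D', E', b, h1', h2', h3'⟩ := hg
  refine ⟨D * D', D' * E + D * E', a + b, ?_, by simpa using h2.mul h2', ?_⟩
  · rw [map_add, map_mul, map_mul, map_mul, ← h1, ← h1']; ring
  · have e1 := h2'.mul h3
    have e2 := h2.mul h3'
    rw [one_mul, ← add_assoc] at e1 e2
    rw [add_comm b] at e1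
    exact e1.add e2

theorem RatLead.sum {ι : Type*} {s : Finset ι} {f : ι → RatFun K n} {m : Fin n → ℤ} {c : ι → K}
    (h : ∀ i ∈ s, RatLead (f i) m (c i)) : RatLead (∑ i ∈ s, f i) m (∑ i ∈ s, c i) := by
  classical
  induction s using Finset.induction_on with
  | empty =>
    refine ⟨1, 0, 0, by simp, isLead_single 0 1, ?_⟩
    simp [IsLead]
  | insert i s hi ih =>
    rw [Finset.sum_insert hi, Finset.sum_insert hi]
    exact (h i (Finset.mem_insert_self i s)).add
      (ih fun j hj => h j (Finset.mem_insert_of_mem hj))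

theorem RatLead.prod {ι : Type*} {s : Finset ι} {f : ι → RatFun K n} {c : ι → K}
    (h : ∀ i ∈ s, RatLead (f i) 0 (c i)) : RatLead (∏ i ∈ s, f i) 0 (∏ i ∈ s, c i) := by
  classical
  induction s using Finset.induction_on with
  | empty => exact ⟨1, 1, 0, by simp, isLead_single 0 1, isLead_single 0 1⟩
  | insert i s hi ih =>
    rw [Finset.prod_insert hi, Finset.prod_insert hi]
    simpa using (h i (Finset.mem_insert_self i s)).mul
      (ih fun j hj => h j (Finset.mem_insert_of_mem hj))

/-- Cross-multiplication compares two Laurent polynomials at the same exponent; the denominators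
have leading coefficient `1`. -/
theorem RatLead.unique {g : RatFun K n} {m : Fin n → ℤ} {c d : K} (h : RatLead g m c)
    (h' : RatLead g m d) : c = d := by
  obtain ⟨D, E, a, h1, h2, h3⟩ := h
  obtain ⟨D', E', b, h1', h2', h3'⟩ := h'
  have e : D' * E = D * E' := toRat_injective (by rw [map_mul, map_mul, ← h1, ← h1']; ring)
  have e1 := (h2'.mul h3).2
  have e2 := (h2.mul h3').2
  rw [one_mul, ← add_assoc] at e1 e2
  rw [← e1, ← e2, e, add_comm b]

/-- Here `x^w` is large, so the quotient tends to `t`; in `ratLead_of_neg` it is small and the limit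
is `1`. -/
theorem ratLead_of_pos (t : K) {w : Fin n → ℤ} (hw : toLex 0 < toLex w) :
    RatLead ((1 - scal t * toRat K n (mono w)) / (1 - toRat K n (mono w))) 0 t := by
  refine ⟨mono w + AddMonoidAlgebra.single 0 (-1),
    AddMonoidAlgebra.single w t + AddMonoidAlgebra.single 0 (-1), w, ?_, ?_, ?_⟩
  · have hne : 1 - toRat K n (mono w) ≠ 0 := fun h => by
      refine scal_mul_mono_ne (K := K) (m := w) (by rintro rfl; exact lt_irrefl _ hw) 1
        one_ne_zero ?_
      rw [scal, map_one, one_mul]; exact (sub_eq_zero.mp h).symm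
    rw [map_add, map_add, toRat_single, toRat_single, mono_zero, map_one, mul_one]
    simp only [scal, map_neg, map_one]
    field_simp
    ring
  · simpa [mono] using (isLead_single w (1 : K)).add (isLead_single_of_lt hw (-1))
  · simpa using (isLead_single w t).add (isLead_single_of_lt hw (-1))

theorem ratLead_of_neg (t : K) {w : Fin n → ℤ} (hw : toLex w < toLex 0) :
    RatLead ((1 - scal t * toRat K n (mono w)) / (1 - toRat K n (mono w))) 0 1 := by
  refine ⟨1 + AddMonoidAlgebra.single w (-1),
    1 + AddMonoidAlgebra.single w (-t), 0, ?_, ?_, ?_⟩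
  · have hne : 1 - toRat K n (mono w) ≠ 0 := fun h => by
      refine scal_mul_mono_ne (K := K) (m := w) (by rintro rfl; exact lt_irrefl _ hw) 1
        one_ne_zero ?_
      rw [scal, map_one, one_mul]; exact (sub_eq_zero.mp h).symm
    rw [map_add, map_add, toRat_single, toRat_single, map_one]
    simp only [scal, map_neg, map_one]
    field_simp
    ring
  · simpa [AddMonoidAlgebra.one_def] using (isLead_single (n := n) 0 (1 : K)).add (isLead_single_of_lt hw (-1))
  · simpa [AddMonoidAlgebra.one_def] using (isLead_single (n := n) 0 (1 : K)).add (isLead_single_of_lt hw (-t))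

end Leading
end OneRowD
end

noncomputable section
namespace OneRowD
variable {K : Type*} [Field K]

/-! ### Uniqueness -/

section Uniqueness
variable {n : ℕ}

theorem toLex_lt_of_first {v w : Fin n → ℤ} (i : Fin n) (h : ∀ j < i, v j = w j)
    (hi : v i < w i) : toLex v < toLex w := ⟨i, h, hi⟩

theorem prod_erase_ite (t : K) (i : Fin n) (p : Fin n → Prop) [DecidablePred p] (hp : ¬ p i) :
    ∏ j ∈ Finset.univ.erase i, (if p j then t else 1) = t ^ (Finset.univ.filter p).card := by
  rw [Finset.prod_ite, Finset.prod_const, Finset.prod_const_one, mul_one]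
  congr 2
  ext j
  simp only [Finset.mem_filter, Finset.mem_erase, Finset.mem_univ, and_true, true_and]
  exact ⟨fun h => h.2, fun h => ⟨fun e => hp (e ▸ h), h⟩⟩

/-- The leading coefficient of the coefficient function of a letter. -/
def weightLead (t : K) : Letter n → K :=
  Sum.elim (fun i => t ^ (n - 1) * t ^ (n - 1 - (i : ℕ))) fun i => t ^ (i : ℕ)

theorem shiftWeight_X (t : K) (k : Letter n) :
    shiftWeight (scal t) X (letterIdx k) (letterVal X k) =
      ∏ j ∈ Finset.univ.erase (letterIdx k),
        ((1 - scal t * toRat K n (mono (letterWt k + Pi.single j 1))) /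
            (1 - toRat K n (mono (letterWt k + Pi.single j 1))) *
          ((1 - scal t * toRat K n (mono (letterWt k + -Pi.single j 1))) /
            (1 - toRat K n (mono (letterWt k + -Pi.single j 1))))) := by
  refine Finset.prod_congr rfl fun j _ => ?_
  rw [mono_add, mono_add, map_mul, map_mul, toRat_mono_neg, ← letterVal_X, X_eq, mul_div_mul_comm,
    mul_assoc, mul_div_assoc, div_eq_mul_inv (letterVal X k)]

/-- A factor contributes `t` exactly when its exponent is lexicographically positive. For `x_i`
these are all the `x_i x_j`, and the `x_i/x_j` with `i < j`; for `x_i⁻¹` only the `x_j/x_i` with `j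
< i`. -/
theorem ratLead_shiftWeight (t : K) (k : Letter n) :
    RatLead (shiftWeight (scal t) X (letterIdx k) (letterVal X k)) 0 (weightLead t k) := by
  rw [shiftWeight_X]
  rcases k with i | i
  · have h : weightLead t (Sum.inl i) =
        ∏ j ∈ Finset.univ.erase i, (t * if i < j then t else 1) := by
      rw [Finset.prod_mul_distrib, prod_erase_ite t i (fun j => i < j) (lt_irrefl i)]
      have : Finset.univ.filter (fun j => i < j) = Finset.Ioi i := by ext; simp
      rw [this, Fin.card_Ioi, Finset.prod_const, Finset.card_erase_of_mem (Finset.mem_univ i)]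
      simp [weightLead]
    rw [h]
    refine RatLead.prod fun j hj => ?_
    have hij : j ≠ i := Finset.ne_of_mem_erase hj
    rw [← add_zero (0 : Fin n → ℤ)]
    refine RatLead.mul (ratLead_of_pos t ?_) ?_
    · rcases lt_or_gt_of_ne hij with h | h
      · exact toLex_lt_of_first j (fun l hl => by simp [letterWt, hl.ne, (hl.trans h).ne])
          (by simp [letterWt, hij])
      · exact toLex_lt_of_first i (fun l hl => by simp [letterWt, hl.ne, (hl.trans h).ne])
          (by simp [letterWt, hij.symm])
    · split_ifs with h
      · exact ratLead_of_pos t (toLex_lt_of_first i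
          (fun l hl => by simp [letterWt, hl.ne, (hl.trans h).ne]) (by simp [letterWt, hij.symm]))
      · have h := lt_of_le_of_ne (not_lt.mp h) hij
        exact ratLead_of_neg t (toLex_lt_of_first j
          (fun l hl => by simp [letterWt, hl.ne, (hl.trans h).ne]) (by simp [letterWt, hij]))
  · have h : weightLead t (Sum.inr i) =
        ∏ j ∈ Finset.univ.erase i, ((if j < i then t else 1) * 1) := by
      simp only [mul_one]
      rw [prod_erase_ite t i (fun j => j < i) (lt_irrefl i)]
      have : Finset.univ.filter (fun j => j < i) = Finset.Iio i := by ext; simp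
      rw [this, Fin.card_Iio]
      simp [weightLead]
    rw [h]
    refine RatLead.prod fun j hj => ?_
    have hij : j ≠ i := Finset.ne_of_mem_erase hj
    rw [← add_zero (0 : Fin n → ℤ)]
    refine RatLead.mul ?_ (ratLead_of_neg t ?_)
    · split_ifs with h
      · exact ratLead_of_pos t (toLex_lt_of_first j
          (fun l hl => by simp [letterWt, hl.ne, (hl.trans h).ne]) (by simp [letterWt, hij]))
      · have h := lt_of_le_of_ne (not_lt.mp h) hij.symm
        exact ratLead_of_neg t (toLex_lt_of_first i
          (fun l hl => by simp [letterWt, hl.ne, (hl.trans h).ne]) (by simp [letterWt, hij.symm]))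
    · rcases lt_or_gt_of_ne hij with h | h
      · exact toLex_lt_of_first j (fun l hl => by simp [letterWt, hl.ne, (hl.trans h).ne])
          (by simp [letterWt, hij])
      · exact toLex_lt_of_first i (fun l hl => by simp [letterWt, hl.ne, (hl.trans h).ne])
          (by simp [letterWt, hij.symm])

theorem coeff_letterShift {q : K} (hq : q ≠ 0) (k : Letter n) (f : Laurent K n) (m : Fin n → ℤ) :
    (letterShift hq k f).coeff m = f.coeff m * q ^ letterExp k m := by
  induction f using AddMonoidAlgebra.induction_on with
  | of p =>
    rw [AddMonoidAlgebra.of_apply, letterShift_single, AddMonoidAlgebra.coeff_single,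
      AddMonoidAlgebra.coeff_single, Finsupp.single_apply, Finsupp.single_apply]
    split_ifs with h
    · rw [← h]
    · rw [zero_mul]
  | add f g hf hg =>
    simp only [map_add, AddMonoidAlgebra.coeff_add, Finsupp.add_apply, hf, hg, add_mul]
  | smul c f hf =>
    simp only [map_smul, AddMonoidAlgebra.coeff_smul, Finsupp.smul_apply, hf, smul_eq_mul,
      mul_assoc]

theorem IsLead.letterShift_sub {q : K} (hq : q ≠ 0) (k : Letter n) {f : Laurent K n}
    {p : Fin n → ℤ} {c : K} (h : IsLead f p c) :
    IsLead (letterShift hq k f - f) p (c * (q ^ letterExp k p - 1)) := by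
  have e : ∀ m, (letterShift hq k f - f).coeff m = f.coeff m * (q ^ letterExp k m - 1) := fun m => by
    rw [AddMonoidAlgebra.coeff_sub, Finsupp.sub_apply, coeff_letterShift, mul_sub, mul_one]
  refine ⟨fun m hm => h.1 m fun h0 => hm ?_, by rw [e, h.2]⟩
  rw [e, h0, zero_mul]

theorem ratLead_shiftOp {q : K} (hq : q ≠ 0) (t : K) {f : Laurent K n} {p : Fin n → ℤ} {c : K}
    (h : IsLead f p c) : RatLead (shiftOp hq t n f) p
      (∑ k : Letter n, weightLead t k * (c * (q ^ letterExp k p - 1))) := by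
  rw [shiftOp_apply]
  refine RatLead.sum fun k _ => ?_
  rw [← map_sub]
  simpa using (ratLead_shiftWeight t k).mul (RatLead.of_laurent (h.letterShift_sub hq k))

/-- The letters `x_i` and `x_i⁻¹` together give `t^{n-1}` times the `i`-th bracket of the
eigenvalue. -/
theorem sum_weightLead {q t : K} (hq : q ≠ 0) (ht : t ≠ 0) (mu : Fin n → ℕ) :
    ∑ k : Letter n, weightLead t k * (q ^ letterExp k (fun i => (mu i : ℤ)) - 1) =
      t ^ (n - 1) * koornwinderEigenvalue 1 q t mu := by
  rw [Fintype.sum_sum_type, ← Finset.sum_add_distrib, koornwinderEigenvalue, Finset.mul_sum]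
  refine Finset.sum_congr rfl fun i _ => ?_
  have e : t ^ (n - 1) = t ^ (n - 1 - (i : ℕ)) * t ^ (i : ℕ) := by
    rw [← pow_add]; congr 1; have := i.2; omega
  simp only [weightLead, letterExp, Sum.elim_inl, Sum.elim_inr, bracket, zpow_natCast, zpow_neg,
    one_mul]
  have ha : t ^ (n - 1 - (i : ℕ)) ≠ 0 := pow_ne_zero _ ht
  have hw : q ^ mu i ≠ 0 := pow_ne_zero _ hq
  rw [e]
  generalize t ^ (n - 1 - (i : ℕ)) = a at *
  generalize q ^ mu i = w at *
  field_simp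
  ring

/-- A negative entry could be flipped, or an ascent swapped, to give a lexicographically larger
exponent of the support. -/
theorem Invariant.exists_partition {f : Laurent K n} (hf : Invariant f) {p : Fin n → ℤ}
    (hp : f.coeff p ≠ 0) (hmax : ∀ m, f.coeff m ≠ 0 → toLex m ≤ toLex p) :
    ∃ mu : Fin n → ℕ, Antitone mu ∧ p = fun i => (mu i : ℤ) := by
  have hnn : ∀ i, 0 ≤ p i := by
    intro i
    by_contra h
    refine absurd (hmax (signedPerm 1 (Function.update 1 i (-1)) p) (by rwa [hf])) (not_le.mpr ?_)
    refine toLex_lt_of_first i (fun j hj => ?_) ?_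
    · simp [signedPerm, Function.update_of_ne hj.ne]
    · simp [signedPerm]; omega
  have hanti : Antitone p := by
    intro i j hij
    by_contra h
    have hlt : i < j := lt_of_le_of_ne hij (by rintro rfl; exact h le_rfl)
    refine absurd (hmax (signedPerm (Equiv.swap i j) 1 p) (by rwa [hf])) (not_le.mpr ?_)
    refine toLex_lt_of_first i (fun l hl => ?_) ?_
    · simp [signedPerm, Equiv.swap_apply_of_ne_of_ne hl.ne (hl.trans hlt).ne]
    · simp [signedPerm]; omega
  refine ⟨fun i => (p i).toNat, fun i j h => ?_, ?_⟩
  · exact Int.toNat_le_toNat (hanti h)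
  · ext i
    exact (Int.toNat_of_nonneg (hnn i)).symm

theorem coeff_of_triangular {lam : Fin n → ℕ} (hlam : Antitone lam) {P : Laurent K n}
    {u : (Fin n → ℕ) →₀ K} (hu : ∀ mu ∈ u.support, Antitone mu)
    (hP : P = monoSymm K lam + u.sum fun mu e => e • monoSymm K mu) {nu : Fin n → ℕ}
    (hnu : Antitone nu) :
    P.coeff (fun i => (nu i : ℤ)) = (if nu = lam then 1 else 0) + u nu := by
  have h : ∀ mu : Fin n → ℕ, Antitone mu →
      (monoSymm K mu).coeff (fun i => (nu i : ℤ)) = if nu = mu then 1 else 0 := by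
    intro mu hmu
    rw [coeff_monoSymm]
    refine if_congr ⟨fun h => ?_, ?_⟩ rfl rfl
    · rw [← partOf_eq_of_mem_orbit hmu h, partOf_eq_of_mem_orbit hnu (self_mem_orbit nu)]
    · rintro rfl; exact self_mem_orbit _
  rw [hP, AddMonoidAlgebra.coeff_add, Finsupp.add_apply, h lam hlam, Finsupp.sum,
    AddMonoidAlgebra.coeff_sum, Finsupp.finsetSum_apply]
  congr 1
  rw [Finset.sum_congr rfl fun mu hmu => by
    rw [AddMonoidAlgebra.coeff_smul, Finsupp.smul_apply, h mu (hu mu hmu)]]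
  simp

/-- At the lexicographically largest exponent `μ` of a nonzero `P - Q`, the operator multiplies the
coefficient by `t^{n-1} d_μ` and, by the eigenvalue equations, by `t^{n-1} d_λ`. -/
theorem eq_of_isMacdonaldD {s t : K} (hq : s ^ 2 ≠ 0) (ht : t ≠ 0) {lam : Fin n → ℕ}
    (hlam : Antitone lam)
    (hd : ∀ mu : Fin n → ℕ, Antitone mu → DomLT mu lam →
      koornwinderEigenvalue 1 (s ^ 2) t mu ≠ koornwinderEigenvalue 1 (s ^ 2) t lam)
    {P Q : Laurent K n} (hP : IsMacdonaldD s t lam P) (hQ : IsMacdonaldD s t lam Q) : P = Q := by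
  by_contra hne
  have hT : (scal (t ^ (n - 1)) : RatFun K n) ≠ 0 := by simpa [scal] using fun h => absurd h ht
  have heig : ∀ {P : Laurent K n}, IsMacdonaldD s t lam P → shiftOp hq t n P =
      toRat K n ((t ^ (n - 1) * koornwinderEigenvalue 1 (s ^ 2) t lam) • P) := by
    intro P hP
    have h := hP.eigen
    rw [koornwinderOp_eq hq, inv_mul_eq_iff_eq_mul₀ hT] at h
    rw [h, map_smul, Algebra.smul_def, map_mul, mul_assoc]; rfl
  obtain ⟨p, hp, hmax⟩ := Finset.exists_max_image (P - Q).coeff.support toLex (by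
    rw [Finsupp.support_nonempty_iff]
    intro h
    exact hne (sub_eq_zero.mp (AddMonoidAlgebra.ext h)))
  rw [Finsupp.mem_support_iff] at hp
  have hmax : ∀ m, (P - Q).coeff m ≠ 0 → toLex m ≤ toLex p := fun m hm =>
    hmax m (Finsupp.mem_support_iff.mpr hm)
  have hinv : Invariant (P - Q) := fun σ ε m => by
    rw [AddMonoidAlgebra.coeff_sub, Finsupp.sub_apply, Finsupp.sub_apply, hP.invariant,
      hQ.invariant]
  obtain ⟨mu, hmu, rfl⟩ := hinv.exists_partition hp hmax
  have hlead : IsLead (P - Q) (fun i => (mu i : ℤ)) _ := ⟨hmax, rfl⟩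
  have h1 := ratLead_shiftOp hq t hlead
  have h2 : RatLead (shiftOp hq t n (P - Q)) (fun i => (mu i : ℤ))
      (t ^ (n - 1) * koornwinderEigenvalue 1 (s ^ 2) t lam *
        (P - Q).coeff (fun i => (mu i : ℤ))) := by
    rw [map_sub, heig hP, heig hQ, ← map_sub, ← smul_sub]
    refine RatLead.of_laurent ⟨fun m hm => hmax m fun h0 => hm ?_, ?_⟩
    · rw [AddMonoidAlgebra.coeff_smul, Finsupp.smul_apply, h0, smul_zero]
    · rw [AddMonoidAlgebra.coeff_smul, Finsupp.smul_apply, smul_eq_mul]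
  have h3 := h1.unique h2
  rw [Finset.sum_congr rfl fun k _ => by rw [mul_left_comm], ← Finset.mul_sum,
    sum_weightLead hq ht, mul_comm] at h3
  have h4 := mul_left_cancel₀ (pow_ne_zero _ ht) (mul_right_cancel₀ hp h3)
  refine hd mu hmu ?_ h4
  -- The terms `m_λ` cancel in `P - Q`, so `μ` occurs among the lower terms of `P` or of `Q`.
  obtain ⟨u, hu, hPu⟩ := hP.triangular
  obtain ⟨v, hv, hQv⟩ := hQ.triangular
  rw [AddMonoidAlgebra.coeff_sub, Finsupp.sub_apply,
    coeff_of_triangular hlam (fun mu h => (hu mu h).1) hPu hmu,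
    coeff_of_triangular hlam (fun mu h => (hv mu h).1) hQv hmu, add_sub_add_left_eq_sub] at hp
  by_cases h0 : u mu = 0
  · exact (hv mu (Finsupp.mem_support_iff.mpr fun h => hp (by rw [h0, h, sub_zero]))).2
  · exact (hu mu (Finsupp.mem_support_iff.mpr h0)).2

end Uniqueness

/-! ### The leading monomial of the tableau sum -/

section Leading

theorem sum_natAbs_le_of_coeff_ne_zero {n r : ℕ} {q t : K} {m : Fin n → ℤ}
    (h : (tableauSum n r q t).coeff m ≠ 0) : ∑ i, (m i).natAbs ≤ r := by
  rw [tableauSum, AddMonoidAlgebra.coeff_smul, Finsupp.smul_apply, AddMonoidAlgebra.coeff_sum,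
    Finsupp.finsetSum_apply] at h
  obtain ⟨θ, hθ, h⟩ := Finset.exists_ne_zero_of_sum_ne_zero (right_ne_zero_of_smul h)
  rw [AddMonoidAlgebra.coeff_smul, Finsupp.smul_apply, coeff_mono] at h
  have e : (fun i => (θ (Sum.inl i) : ℤ) - (θ (Sum.inr i) : ℤ)) = m := by
    by_contra e
    exact h (by rw [if_neg e, smul_zero])
  rw [← e, ← (mem_fillings.mp hθ).1, Fintype.sum_sum_type, ← Finset.sum_add_distrib]
  exact Finset.sum_le_sum fun i _ => by dsimp only; omega

/-- The monomial `x_1^r` forces all `r` letters to be `1`; the weight `(t;q)_r/(q;q)_r` of this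
filling cancels the normalising factor. -/
theorem coeff_tableauSum_oneRow {N r : ℕ} {q t : K} (hq : qPoch q q r ≠ 0)
    (ht : qPoch t q r ≠ 0) :
    (tableauSum (N + 1) r q t).coeff (fun i => (oneRow (N + 1) r i : ℤ)) = 1 := by
  rw [tableauSum, AddMonoidAlgebra.coeff_smul, Finsupp.smul_apply, AddMonoidAlgebra.coeff_sum,
    Finsupp.finsetSum_apply]
  simp only [AddMonoidAlgebra.coeff_smul, Finsupp.smul_apply, coeff_mono]
  obtain ⟨θ₀, h₀⟩ : ∃ θ₀ : Letter (N + 1) → ℕ, θ₀ = Sum.elim (oneRow (N + 1) r) fun _ => 0 := ⟨_, rfl⟩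
  have hinr : ∀ i, θ₀ (Sum.inr i) = 0 := fun i => by rw [h₀]; rfl
  have hzero : oneRow (N + 1) r 0 = r := rfl
  have hsucc : ∀ i : Fin N, oneRow (N + 1) r i.succ = 0 := fun i => if_neg (by simp)
  rw [Finset.sum_eq_single θ₀]
  · have h1 : ∏ k : Letter (N + 1), qPoch t q (θ₀ k) / qPoch q q (θ₀ k) =
        qPoch t q r / qPoch q q r := by
      rw [Fintype.prod_sum_type, Fin.prod_univ_succ]
      simp [h₀, hzero, hsucc, qPoch_zero]
    have h2 : ∀ l, factor q t θ₀ l = 1 := fun l => by simp [factor, hinr, qPoch_zero]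
    rw [h1, if_pos (by ext i; simp [h₀])]
    simp only [h2, Finset.prod_const_one, mul_one, smul_eq_mul]
    field_simp
  · intro θ hθ hne
    rw [if_neg, smul_zero]
    intro e
    apply hne
    have hsum := (mem_fillings.mp hθ).1
    have e0 := congrFun e 0
    rw [hzero] at e0
    rw [← Finset.add_sum_erase _ _ (Finset.mem_univ (Sum.inl 0))] at hsum
    have h3 : ∑ k ∈ Finset.univ.erase (Sum.inl 0), θ k = 0 := by omega
    rw [Finset.sum_eq_zero_iff] at h3
    have h4 : θ (Sum.inl 0) = r := by
      have := h3 (Sum.inr 0) (by simp)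
      omega
    ext (i | i)
    · refine Fin.cases ?_ (fun i => ?_) i
      · rw [h4, h₀]; rfl
      · rw [h3 _ (by simp), h₀, Sum.elim_inl, hsucc]
    · rw [h3 _ (by simp), hinr]
  · intro h
    refine absurd ?_ h
    rw [mem_fillings]
    refine ⟨?_, fun i _ => by rw [hinr, mul_zero]⟩
    rw [Fintype.sum_sum_type, Fin.sum_univ_succ]
    simp [h₀, hzero, hsucc]

end Leading

/-! ### The theorem -/

theorem isMacdonaldD_tableauSum {s t : K} (N : ℕ) (ht : t ≠ 0) (hq : s ^ 2 ≠ 0)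
    (hqt : ∀ a b : ℕ, a ≤ N + 1 → (a, b) ≠ (0, 0) → t ^ a * (s ^ 2) ^ b ≠ 1) (r : ℕ) :
    IsMacdonaldD s t (oneRow (N + 1) r) (tableauSum (N + 1) r (s ^ 2) t) := by
  have hinv : Invariant (tableauSum (N + 1) r (s ^ 2) t) := fun σ ε m => by
    rw [← coeff_signedMap σ ε _ m, tableauSum_eq, map_smul, signedMap_oneRowFun hq ht N hqt]
  refine ⟨hinv, ?_, ?_⟩
  · refine triangular_of_invariant hinv (fun m => sum_natAbs_le_of_coeff_ne_zero) ?_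
    refine coeff_tableauSum_oneRow (qPoch_self_ne_zero (fun j hj => ?_) r) (qPoch_ne_zero fun i _ => ?_)
    · simpa using hqt 0 j (by omega) (by simp; omega)
    · simpa using hqt 1 i (by omega) (by simp)
  · rw [tableauSum_eq, koornwinderOp_eq hq, map_smul, mul_smul_comm, ← koornwinderOp_eq hq,
      koornwinderOp_oneRowFun N ht hq hqt, ← toRat_apply, ← toRat_apply, map_smul, mul_smul_comm]

end OneRowD
end
theorem mainTheorem1 {K : Type*} [Field K] (n : ℕ) (hn : 1 ≤ n) (r : ℕ) (q s t : K)
    (hs : s ^ 2 = q) (hq : q ≠ 0) (ht : t ≠ 0)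
    (hqt : ∀ a b : ℕ, a ≤ n → (a, b) ≠ (0, 0) → t ^ a * q ^ b ≠ 1) :
    OneRowD.IsMacdonaldD s t (OneRowD.oneRow n r) (OneRowD.tableauSum n r q t) ∧
      ((∀ mu : Fin n → ℕ, Antitone mu → OneRowD.DomLT mu (OneRowD.oneRow n r) →
          OneRowD.koornwinderEigenvalue 1 q t mu ≠
            OneRowD.koornwinderEigenvalue 1 q t (OneRowD.oneRow n r)) →
        ∀ P : OneRowD.Laurent K n, OneRowD.IsMacdonaldD s t (OneRowD.oneRow n r) P →
          P = OneRowD.tableauSum n r q t) := by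
  obtain ⟨N, rfl⟩ := Nat.exists_eq_add_of_le' hn
  subst hs
  have h := OneRowD.isMacdonaldD_tableauSum N ht hq hqt r
  exact ⟨h, fun hd P hP => OneRowD.eq_of_isMacdonaldD hq ht (OneRowD.antitone_oneRow _ _) hd hP h⟩
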